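/- Let $H\in(0,1)$ and $K\in(0,1]$ satisfy $2HK=1$. There is a constant $C_{H,K}>0$, depending only on $H$ and $K$, such that the following holds for every $T>0$. Let $B=\{B_t,\,0\le t\le T\}$ be a bi-fractional Brownian motion with indices $H,K$ on a probability space $(\Omega,\mathscr F,P)$, i.e. a centered Gaussian process with $B_0=0$, almost surely continuous paths and covariance $$E[B_tB_s]=\frac1{2^K}\left[\left(t^{2H}+s^{2H}\right)^K-|t-s|^{2HK}\right],\qquad 0\le s,t\le T .$$ Let $\mathscr H$ be the space of measurable functions $f:\mathbb R\to\mathbb R$ such that $$\|f\|_{\mathscr H}^2:=\int_0^T\!\!\int_{\mathbb R}|f(x)|^2\varphi_s(x)\,dx\,ds+\int_0^T\!\!\int_{\mathbb R}|f(x)x|^2\varphi_s(x)\,\frac{dx\,ds}{s}<\infty,\qquad \varphi_s(x)=\frac1{\sqrt{2\pi s}}e^{-x^2/(2s)} .$$ For $f\in\mathscr H$, $t\in[0,T]$ and $0<\varepsilon<T$ let $t_\varepsilon=\min(t,T-\varepsilon)$ (so that only times in $[0,T]$ occur below, and $t_\varepsilon=t$ whenever $t<T$ and $\varepsilon\le T-t$).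 Then the limits $$\int_0^tf(B_s)\,d^-B_s:=\lim_{\varepsilon\downarrow0}\frac1\varepsilon\int_0^{t_\varepsilon}f(B_s)(B_{s+\varepsilon}-B_s)\,ds,$$ $$\int_0^tf(B_s)\,d^+B_s:=\lim_{\varepsilon\downarrow0}\frac1\varepsilon\int_0^{t_\varepsilon}f(B_{s+\varepsilon})(B_{s+\varepsilon}-B_s)\,ds,$$ $$[f(B),B]_t:=\lim_{\varepsilon\downarrow0}\frac1\varepsilon\int_0^{t_\varepsilon}\{f(B_{s+\varepsilon})-f(B_s)\}(B_{s+\varepsilon}-B_s)\,ds$$ exist in $L^2(\Omega)$ for all $f\in\mathscr H$ and $0\le t\le T$ (in particular, for all sufficiently small $\varepsilon$ the approximating integrals converge absolutely almost surely and belong to $L^2(\Omega)$), and $$E\left|\int_0^tf(B_s)\,d^{-}B_s\right|^2\le C_{H,K}\|f\|_{\mathscr H}^2,\qquad E\left|\int_0^tf(B_s)\,d^{+}B_s\right|^2\le C_{H,K}\|f\|_{\mathscr H}^2$$ for all $0\le t\le T$. -/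

import Mathlib

open MeasureTheory ProbabilityTheory Filter Topology Set

/-- `B` is a (continuous version of a) bi-fractional Brownian motion with indices `H`, `K` on the
time interval `[0, T]`; the values `B t` for `t` outside `[0, T]` are irrelevant. -/
structure IsBifractionalBM {Ω : Type*} [MeasurableSpace Ω] (H K T : ℝ) (B : ℝ → Ω → ℝ)
    (P : Measure Ω) : Prop where
  isGaussian : IsGaussianProcess (fun t : Icc (0 : ℝ) T => B t) P
  zero_start : ∀ᵐ ω ∂P, B 0 ω = 0
  centered : ∀ t ∈ Icc (0 : ℝ) T, ∫ ω, B t ω ∂P = 0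
  covariance : ∀ s ∈ Icc (0 : ℝ) T, ∀ t ∈ Icc (0 : ℝ) T,
    ∫ ω, B t ω * B s ω ∂P =
      1 / (2 : ℝ) ^ K * ((t ^ (2 * H) + s ^ (2 * H)) ^ K - |t - s| ^ (2 * H * K))
  continuous_paths : ∀ᵐ ω ∂P, ContinuousOn (fun t => B t ω) (Icc (0 : ℝ) T)

/-- The centered Gaussian density `φ_s` of variance `s > 0`. -/
noncomputable def gaussDensity (s x : ℝ) : ℝ :=
  1 / √(2 * Real.pi * s) * Real.exp (-(x ^ 2 / (2 * s)))

/-- The squared norm `‖f‖²_𝓗` as an extended nonnegative number. -/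
noncomputable def eNormSqH (T : ℝ) (f : ℝ → ℝ) : ENNReal :=
  (∫⁻ s in Ioc (0 : ℝ) T, ∫⁻ x : ℝ, ENNReal.ofReal (|f x| ^ 2 * gaussDensity s x)) +
    ∫⁻ s in Ioc (0 : ℝ) T, ∫⁻ x : ℝ, ENNReal.ofReal (|f x * x| ^ 2 * gaussDensity s x / s)

/-- Membership in the space `𝓗`: `f` is (a.e.) measurable and `‖f‖_𝓗 < ∞`. -/
def MemH (T : ℝ) (f : ℝ → ℝ) : Prop :=
  AEMeasurable f ∧ eNormSqH T f < ⊤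

/-- The norm `‖f‖_𝓗`. -/
noncomputable def normH (T : ℝ) (f : ℝ → ℝ) : ℝ :=
  √(eNormSqH T f).toReal

/-- The integrand of the forward approximation. -/
def forwardIntegrand {Ω : Type*} (B : ℝ → Ω → ℝ) (f : ℝ → ℝ) (ε : ℝ) (s : ℝ) (ω : Ω) : ℝ :=
  f (B s ω) * (B (s + ε) ω - B s ω)

/-- The integrand of the backward approximation. -/
def backwardIntegrand {Ω : Type*} (B : ℝ → Ω → ℝ) (f : ℝ → ℝ) (ε : ℝ) (s : ℝ) (ω : Ω) : ℝ :=
  f (B (s + ε) ω) * (B (s + ε) ω - B s ω)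

/-- The integrand of the approximation of the quadratic covariation. -/
def covariationIntegrand {Ω : Type*} (B : ℝ → Ω → ℝ) (f : ℝ → ℝ) (ε : ℝ) (s : ℝ) (ω : Ω) : ℝ :=
  (f (B (s + ε) ω) - f (B s ω)) * (B (s + ε) ω - B s ω)

/-- `I` is the limit in `L²(P)`, as `ε ↓ 0`, of `ε⁻¹ ∫_0^t g ε s ds`. The process lives on `[0, T]`,
so `s` runs over those times in `[0, t]` with `s + ε ≤ T`: the upper limit is `t` as soon as
`ε ≤ T - t`, and it is `T - ε` when `t = T`. For small `ε` the pathwise integrals are required to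
exist almost surely and to define elements of `L²(P)`. -/
def IsRegularizedLimit {Ω : Type*} [MeasurableSpace Ω] (P : Measure Ω) (T : ℝ)
    (g : ℝ → ℝ → Ω → ℝ) (t : ℝ) (I : Ω → ℝ) : Prop :=
  (∀ᶠ ε in 𝓝[>] (0 : ℝ),
    (∀ᵐ ω ∂P, IntervalIntegrable (fun s => g ε s ω) volume 0 (min t (T - ε))) ∧
    MemLp (fun ω => 1 / ε * ∫ s in (0 : ℝ)..min t (T - ε), g ε s ω) 2 P) ∧
  MemLp I 2 P ∧
  Tendsto (fun ε : ℝ =>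
      eLpNorm (fun ω => (1 / ε * ∫ s in (0 : ℝ)..min t (T - ε), g ε s ω) - I ω) 2 P)
    (𝓝[>] 0) (𝓝 0)

/-- `I` is the forward integral `∫_0^t f(B_s) d⁻B_s`, as a limit in `L²(P)`. -/
def IsForwardIntegral {Ω : Type*} [MeasurableSpace Ω] (P : Measure Ω) (T : ℝ) (B : ℝ → Ω → ℝ)
    (f : ℝ → ℝ) (t : ℝ) (I : Ω → ℝ) : Prop :=
  IsRegularizedLimit P T (forwardIntegrand B f) t I

/-- `I` is the backward integral `∫_0^t f(B_s) d⁺B_s`, as a limit in `L²(P)`. -/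
def IsBackwardIntegral {Ω : Type*} [MeasurableSpace Ω] (P : Measure Ω) (T : ℝ) (B : ℝ → Ω → ℝ)
    (f : ℝ → ℝ) (t : ℝ) (I : Ω → ℝ) : Prop :=
  IsRegularizedLimit P T (backwardIntegrand B f) t I

/-- `Q` is the quadratic covariation `[f(B), B]_t`, as a limit in `L²(P)`. -/
def IsQuadraticCovariation {Ω : Type*} [MeasurableSpace Ω] (P : Measure Ω) (T : ℝ)
    (B : ℝ → Ω → ℝ) (f : ℝ → ℝ) (t : ℝ) (Q : Ω → ℝ) : Prop :=
  IsRegularizedLimit P T (covariationIntegrand B f) t Q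

/-!
Write `p = 2 * H`, so that `p * K = 1` and `1 ≤ p ≤ 2`. The covariance of `B` is
`2 ^ (-K) * (‖(s, t)‖_p - |t - s|)` with the `ℓ^p` norm on the plane, hence `Var B_s = s`, and `B`
behaves at small scales like a Brownian motion: an increment over `[s, s + ε]` has variance
`2 ^ (1 - K) * ε + O(ε ^ 2 / s)`, and increments over disjoint intervals `[a, b]`, `[c, d]` with
`b ≤ c` have covariance at most `(b - a) * (d - c) / c`, because the mixed second derivative of the
norm is at most `1 / c` (`abs_bifracCov_rect_le`, `abs_bifracCov_incr_sub_le`).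

*Uniform bounds.* The second moment of an approximation is
`ε ^ (-2) ∬ E[f(B_s) ΔB_s f(B_r) ΔB_r] dr ds`. Split each increment into its projection on the span
of `B_r` and `B_s` and a remainder independent of both. The remainders contribute their covariance,
and the projections contribute the product of their standard deviations, at the price of replacing
`E f(B_s)²` by `W(s) = E[f(B_s)² (1 + B_s² / s)]` (`abs_integral_mul_mul_le`). Since
`Var(B_s | B_r) ≥ s - r`, the projections are so small that the correlation is at most
`38 ε² √W(r) √W(s) / √(r (s - r))` for `r + 2 ε ≤ s`, both for forward and for backward increments
(`forward_far`, `backward_far`); near the diagonal the Cauchy-Schwarz inequality suffices. The norm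
of `𝓗` is `∫ W`, and Schur's test with the weight `s ^ (1 / 4)` bounds the double integral by
`∫ (T / s) ^ (1 / 4) W(s) ds`, which is at most `2 ‖f‖²`: this follows from explicit antiderivatives
in time of the Gaussian density (`lintegral_corrKernel_le`, `lintegral_rpow_mul_hWeight_le`). So the
approximations are bounded in `L²` by `√1240 ‖f‖`, uniformly in `ε` (`forward_bound`,
`backward_bound`).

*Convergence on a dense class.* The same integration in time shows that `𝓗` is the `L²` space of the
law of `B_T`, so `C²` functions of compact support are dense in it. For such an `f` with
antiderivative `F`, Taylor's formula expresses the approximations through averages of `F(B)`, the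
weighted quadratic variation `ε⁻¹ ∫ f'(B_s) (ΔB_s)² ds`, and remainders of third order in the
increments. The quadratic variation converges to `2 ^ (1 - K) ∫ f'(B_s) ds`
(`l2Tendsto_quadVar`): the correlation of the centered squares at two times is `O(ε ^ 3)`, by
projecting one increment on the span of `B_r`, `B_s` and the other increment.

The uniform bounds and completeness of `L²` extend the limits to all of `𝓗`; the covariation is the
difference of the backward and the forward integrals.

All this is done for a version of `B` with continuous paths and measurable variables, and for a
Borel function `f`. As `B_s` has a density for `s > 0`, changing `f` on a null set does not affect
the approximating integrals.
-/

/-! ### The covariance function -/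

/-- The function `(x ^ p + y ^ p) ^ K`; for `p * K = 1` it is the `ℓ^p` norm of `(x, y)`. -/
noncomputable def powSum (p K x y : ℝ) : ℝ := (x ^ p + y ^ p) ^ K

/-- The partial derivative of `powSum p K` in the first variable, when `p * K = 1`. -/
noncomputable def powSumDeriv (p K x y : ℝ) : ℝ := x ^ (p - 1) * (x ^ p + y ^ p) ^ (K - 1)

section PowSum

variable {p K : ℝ}

lemma powSum_comm (x y : ℝ) : powSum p K x y = powSum p K y x := by
  simp [powSum, add_comm]

lemma powSum_self (hpK : p * K = 1) {x : ℝ} (hx : 0 ≤ x) : powSum p K x x = 2 ^ K * x := by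
  have : x ^ p + x ^ p = 2 * x ^ p := by ring
  rw [powSum, this, Real.mul_rpow (by norm_num) (by positivity), ← Real.rpow_mul hx, hpK,
    Real.rpow_one]

lemma powSum_zero (hp : 1 ≤ p) (hpK : p * K = 1) {x : ℝ} (hx : 0 ≤ x) : powSum p K x 0 = x := by
  rw [powSum, Real.zero_rpow (by linarith), add_zero, ← Real.rpow_mul hx, hpK, Real.rpow_one]

lemma hasDerivAt_powSum (hpK : p * K = 1) {x y : ℝ} (hx : 0 < x) (hy : 0 ≤ y) :
    HasDerivAt (fun z => powSum p K z y) (powSumDeriv p K x y) x := by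
  have hS : 0 < x ^ p + y ^ p := by positivity
  have h1 : HasDerivAt (fun z : ℝ => z ^ p + y ^ p) (p * x ^ (p - 1)) x :=
    (Real.hasDerivAt_rpow_const (Or.inl hx.ne')).add_const _
  have h2 := h1.rpow_const (p := K) (Or.inl hS.ne')
  refine h2.congr_deriv ?_
  rw [powSumDeriv]
  linear_combination (x ^ (p - 1) * (x ^ p + y ^ p) ^ (K - 1)) * hpK

lemma powSumDeriv_nonneg {x y : ℝ} (hx : 0 < x) (hy : 0 ≤ y) : 0 ≤ powSumDeriv p K x y := by
  unfold powSumDeriv; positivity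

lemma rpow_sub_one_le_powSum (hp : 1 ≤ p) (hpK : p * K = 1) {x S : ℝ} (hx : 0 ≤ x)
    (hS : x ^ p ≤ S) : x ^ (p - 1) ≤ S ^ (1 - K) := by
  have hK1 : K ≤ 1 := by nlinarith
  calc x ^ (p - 1) = (x ^ p) ^ (1 - K) := by
        rw [← Real.rpow_mul hx]; congr 1; linear_combination hpK
    _ ≤ S ^ (1 - K) := Real.rpow_le_rpow (by positivity) hS (by linarith)

lemma powSumDeriv_le_one (hp : 1 ≤ p) (hpK : p * K = 1) {x y : ℝ} (hx : 0 < x) (hy : 0 ≤ y) :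
    powSumDeriv p K x y ≤ 1 := by
  have hS : 0 < x ^ p + y ^ p := by positivity
  have h := rpow_sub_one_le_powSum hp hpK (S := x ^ p + y ^ p) hx.le
    (by have := Real.rpow_nonneg hy p; linarith)
  calc powSumDeriv p K x y ≤ (x ^ p + y ^ p) ^ (1 - K) * (x ^ p + y ^ p) ^ (K - 1) := by
        unfold powSumDeriv; gcongr
    _ = 1 := by rw [← Real.rpow_add hS]; simp

lemma hasDerivAt_powSumDeriv (hp : 1 ≤ p) {x y : ℝ} (hx : 0 < x) (hy : 0 ≤ y) :
    HasDerivAt (fun z => powSumDeriv p K x z)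
      (x ^ (p - 1) * (p * y ^ (p - 1) * (K - 1) * (x ^ p + y ^ p) ^ (K - 1 - 1))) y := by
  have hS : 0 < x ^ p + y ^ p := by positivity
  have h1 : HasDerivAt (fun z : ℝ => x ^ p + z ^ p) (p * y ^ (p - 1)) y :=
    (Real.hasDerivAt_rpow_const (Or.inr hp)).const_add _
  exact (h1.rpow_const (p := K - 1) (Or.inl hS.ne')).const_mul _

/-- The mixed second derivative of the `ℓ^p` norm on the quadrant is at most `1 / x`. -/
lemma abs_deriv_powSumDeriv_le (hp : 1 ≤ p) (hp2 : p ≤ 2) (hpK : p * K = 1) {x y : ℝ}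
    (hx : 0 < x) (hy : 0 ≤ y) :
    |x ^ (p - 1) * (p * y ^ (p - 1) * (K - 1) * (x ^ p + y ^ p) ^ (K - 1 - 1))| ≤ 1 / x := by
  have hK1 : K ≤ 1 := by nlinarith
  have hyp := Real.rpow_nonneg hy p
  have hxp := Real.rpow_pos_of_pos hx p
  set S := x ^ p + y ^ p with hSdef
  have hS : 0 < S := by positivity
  have e : x ^ (p - 1) * (p * y ^ (p - 1) * (K - 1) * S ^ (K - 1 - 1)) =
      -((p - 1) * (x ^ (p - 1) * y ^ (p - 1) * S ^ (K - 1 - 1))) := by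
    linear_combination (x ^ (p - 1) * y ^ (p - 1) * S ^ (K - 1 - 1)) * hpK
  rw [e, abs_neg, abs_of_nonneg (mul_nonneg (by linarith) (by positivity)), le_div_iff₀ hx]
  have hxx : x ^ (p - 1) * x = x ^ p := by
    rw [← Real.rpow_add_one hx.ne']; simp
  have h2 := rpow_sub_one_le_powSum hp hpK (S := S) hy (by linarith)
  calc (p - 1) * (x ^ (p - 1) * y ^ (p - 1) * S ^ (K - 1 - 1)) * x
      = (p - 1) * ((x ^ (p - 1) * x) * y ^ (p - 1) * S ^ (K - 1 - 1)) := by ring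
    _ ≤ 1 * (S * S ^ (1 - K) * S ^ (K - 1 - 1)) := by
        rw [hxx]
        gcongr
        · linarith
        · linarith
    _ = 1 := by
        rw [mul_assoc S, ← Real.rpow_add hS, one_mul]
        have : (1 - K + (K - 1 - 1)) = (-1 : ℝ) := by ring
        rw [this, Real.rpow_neg_one, mul_inv_cancel₀ hS.ne']

lemma abs_powSumDeriv_sub_le (hp : 1 ≤ p) (hp2 : p ≤ 2) (hpK : p * K = 1) {x a b : ℝ}
    (hx : 0 < x) (ha : 0 ≤ a) (hb : 0 ≤ b) :
    |powSumDeriv p K x b - powSumDeriv p K x a| ≤ 1 / x * |b - a| :=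
  (convex_Ici (0 : ℝ)).norm_image_sub_le_of_norm_hasDerivWithin_le
    (fun _ hy => (hasDerivAt_powSumDeriv (K := K) hp hx hy).hasDerivWithinAt)
    (fun _ hy => abs_deriv_powSumDeriv_le hp hp2 hpK hx hy) ha hb

/-- The rectangular increments of the `ℓ^p` norm. -/
lemma abs_powSum_rect_le (hp : 1 ≤ p) (hp2 : p ≤ 2) (hpK : p * K = 1) {a b c d : ℝ}
    (ha : 0 ≤ a) (hab : a ≤ b) (hc : 0 < c) (hcd : c ≤ d) :
    |powSum p K d b - powSum p K d a - (powSum p K c b - powSum p K c a)| ≤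
      (b - a) * (d - c) / c := by
  have h := (convex_Icc c d).norm_image_sub_le_of_norm_hasDerivWithin_le
    (f := fun x => powSum p K x b - powSum p K x a)
    (f' := fun x => powSumDeriv p K x b - powSumDeriv p K x a) (C := (b - a) / c)
    (fun x hx => ((hasDerivAt_powSum hpK (hc.trans_le hx.1) (ha.trans hab)).sub
      (hasDerivAt_powSum hpK (hc.trans_le hx.1) ha)).hasDerivWithinAt)
    (fun x hx => by
      refine (abs_powSumDeriv_sub_le hp hp2 hpK (hc.trans_le hx.1) ha (ha.trans hab)).trans ?_
      rw [abs_of_nonneg (by linarith), one_div_mul_eq_div]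
      have := hx.1
      gcongr)
    (left_mem_Icc.2 hcd) (right_mem_Icc.2 hcd)
  rw [Real.norm_eq_abs, Real.norm_eq_abs, abs_of_nonneg (a := d - c) (by linarith)] at h
  calc _ ≤ _ := h
    _ = _ := by ring

lemma powSum_mono_lip (hp : 1 ≤ p) (hpK : p * K = 1) {a b y : ℝ}
    (ha : 0 ≤ a) (hab : a ≤ b) (hy : 0 ≤ y) :
    powSum p K a y ≤ powSum p K b y ∧ powSum p K b y ≤ powSum p K a y + (b - a) := by
  have hK0 : 0 < K := by nlinarith
  have hcont : ContinuousOn (fun z => powSum p K z y) (Icc a b) := by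
    refine ContinuousOn.rpow_const (ContinuousOn.add ?_ continuousOn_const)
        (fun _ _ => Or.inr hK0.le)
    exact ContinuousOn.rpow_const continuousOn_id (fun _ _ => Or.inr (by linarith))
  have hd : ∀ x ∈ interior (Icc a b), HasDerivAt (fun z => powSum p K z y)
      (powSumDeriv p K x y) x := by
    intro x hx
    rw [interior_Icc] at hx
    exact hasDerivAt_powSum hpK (ha.trans_lt hx.1) hy
  have hx0 : ∀ x ∈ interior (Icc a b), 0 < x := by
    intro x hx
    rw [interior_Icc] at hx
    exact ha.trans_lt hx.1
  constructor
  · refine monotoneOn_of_deriv_nonneg (convex_Icc a b) hcont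
      (fun x hx => (hd x hx).differentiableAt.differentiableWithinAt)
      (fun x hx => ?_) (left_mem_Icc.2 hab) (right_mem_Icc.2 hab) hab
    rw [(hd x hx).deriv]
    exact powSumDeriv_nonneg (hx0 x hx) hy
  · have := (convex_Icc a b).image_sub_le_mul_sub_of_deriv_le hcont
      (fun x hx => (hd x hx).differentiableAt.differentiableWithinAt) (C := 1)
      (fun x hx => by
        rw [(hd x hx).deriv]; exact powSumDeriv_le_one hp hpK (hx0 x hx) hy)
      a (left_mem_Icc.2 hab) b (right_mem_Icc.2 hab) hab
    linarith

end PowSum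

/-- The covariance of the bi-fractional Brownian motion with `2 * H * K = 1`, in terms of
`p = 2 * H`. -/
noncomputable def bifracCov (p K s t : ℝ) : ℝ := 1 / 2 ^ K * (powSum p K s t - |t - s|)

section BifracCov

variable {p K : ℝ}

lemma bifracCov_comm (s t : ℝ) : bifracCov p K s t = bifracCov p K t s := by
  rw [bifracCov, bifracCov, powSum_comm, abs_sub_comm]

lemma one_div_two_rpow_le_one (hK : 0 ≤ K) : 1 / (2 : ℝ) ^ K ≤ 1 := by
  rw [div_le_one (by positivity)]
  exact Real.one_le_rpow (by norm_num) hK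

lemma bifracCov_self (hpK : p * K = 1) {t : ℝ} (ht : 0 ≤ t) : bifracCov p K t t = t := by
  rw [bifracCov, powSum_self hpK ht]
  have : (2 : ℝ) ^ K ≠ 0 := by positivity
  simp; field_simp

lemma bifracCov_zero (hp : 1 ≤ p) (hpK : p * K = 1) {t : ℝ} (ht : 0 ≤ t) :
    bifracCov p K t 0 = 0 := by
  rw [bifracCov, powSum_zero hp hpK ht]
  simp [abs_of_nonneg ht]

lemma bifracCov_lip (hp : 1 ≤ p) (hpK : p * K = 1) {a b z : ℝ}
    (ha : 0 ≤ a) (hab : a ≤ b) (hz : 0 ≤ z) :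
    |bifracCov p K b z - bifracCov p K a z| ≤ 2 * (b - a) := by
  have hK0 : 0 ≤ K := by nlinarith
  obtain ⟨h1, h2⟩ := powSum_mono_lip hp hpK ha hab hz
  have h3 : |(|z - b| - |z - a|)| ≤ b - a := by
    refine (abs_abs_sub_abs_le_abs_sub _ _).trans ?_
    rw [abs_sub_comm]; simp [abs_of_nonneg (sub_nonneg.2 hab)]
  have hc := one_div_two_rpow_le_one hK0
  have hc0 : 0 < 1 / (2 : ℝ) ^ K := by positivity
  have e : bifracCov p K b z - bifracCov p K a z =
      1 / 2 ^ K * (powSum p K b z - powSum p K a z - (|z - b| - |z - a|)) := by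
    simp only [bifracCov]; ring
  rw [e, abs_mul, abs_of_pos hc0]
  have h4 : |powSum p K b z - powSum p K a z - (|z - b| - |z - a|)| ≤ 2 * (b - a) := by
    rw [abs_le] at h3 ⊢
    constructor <;> linarith
  nlinarith [abs_nonneg (powSum p K b z - powSum p K a z - (|z - b| - |z - a|))]

lemma bifracCov_bounds (hp : 1 ≤ p) (hpK : p * K = 1) {r s : ℝ} (hr : 0 ≤ r) (hrs : r ≤ s) :
    0 ≤ bifracCov p K s r ∧ bifracCov p K s r ≤ r ∧ r - bifracCov p K s r ≤ s - r := by
  have hK0 : 0 ≤ K := by nlinarith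
  have hc := one_div_two_rpow_le_one hK0
  have hc0 : 0 < 1 / (2 : ℝ) ^ K := by positivity
  obtain ⟨h1, h2⟩ := powSum_mono_lip hp hpK hr hrs hr
  obtain ⟨h3, -⟩ := powSum_mono_lip hp hpK le_rfl hr (hr.trans hrs)
  rw [powSum_comm, powSum_zero hp hpK (hr.trans hrs), powSum_comm] at h3
  have hself : 1 / 2 ^ K * powSum p K r r = r := by
    simpa [bifracCov] using bifracCov_self hpK hr
  have e : bifracCov p K s r = 1 / 2 ^ K * (powSum p K s r - (s - r)) := by
    rw [bifracCov, abs_sub_comm, abs_of_nonneg (by linarith)]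
  rw [e]
  refine ⟨mul_nonneg hc0.le (by linarith), ?_, ?_⟩
  · nlinarith
  · nlinarith

/-- Two increments over intervals with disjoint interiors. -/
lemma abs_bifracCov_rect_le (hp : 1 ≤ p) (hp2 : p ≤ 2) (hpK : p * K = 1) {a b c d : ℝ}
    (ha : 0 ≤ a) (hab : a ≤ b) (hbc : b ≤ c) (hc : 0 < c) (hcd : c ≤ d) :
    |bifracCov p K d b - bifracCov p K d a - (bifracCov p K c b - bifracCov p K c a)| ≤
      (b - a) * (d - c) / c := by
  have hK0 : 0 ≤ K := by nlinarith
  have hc1 := one_div_two_rpow_le_one hK0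
  have hc0 : 0 < 1 / (2 : ℝ) ^ K := by positivity
  have h := abs_powSum_rect_le hp hp2 hpK ha hab hc hcd
  have e : bifracCov p K d b - bifracCov p K d a - (bifracCov p K c b - bifracCov p K c a) =
      1 / 2 ^ K * (powSum p K d b - powSum p K d a - (powSum p K c b - powSum p K c a)) := by
    simp only [bifracCov, abs_sub_comm _ d, abs_sub_comm _ c]
    rw [abs_of_nonneg (a := d - b) (by linarith), abs_of_nonneg (a := d - a) (by linarith),
      abs_of_nonneg (a := c - b) (by linarith), abs_of_nonneg (a := c - a) (by linarith)]
    ring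
  rw [e, abs_mul, abs_of_pos hc0]
  exact (mul_le_of_le_one_left (abs_nonneg _) hc1).trans h

lemma bifracCov_incr_le (hp : 1 ≤ p) (hpK : p * K = 1) {r s : ℝ} (hr : 0 ≤ r) (hrs : r ≤ s) :
    s + r - 2 * bifracCov p K s r ≤ 3 * (s - r) := by
  have := (bifracCov_bounds hp hpK hr hrs).2.2
  linarith

/-- The variance of a short increment away from the origin is `2 ^ (1 - K)` times its length, up
to a quadratic error. -/
lemma abs_bifracCov_incr_sub_le (hp : 1 ≤ p) (hp2 : p ≤ 2) (hpK : p * K = 1) {r s : ℝ}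
    (hr : 0 < r) (hrs : r ≤ s) :
    |s + r - 2 * bifracCov p K s r - 2 * (1 / 2 ^ K) * (s - r)| ≤ (s - r) ^ 2 / r := by
  have hK0 : 0 ≤ K := by nlinarith
  have hc1 := one_div_two_rpow_le_one hK0
  have hc0 : 0 < 1 / (2 : ℝ) ^ K := by positivity
  have h := abs_powSum_rect_le hp hp2 hpK hr.le hrs hr hrs
  have e : s + r - 2 * bifracCov p K s r - 2 * (1 / 2 ^ K) * (s - r) =
      1 / 2 ^ K * (powSum p K s s - powSum p K s r - (powSum p K r s - powSum p K r r)) := by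
    have h1 : 1 / 2 ^ K * powSum p K r r = r := by
      simpa [bifracCov] using bifracCov_self hpK hr.le
    have h2 : 1 / 2 ^ K * powSum p K s s = s := by
      simpa [bifracCov] using bifracCov_self hpK (hr.le.trans hrs)
    rw [bifracCov, abs_sub_comm, abs_of_nonneg (by linarith), powSum_comm r s]
    linear_combination -h1 - h2
  rw [e, abs_mul, abs_of_pos hc0]
  refine (mul_le_of_le_one_left (abs_nonneg _) hc1).trans (h.trans_eq ?_)
  ring

end BifracCov

/-! ### Linear spaces of centered Gaussian variables -/

section CauchySchwarz

variable {Ω : Type*} [MeasurableSpace Ω] {P : Measure Ω}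

lemma integrable_mul_of_memLp_two {f g : Ω → ℝ} (hf : MemLp f 2 P) (hg : MemLp g 2 P) :
    Integrable (fun ω => f ω * g ω) P := hf.integrable_mul hg

lemma integral_add_three {a b c : Ω → ℝ} (ha : Integrable a P) (hb : Integrable b P)
    (hc : Integrable c P) :
    ∫ ω, (a ω + (b ω + c ω)) ∂P = ∫ ω, a ω ∂P + (∫ ω, b ω ∂P + ∫ ω, c ω ∂P) :=
  (integral_add ha (hb.add hc)).trans (congrArg _ (integral_add hb hc))

lemma integral_add_four {a b c d : Ω → ℝ} (ha : Integrable a P) (hb : Integrable b P)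
    (hc : Integrable c P) (hd : Integrable d P) :
    ∫ ω, (a ω + (b ω + (c ω + d ω))) ∂P =
      ∫ ω, a ω ∂P + (∫ ω, b ω ∂P + (∫ ω, c ω ∂P + ∫ ω, d ω ∂P)) :=
  (integral_add_three ha hb (hc.add hd)).trans
    (congrArg _ (congrArg _ (integral_add hc hd)))

lemma sq_integral_mul_le {f g : Ω → ℝ} (hf : MemLp f 2 P) (hg : MemLp g 2 P) :
    (∫ ω, f ω * g ω ∂P) ^ 2 ≤ (∫ ω, f ω ^ 2 ∂P) * ∫ ω, g ω ^ 2 ∂P := by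
  have key : ∀ t : ℝ, 0 ≤ (∫ ω, g ω ^ 2 ∂P) * (t * t) + (2 * ∫ ω, f ω * g ω ∂P) * t +
      ∫ ω, f ω ^ 2 ∂P := by
    intro t
    have h : ∫ ω, (f ω + t * g ω) ^ 2 ∂P = (∫ ω, g ω ^ 2 ∂P) * (t * t) +
        (2 * ∫ ω, f ω * g ω ∂P) * t + ∫ ω, f ω ^ 2 ∂P := by
      have e : (fun ω => (f ω + t * g ω) ^ 2) =
          fun ω => f ω ^ 2 + ((2 * t) * (f ω * g ω) + t ^ 2 * g ω ^ 2) := by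
        ext ω; ring
      have i1 := hf.integrable_sq
      have i2 := (integrable_mul_of_memLp_two hf hg).const_mul (2 * t)
      have i3 := hg.integrable_sq.const_mul (t ^ 2)
      rw [e, integral_add_three i1 i2 i3, integral_const_mul, integral_const_mul]
      ring
    rw [← h]
    exact integral_nonneg fun ω => sq_nonneg _
  have := discrim_le_zero key
  rw [discrim] at this
  linarith

lemma abs_integral_mul_le_sqrt {f g : Ω → ℝ} (hf : MemLp f 2 P) (hg : MemLp g 2 P) :
    |∫ ω, f ω * g ω ∂P| ≤ √(∫ ω, f ω ^ 2 ∂P) * √(∫ ω, g ω ^ 2 ∂P) := by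
  rw [← Real.sqrt_mul (integral_nonneg fun ω => sq_nonneg _)]
  exact Real.abs_le_sqrt (sq_integral_mul_le hf hg)

end CauchySchwarz

/-- A linear space of centered, measurable, jointly Gaussian random variables, parametrized
linearly by a real vector space `E`. -/
structure IsCenteredGaussianSpace {Ω E : Type*} [MeasurableSpace Ω] [AddCommGroup E] [Module ℝ E]
    (G : E →ₗ[ℝ] Ω → ℝ) (P : Measure Ω) : Prop where
  isGaussian : IsGaussianProcess (fun e => G e) P
  integral_eq_zero : ∀ e, ∫ ω, G e ω ∂P = 0
  measurable : ∀ e, Measurable (G e)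

/-- The covariance form of a linear space of centered random variables. -/
noncomputable def gcov {Ω E : Type*} [MeasurableSpace Ω] [AddCommGroup E] [Module ℝ E]
    (G : E →ₗ[ℝ] Ω → ℝ) (P : Measure Ω) (x y : E) : ℝ := ∫ ω, G x ω * G y ω ∂P

/-- For `X = G x` of variance `σ²`, the weighted second moment `E[f(X)² (1 + X² / σ²)]`. -/
noncomputable def gweight {Ω E : Type*} [MeasurableSpace Ω] [AddCommGroup E] [Module ℝ E]
    (G : E →ₗ[ℝ] Ω → ℝ) (P : Measure Ω) (f : ℝ → ℝ) (x : E) : ℝ :=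
  ∫ ω, f (G x ω) ^ 2 * (1 + G x ω ^ 2 / gcov G P x x) ∂P

/-- The even moments of the standard Gaussian distribution. -/
noncomputable def stdMoment (k : ℕ) : ℝ := ∫ x, x ^ (2 * k) ∂(gaussianReal 0 1)

lemma stdMoment_nonneg (k : ℕ) : 0 ≤ stdMoment k :=
  integral_nonneg fun x => by rw [pow_mul]; positivity

namespace IsCenteredGaussianSpace

variable {Ω E : Type*} [MeasurableSpace Ω] [AddCommGroup E] [Module ℝ E]
  {G : E →ₗ[ℝ] Ω → ℝ} {P : Measure Ω}

lemma memLp (hG : IsCenteredGaussianSpace G P) (x : E) {q : ENNReal} (hq : q ≠ ⊤) :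
    MemLp (G x) q P :=
  (hG.isGaussian.hasGaussianLaw_eval x).memLp hq

lemma memLp_two (hG : IsCenteredGaussianSpace G P) (x : E) : MemLp (G x) 2 P :=
  hG.memLp x (by simp)

lemma memLp_pow (hG : IsCenteredGaussianSpace G P) (x : E) (k : ℕ) :
    MemLp (fun ω => G x ω ^ k) 2 P := by
  rcases Nat.eq_zero_or_pos k with rfl | hk
  · have := hG.isGaussian.isProbabilityMeasure
    simpa using memLp_const (1 : ℝ)
  have h := (hG.memLp x (q := 2 * k) (ENNReal.mul_ne_top (by simp) (by simp))).norm_rpow_div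
      (k : ENNReal)
  have e : (2 * (k : ENNReal)) / k = 2 :=
    ENNReal.mul_div_cancel_right (by simpa using hk.ne') (by simp)
  rw [e] at h
  refine h.congr_norm ((hG.measurable x).pow_const k).aestronglyMeasurable (ae_of_all _ fun ω => ?_)
  simp

lemma gcov_comm (x y : E) : gcov G P x y = gcov G P y x := by
  simp [gcov, mul_comm]

lemma gcov_self_nonneg (x : E) : 0 ≤ gcov G P x x :=
  integral_nonneg fun _ => mul_self_nonneg _

lemma gcov_self (x : E) : gcov G P x x = ∫ ω, G x ω ^ 2 ∂P := by
  simp [gcov, sq]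

lemma gcov_add_left (hG : IsCenteredGaussianSpace G P) (x y z : E) :
    gcov G P (x + y) z = gcov G P x z + gcov G P y z := by
  rw [gcov, gcov, gcov, ← integral_add (integrable_mul_of_memLp_two (hG.memLp_two x)
      (hG.memLp_two z))
    (integrable_mul_of_memLp_two (hG.memLp_two y) (hG.memLp_two z))]
  simp [add_mul]

lemma gcov_smul_left (c : ℝ) (x z : E) :
    gcov G P (c • x) z = c * gcov G P x z := by
  rw [gcov, gcov, ← integral_const_mul]
  simp [mul_assoc]

lemma gcov_sub_left (hG : IsCenteredGaussianSpace G P) (x y z : E) :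
    gcov G P (x - y) z = gcov G P x z - gcov G P y z := by
  rw [sub_eq_add_neg, ← neg_one_smul ℝ, hG.gcov_add_left, gcov_smul_left]; ring

lemma gcov_add_right (hG : IsCenteredGaussianSpace G P) (x y z : E) :
    gcov G P x (y + z) = gcov G P x y + gcov G P x z := by
  rw [gcov_comm, hG.gcov_add_left, gcov_comm y, gcov_comm z]

lemma gcov_sub_right (hG : IsCenteredGaussianSpace G P) (x y z : E) :
    gcov G P x (y - z) = gcov G P x y - gcov G P x z := by
  rw [gcov_comm, hG.gcov_sub_left, gcov_comm y, gcov_comm z]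

lemma gcov_smul_right (c : ℝ) (x z : E) :
    gcov G P x (c • z) = c * gcov G P x z := by
  rw [gcov_comm, gcov_smul_left, gcov_comm]

lemma gcov_sq_le (hG : IsCenteredGaussianSpace G P) (x y : E) :
    gcov G P x y ^ 2 ≤ gcov G P x x * gcov G P y y := by
  rw [gcov_self, gcov_self]
  exact sq_integral_mul_le (hG.memLp_two x) (hG.memLp_two y)

lemma abs_gcov_le (hG : IsCenteredGaussianSpace G P) (x y : E) :
    |gcov G P x y| ≤ √(gcov G P x x) * √(gcov G P y y) := by
  rw [← Real.sqrt_mul (gcov_self_nonneg x)]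
  exact Real.abs_le_sqrt (hG.gcov_sq_le x y)

lemma indepFun (hG : IsCenteredGaussianSpace G P) {m n : Type*} (a : m → E) (b : n → E)
    (h : ∀ i j, gcov G P (a i) (b j) = 0) :
    IndepFun (fun ω i => G (a i) ω) (fun ω j => G (b j) ω) P := by
  have := hG.isGaussian.isProbabilityMeasure
  refine IsGaussianProcess.indepFun_of_covariance_eq_zero (X := fun i => G (a i))
    (Y := fun j => G (b j)) ?_ (fun _ => (hG.measurable _).aemeasurable)
    (fun _ => (hG.measurable _).aemeasurable) fun i j => ?_
  · have h1 := hG.isGaussian.comp_right (Sum.elim a b)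
    have e : Sum.elim (fun i => G (a i)) (fun j => G (b j)) = (fun e => G e) ∘ Sum.elim a b := by
      ext i
      cases i <;> rfl
    rwa [e]
  · rw [covariance_eq_sub (hG.memLp_two _) (hG.memLp_two _), hG.integral_eq_zero, zero_mul,
      sub_zero]
    exact h i j

lemma map_eq (hG : IsCenteredGaussianSpace G P) (x : E) :
    P.map (G x) = gaussianReal 0 (gcov G P x x).toNNReal := by
  have := hG.isGaussian.isProbabilityMeasure
  rw [(hG.isGaussian.hasGaussianLaw_eval x).map_eq_gaussianReal, hG.integral_eq_zero,
    variance_eq_integral (hG.measurable x).aemeasurable, hG.integral_eq_zero, gcov_self]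
  simp

lemma integral_pow (hG : IsCenteredGaussianSpace G P) (x : E) (k : ℕ) :
    ∫ ω, G x ω ^ (2 * k) ∂P = gcov G P x x ^ k * stdMoment k := by
  have h1 : ∫ ω, G x ω ^ (2 * k) ∂P = ∫ z, z ^ (2 * k) ∂(P.map (G x)) := by
    rw [integral_map (hG.measurable x).aemeasurable (by fun_prop)]
  have h2 : gaussianReal 0 (gcov G P x x).toNNReal =
      (gaussianReal 0 1).map (fun z => √(gcov G P x x) * z) := by
    rw [gaussianReal_map_const_mul]
    congr 1
    · simp
    · ext
      simp [gcov_self_nonneg]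
  rw [h1, hG.map_eq, h2, integral_map (by fun_prop) (by fun_prop), stdMoment, ← integral_const_mul]
  congr 1
  ext z
  rw [mul_pow, pow_mul, Real.sq_sqrt (gcov_self_nonneg x)]

lemma gweight_nonneg (f : ℝ → ℝ) (x : E) : 0 ≤ gweight G P f x :=
  integral_nonneg fun _ => mul_nonneg (sq_nonneg _)
    (add_nonneg zero_le_one (div_nonneg (sq_nonneg _) (gcov_self_nonneg x)))

lemma gweight_eq {f : ℝ → ℝ} {x : E} (h0 : MemLp (fun ω => f (G x ω)) 2 P)
    (h1 : MemLp (fun ω => f (G x ω) * G x ω) 2 P) :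
    gweight G P f x = ∫ ω, f (G x ω) ^ 2 ∂P +
      (∫ ω, (f (G x ω) * G x ω) ^ 2 ∂P) / gcov G P x x := by
  rw [gweight, div_eq_mul_inv, ← integral_mul_const, ← integral_add h0.integrable_sq
    (h1.integrable_sq.mul_const _)]
  congr 1
  ext ω
  ring

lemma integral_sq_le_gweight {f : ℝ → ℝ} {x : E} (h0 : MemLp (fun ω => f (G x ω)) 2 P)
    (h1 : MemLp (fun ω => f (G x ω) * G x ω) 2 P) :
    ∫ ω, f (G x ω) ^ 2 ∂P ≤ gweight G P f x := by
  rw [gweight_eq h0 h1]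
  refine le_add_of_nonneg_right (div_nonneg ?_ (gcov_self_nonneg x))
  exact integral_nonneg fun ω => sq_nonneg _

/-- Multiplying `f(X)` by a jointly Gaussian variable `U` costs at most the standard deviation of
`U` in the weighted norm: split `U` into its projection on `X` and an independent part. -/
lemma memLp_mul_and_integral_sq_le (hG : IsCenteredGaussianSpace G P) {f : ℝ → ℝ}
    (hf : Measurable f) {x : E} (hx : 0 < gcov G P x x) (h0 : MemLp (fun ω => f (G x ω)) 2 P)
    (h1 : MemLp (fun ω => f (G x ω) * G x ω) 2 P) (u : E) :
    MemLp (fun ω => f (G x ω) * G u ω) 2 P ∧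
      ∫ ω, (f (G x ω) * G u ω) ^ 2 ∂P ≤ gcov G P u u * gweight G P f x := by
  set κ := gcov G P u x / gcov G P x x with hκ
  set u' := u - κ • x with hu'
  have hux : gcov G P u' x = 0 := by
    rw [hu', hG.gcov_sub_left, gcov_smul_left, hκ, div_mul_cancel₀ _ hx.ne', sub_self]
  have hind : IndepFun (G x) (G u') P := by
    have := hG.indepFun (fun _ : Unit => x) (fun _ : Unit => u')
      (fun _ _ => by rw [gcov_comm]; exact hux)
    exact this.comp (measurable_pi_apply ()) (measurable_pi_apply ())
  have hm2 : Measurable fun z : ℝ => z ^ 2 := by fun_prop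
  have hfm : Measurable fun ω => f (G x ω) := hf.comp (hG.measurable x)
  have hUu : ∀ ω, G u ω = κ * G x ω + G u' ω := by
    intro ω; simp [hu']
  have hind2 : IndepFun (fun ω => f (G x ω) ^ 2) (fun ω => G u' ω ^ 2) P :=
    hind.comp (φ := fun z => f z ^ 2) (ψ := fun z => z ^ 2) (hf.pow_const 2) hm2
  have hp' : MemLp (fun ω => f (G x ω) * G u' ω) 2 P := by
    refine (memLp_two_iff_integrable_sq (hfm.mul (hG.measurable u')).aestronglyMeasurable).2 ?_
    simp_rw [Pi.mul_apply, mul_pow]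
    exact hind2.integrable_mul h0.integrable_sq (hG.memLp_two u').integrable_sq
  have hp : MemLp (fun ω => f (G x ω) * G u ω) 2 P := by
    have := (h1.const_mul κ).add hp'
    refine this.ae_eq (ae_of_all _ fun ω => ?_)
    simp only [Pi.add_apply, hUu]; ring
  refine ⟨hp, ?_⟩
  have hcross : ∫ ω, (f (G x ω) * G x ω) * (f (G x ω) * G u' ω) ∂P = 0 := by
    have h := (hind.comp (φ := fun z => f z ^ 2 * z) (ψ := id) ((hf.pow_const 2).mul measurable_id)
      measurable_id).integral_fun_mul_eq_mul_integral
      (((hf.pow_const 2).mul measurable_id).comp (hG.measurable x)).aestronglyMeasurable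
      (hG.measurable u').aestronglyMeasurable
    simp only [Function.comp_def, id, hG.integral_eq_zero, mul_zero] at h
    rw [← h]
    congr 1; ext ω; ring
  have hsq : ∫ ω, (f (G x ω) * G u' ω) ^ 2 ∂P = (∫ ω, f (G x ω) ^ 2 ∂P) * gcov G P u' u' := by
    rw [gcov_self, ← hind2.integral_fun_mul_eq_mul_integral (hfm.pow_const 2).aestronglyMeasurable
      ((hG.measurable u').pow_const 2).aestronglyMeasurable]
    simp_rw [mul_pow]
  have hexp : ∫ ω, (f (G x ω) * G u ω) ^ 2 ∂P = κ ^ 2 * ∫ ω, (f (G x ω) * G x ω) ^ 2 ∂P +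
      (∫ ω, f (G x ω) ^ 2 ∂P) * gcov G P u' u' := by
    have e : (fun ω => (f (G x ω) * G u ω) ^ 2) = fun ω => κ ^ 2 * (f (G x ω) * G x ω) ^ 2 +
        ((2 * κ) * ((f (G x ω) * G x ω) * (f (G x ω) * G u' ω)) + (f (G x ω) * G u' ω) ^ 2) := by
      ext ω; rw [hUu]; ring
    have i1 := h1.integrable_sq.const_mul (κ ^ 2)
    have i2 := (integrable_mul_of_memLp_two h1 hp').const_mul (2 * κ)
    rw [e, integral_add_three i1 i2 hp'.integrable_sq, integral_const_mul, integral_const_mul,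
        hcross, hsq]
    ring
  have hvar : gcov G P u' u' = gcov G P u u - gcov G P u x ^ 2 / gcov G P x x := by
    have : gcov G P u' u' = gcov G P u' u := by
      conv_lhs => rw [hu', hG.gcov_sub_right, gcov_smul_right, ← hu', hux]
      ring
    rw [this, hu', hG.gcov_sub_left, gcov_smul_left, gcov_comm x u, hκ]
    ring
  have hvar' : gcov G P u' u' ≤ gcov G P u u := by
    rw [hvar]; have := div_nonneg (sq_nonneg (gcov G P u x)) hx.le; linarith
  have hκ2 : κ ^ 2 ≤ gcov G P u u / gcov G P x x := by
    rw [hκ, div_pow, div_le_div_iff₀ (by positivity) hx]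
    nlinarith [hG.gcov_sq_le u x]
  rw [hexp, gweight_eq h0 h1]
  have i0 : 0 ≤ ∫ ω, f (G x ω) ^ 2 ∂P := integral_nonneg fun ω => sq_nonneg _
  have i1 : 0 ≤ ∫ ω, (f (G x ω) * G x ω) ^ 2 ∂P := integral_nonneg fun ω => sq_nonneg _
  calc _ ≤ gcov G P u u / gcov G P x x * ∫ ω, (f (G x ω) * G x ω) ^ 2 ∂P +
      (∫ ω, f (G x ω) ^ 2 ∂P) * gcov G P u u := by gcongr
    _ = _ := by ring

/-- The second moment of `f(X) f(Y)` against two jointly Gaussian variables, in terms of the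
projections `α • x + β • y` and `α' • x + β' • y` of `u` and `v` on the span of `x` and `y`. -/
lemma abs_integral_mul_mul_le (hG : IsCenteredGaussianSpace G P) {f : ℝ → ℝ}
    (hf : Measurable f) {x y : E} (hx : 0 < gcov G P x x) (hy : 0 < gcov G P y y)
    (hx0 : MemLp (fun ω => f (G x ω)) 2 P) (hx1 : MemLp (fun ω => f (G x ω) * G x ω) 2 P)
    (hy0 : MemLp (fun ω => f (G y ω)) 2 P) (hy1 : MemLp (fun ω => f (G y ω) * G y ω) 2 P)
    {u v u₁ v₁ : E} {α β α' β' : ℝ} (hu₁ : u₁ = α • x + β • y) (hv₁ : v₁ = α' • x + β' • y)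
    (hux : gcov G P (u - u₁) x = 0) (huy : gcov G P (u - u₁) y = 0)
    (hvx : gcov G P (v - v₁) x = 0) (hvy : gcov G P (v - v₁) y = 0) :
    |∫ ω, (f (G x ω) * G u ω) * (f (G y ω) * G v ω) ∂P| ≤
      √(gweight G P f x) * √(gweight G P f y) *
        (|gcov G P u v| + 2 * (√(gcov G P u₁ u₁) * √(gcov G P v₁ v₁))) := by
  set u' := u - u₁
  set v' := v - v₁
  have hU : ∀ ω, G u ω = G u₁ ω + G u' ω := fun ω => by simp [u']
  have hV : ∀ ω, G v ω = G v₁ ω + G v' ω := fun ω => by simp [v']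
  have hind : IndepFun (fun ω (i : Fin 2) => G (![x, y] i) ω)
      (fun ω (i : Fin 2) => G (![u', v'] i) ω) P := by
    refine hG.indepFun _ _ fun i j => ?_
    rw [gcov_comm]
    fin_cases i <;> fin_cases j <;> assumption
  have hU₁ : ∀ ω, G u₁ ω = α * G x ω + β * G y ω := fun ω => by simp [hu₁]
  have hV₁ : ∀ ω, G v₁ ω = α' * G x ω + β' * G y ω := fun ω => by simp [hv₁]
  have hfx : Measurable fun ω => f (G x ω) := hf.comp (hG.measurable x)
  have hfy : Measurable fun ω => f (G y ω) := hf.comp (hG.measurable y)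
  have hz0 : Measurable fun z : Fin 2 → ℝ => z 0 := measurable_pi_apply 0
  have hz1 : Measurable fun z : Fin 2 → ℝ => z 1 := measurable_pi_apply 1
  -- integrals of a function of `(X, Y)` times a function of `(U', V')`
  have hprod : ∀ φ ψ : (Fin 2 → ℝ) → ℝ, Measurable φ → Measurable ψ →
      ∫ ω, φ ![G x ω, G y ω] * ψ ![G u' ω, G v' ω] ∂P =
        (∫ ω, φ ![G x ω, G y ω] ∂P) * ∫ ω, ψ ![G u' ω, G v' ω] ∂P := by
    intro φ ψ hφ hψ
    have e1 : (fun ω (i : Fin 2) => G (![x, y] i) ω) = fun ω => ![G x ω, G y ω] := by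
      ext ω i; fin_cases i <;> rfl
    have e2 : (fun ω (i : Fin 2) => G (![u', v'] i) ω) = fun ω => ![G u' ω, G v' ω] := by
      ext ω i; fin_cases i <;> rfl
    rw [e1, e2] at hind
    have m1 : Measurable fun ω => ![G x ω, G y ω] := by
      rw [← e1]; exact measurable_pi_lambda _ fun i => hG.measurable _
    have m2 : Measurable fun ω => ![G u' ω, G v' ω] := by
      rw [← e2]; exact measurable_pi_lambda _ fun i => hG.measurable _
    exact (hind.comp hφ hψ).integral_fun_mul_eq_mul_integral
      (hφ.comp m1).aestronglyMeasurable (hψ.comp m2).aestronglyMeasurable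
  have hc1 : ∫ ω, (f (G x ω) * G u₁ ω) * (f (G y ω) * G v' ω) ∂P = 0 := by
    have h := hprod (fun z => f (z 0) * f (z 1) * (α * z 0 + β * z 1)) (fun z => z 1)
      (by fun_prop) (by fun_prop)
    simp only [Matrix.cons_val_zero, Matrix.cons_val_one, hG.integral_eq_zero, mul_zero] at h
    rw [← h]; congr 1; ext ω; rw [hU₁]; ring
  have hc2 : ∫ ω, (f (G x ω) * G u' ω) * (f (G y ω) * G v₁ ω) ∂P = 0 := by
    have h := hprod (fun z => f (z 0) * f (z 1) * (α' * z 0 + β' * z 1)) (fun z => z 0)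
      (by fun_prop) (by fun_prop)
    simp only [Matrix.cons_val_zero, Matrix.cons_val_one, hG.integral_eq_zero, mul_zero] at h
    rw [← h]; congr 1; ext ω; rw [hV₁]; ring
  have hc3 : ∫ ω, (f (G x ω) * G u' ω) * (f (G y ω) * G v' ω) ∂P =
      (∫ ω, f (G x ω) * f (G y ω) ∂P) * gcov G P u' v' := by
    have h := hprod (fun z => f (z 0) * f (z 1)) (fun z => z 0 * z 1) (by fun_prop) (by fun_prop)
    simp only [Matrix.cons_val_zero, Matrix.cons_val_one] at h
    rw [gcov, ← h]; congr 1; ext ω; ring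
  obtain ⟨mu1, bu1⟩ := hG.memLp_mul_and_integral_sq_le hf hx hx0 hx1 u₁
  obtain ⟨mu', -⟩ := hG.memLp_mul_and_integral_sq_le hf hx hx0 hx1 u'
  obtain ⟨mv1, bv1⟩ := hG.memLp_mul_and_integral_sq_le hf hy hy0 hy1 v₁
  obtain ⟨mv', -⟩ := hG.memLp_mul_and_integral_sq_le hf hy hy0 hy1 v'
  have hexp : ∫ ω, (f (G x ω) * G u ω) * (f (G y ω) * G v ω) ∂P =
      ∫ ω, (f (G x ω) * G u₁ ω) * (f (G y ω) * G v₁ ω) ∂P +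
        (∫ ω, f (G x ω) * f (G y ω) ∂P) * gcov G P u' v' := by
    have i1 := integrable_mul_of_memLp_two mu1 mv1
    have i2 := integrable_mul_of_memLp_two mu1 mv'
    have i3 := integrable_mul_of_memLp_two mu' mv1
    have i4 := integrable_mul_of_memLp_two mu' mv'
    have e : (fun ω => (f (G x ω) * G u ω) * (f (G y ω) * G v ω)) = fun ω =>
        (f (G x ω) * G u₁ ω) * (f (G y ω) * G v₁ ω) +
        ((f (G x ω) * G u₁ ω) * (f (G y ω) * G v' ω) +
        ((f (G x ω) * G u' ω) * (f (G y ω) * G v₁ ω) +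
        (f (G x ω) * G u' ω) * (f (G y ω) * G v' ω))) := by
      ext ω; rw [hU, hV]; ring
    rw [e, integral_add_four i1 i2 i3 i4, hc1, hc2, hc3]
    ring
  have hcov : gcov G P u' v' = gcov G P u v - gcov G P u₁ v₁ := by
    have h1 : gcov G P u' v₁ = 0 := by
      rw [hv₁, hG.gcov_add_right, gcov_smul_right, gcov_smul_right, hux, huy]; ring
    have h2 : gcov G P v' u₁ = 0 := by
      rw [hu₁, hG.gcov_add_right, gcov_smul_right, gcov_smul_right, hvx, hvy]; ring
    have h3 : gcov G P u' v' = gcov G P u' v - gcov G P u' v₁ := hG.gcov_sub_right _ _ _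
    have h4 : gcov G P u' v = gcov G P u v - gcov G P u₁ v := hG.gcov_sub_left _ _ _
    have h5 : gcov G P v' u₁ = gcov G P v u₁ - gcov G P v₁ u₁ := hG.gcov_sub_left _ _ _
    rw [h3, h4, h1, gcov_comm u₁ v, gcov_comm u₁ v₁]; linarith
  have w1 : √(∫ ω, (f (G x ω) * G u₁ ω) ^ 2 ∂P) ≤ √(gcov G P u₁ u₁) * √(gweight G P f x) := by
    rw [← Real.sqrt_mul (gcov_self_nonneg _)]; exact Real.sqrt_le_sqrt bu1
  have w2 : √(∫ ω, (f (G y ω) * G v₁ ω) ^ 2 ∂P) ≤ √(gcov G P v₁ v₁) * √(gweight G P f y) := by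
    rw [← Real.sqrt_mul (gcov_self_nonneg _)]; exact Real.sqrt_le_sqrt bv1
  have w3 := Real.sqrt_le_sqrt (integral_sq_le_gweight hx0 hx1)
  have w4 := Real.sqrt_le_sqrt (integral_sq_le_gweight hy0 hy1)
  have t1 := (abs_integral_mul_le_sqrt mu1 mv1).trans
      (mul_le_mul w1 w2 (by positivity) (by positivity))
  have t2 := (abs_integral_mul_le_sqrt hx0 hy0).trans
      (mul_le_mul w3 w4 (by positivity) (by positivity))
  have t3 : |gcov G P u' v'| ≤ |gcov G P u v| + √(gcov G P u₁ u₁) * √(gcov G P v₁ v₁) := by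
    rw [hcov]
    exact (abs_sub _ _).trans (add_le_add_right (hG.abs_gcov_le _ _) _)
  rw [hexp]
  refine (abs_add_le _ _).trans ?_
  rw [abs_mul]
  calc _ ≤ √(gcov G P u₁ u₁) * √(gweight G P f x) * (√(gcov G P v₁ v₁) * √(gweight G P f y)) +
        √(gweight G P f x) * √(gweight G P f y) *
        (|gcov G P u v| + √(gcov G P u₁ u₁) * √(gcov G P v₁ v₁)) :=
        add_le_add t1 (mul_le_mul t2 t3 (abs_nonneg _) (by positivity))
    _ = _ := by ring

/-- The orthogonal projection on the span of `x` and `y`, by the Gram-Schmidt procedure. -/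
lemma exists_proj (hG : IsCenteredGaussianSpace G P) {x y : E} (hy : 0 < gcov G P y y)
    (hd : 0 < gcov G P x x - gcov G P x y ^ 2 / gcov G P y y) (u : E) :
    ∃ α β : ℝ, gcov G P (u - (α • x + β • y)) x = 0 ∧ gcov G P (u - (α • x + β • y)) y = 0 ∧
      gcov G P (α • x + β • y) (α • x + β • y) = gcov G P u y ^ 2 / gcov G P y y +
        (gcov G P u x - gcov G P x y / gcov G P y y * gcov G P u y) ^ 2 /
          (gcov G P x x - gcov G P x y ^ 2 / gcov G P y y) := by
  set r := gcov G P y y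
  set R := gcov G P x y
  set s := gcov G P x x
  set d := s - R ^ 2 / r with hdd
  set e := gcov G P u x - R / r * gcov G P u y with he
  have hyx : gcov G P y x = R := gcov_comm _ _
  have hr : r ≠ 0 := hy.ne'
  have hd' : d ≠ 0 := hd.ne'
  have hxx : gcov G P x x = d + R ^ 2 / r := by rw [hdd]; ring
  have hxy : gcov G P x y = R := rfl
  have hyy : gcov G P y y = r := rfl
  have hux : gcov G P u x = e + R / r * gcov G P u y := by rw [he]; ring
  refine ⟨e / d, gcov G P u y / r - e / d * (R / r), ?_, ?_, ?_⟩
  · rw [hG.gcov_sub_left, hG.gcov_add_left, gcov_smul_left, gcov_smul_left, hyx]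
    rw [hxx, hux]
    field_simp
    ring
  · rw [hG.gcov_sub_left, hG.gcov_add_left, gcov_smul_left, gcov_smul_left]
    rw [hxy, hyy]
    field_simp
    ring
  · rw [hG.gcov_add_left, hG.gcov_add_right, hG.gcov_add_right]
    simp only [gcov_smul_left, gcov_smul_right, hyx, hxy, hyy, hxx]
    field_simp
    ring

end IsCenteredGaussianSpace

/-! ### Increments of the bi-fractional Brownian motion -/

/-- A bi-fractional Brownian motion on `[0, T]` with `p = 2 * H`, `p * K = 1`, extended to all
times as a Gaussian process whose paths are all continuous and whose variables are measurable. -/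
structure IsRegularBifracBM {Ω : Type*} [MeasurableSpace Ω] (p K T : ℝ) (B : ℝ → Ω → ℝ)
    (P : Measure Ω) : Prop where
  isGaussian : IsGaussianProcess B P
  centered : ∀ t, ∫ ω, B t ω ∂P = 0
  covariance : ∀ s ∈ Icc (0 : ℝ) T, ∀ t ∈ Icc (0 : ℝ) T,
    ∫ ω, B s ω * B t ω ∂P = bifracCov p K s t
  measurable : ∀ t, Measurable (B t)
  continuous : ∀ ω, Continuous fun t => B t ω

/-- The linear combinations of the values of a process. -/
noncomputable def processSpan {Ω : Type*} (B : ℝ → Ω → ℝ) : (ℝ →₀ ℝ) →ₗ[ℝ] Ω → ℝ :=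
  Finsupp.linearCombination ℝ B

/-- The vector representing the value of a process at time `t` in `processSpan`. -/
noncomputable def timeVec (t : ℝ) : ℝ →₀ ℝ := Finsupp.single t 1

@[simp] lemma processSpan_timeVec {Ω : Type*} (B : ℝ → Ω → ℝ) (t : ℝ) :
    processSpan B (timeVec t) = B t := by
  simp [processSpan, timeVec]

lemma processSpan_incr {Ω : Type*} (B : ℝ → Ω → ℝ) (s t : ℝ) (ω : Ω) :
    processSpan B (timeVec t - timeVec s) ω = B t ω - B s ω := by
  simp

/-- The weighted second moment `E[f(B_s)² (1 + B_s² / s)]`. -/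
noncomputable def timeWeight {Ω : Type*} [MeasurableSpace Ω] (B : ℝ → Ω → ℝ) (P : Measure Ω)
    (f : ℝ → ℝ) (s : ℝ) : ℝ := ∫ ω, f (B s ω) ^ 2 * (1 + B s ω ^ 2 / s) ∂P

/-- The integrability at time `s` under which the weighted second moment is meaningful. -/
def GoodTime {Ω : Type*} [MeasurableSpace Ω] (B : ℝ → Ω → ℝ) (P : Measure Ω)
    (f : ℝ → ℝ) (s : ℝ) : Prop :=
  MemLp (fun ω => f (B s ω)) 2 P ∧ MemLp (fun ω => f (B s ω) * B s ω) 2 P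

namespace IsRegularBifracBM

variable {Ω : Type*} [MeasurableSpace Ω] {p K T : ℝ} {B : ℝ → Ω → ℝ} {P : Measure Ω}

lemma isCenteredGaussianSpace (hB : IsRegularBifracBM p K T B P) :
    IsCenteredGaussianSpace (processSpan B) P where
  isGaussian := by
    refine hB.isGaussian.of_isGaussianProcess fun c =>
      ⟨c.support, ∑ i : c.support, c i • ContinuousLinearMap.proj i, fun ω => ?_⟩
    simp only [processSpan, Finsupp.linearCombination_apply, Finsupp.sum, Finset.sum_apply,
      Pi.smul_apply, smul_eq_mul, sum_apply, smul_apply,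
      ContinuousLinearMap.proj_apply, Finset.restrict]
    exact (Finset.sum_coe_sort c.support fun i => c i * B i ω).symm
  integral_eq_zero c := by
    simp only [processSpan, Finsupp.linearCombination_apply, Finsupp.sum, Finset.sum_apply,
      Pi.smul_apply, smul_eq_mul]
    rw [integral_finsetSum _ fun i _ =>
      ((hB.isGaussian.hasGaussianLaw_eval i).integrable).const_mul _]
    simp [integral_const_mul, hB.centered]
  measurable c := by
    simp only [processSpan, Finsupp.linearCombination_apply, Finsupp.sum]
    have h := Finset.measurable_sum (f := fun i => c i • B i) c.support
      fun i _ => (hB.measurable i).const_smul (c i)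
    convert h using 1
    ext ω
    simp

lemma gcov_timeVec (hB : IsRegularBifracBM p K T B P) {s t : ℝ} (hs : s ∈ Icc 0 T)
    (ht : t ∈ Icc 0 T) : gcov (processSpan B) P (timeVec s) (timeVec t) = bifracCov p K s t := by
  simp [gcov, hB.covariance s hs t ht]

lemma gcov_timeVec_self (hB : IsRegularBifracBM p K T B P) (hpK : p * K = 1) {s : ℝ}
    (hs : s ∈ Icc 0 T) : gcov (processSpan B) P (timeVec s) (timeVec s) = s := by
  rw [hB.gcov_timeVec hs hs, bifracCov_self hpK hs.1]

lemma gweight_timeVec (hB : IsRegularBifracBM p K T B P) (hpK : p * K = 1) (f : ℝ → ℝ) {s : ℝ}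
    (hs : s ∈ Icc 0 T) : gweight (processSpan B) P f (timeVec s) = timeWeight B P f s := by
  rw [gweight, timeWeight, hB.gcov_timeVec_self hpK hs, processSpan_timeVec]

lemma timeWeight_nonneg (hB : IsRegularBifracBM p K T B P) (hpK : p * K = 1) (f : ℝ → ℝ) {s : ℝ}
    (hs : s ∈ Icc 0 T) : 0 ≤ timeWeight B P f s := by
  rw [← hB.gweight_timeVec hpK f hs]
  exact IsCenteredGaussianSpace.gweight_nonneg f _

lemma gcov_incr_self (hB : IsRegularBifracBM p K T B P) (hpK : p * K = 1) {r s : ℝ}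
    (hr : r ∈ Icc 0 T) (hs : s ∈ Icc 0 T) :
    gcov (processSpan B) P (timeVec s - timeVec r) (timeVec s - timeVec r) =
      s + r - 2 * bifracCov p K s r := by
  have hG := hB.isCenteredGaussianSpace
  rw [hG.gcov_sub_left, hG.gcov_sub_right, hG.gcov_sub_right, hB.gcov_timeVec_self hpK hr,
    hB.gcov_timeVec_self hpK hs, hB.gcov_timeVec hs hr, hB.gcov_timeVec hr hs, bifracCov_comm r s]
  ring

lemma gcov_incr_self_le (hB : IsRegularBifracBM p K T B P) (hp : 1 ≤ p) (hpK : p * K = 1)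
    {r s : ℝ} (hr : 0 ≤ r) (hrs : r ≤ s) (hs : s ≤ T) :
    gcov (processSpan B) P (timeVec s - timeVec r) (timeVec s - timeVec r) ≤ 3 * (s - r) := by
  rw [hB.gcov_incr_self hpK ⟨hr, hrs.trans hs⟩ ⟨hr.trans hrs, hs⟩]
  exact bifracCov_incr_le hp hpK hr hrs

lemma abs_gcov_incr_le (hB : IsRegularBifracBM p K T B P) (hp : 1 ≤ p) (hpK : p * K = 1)
    {a b z : ℝ} (ha : 0 ≤ a) (hab : a ≤ b) (hb : b ≤ T) (hz : z ∈ Icc 0 T) :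
    |gcov (processSpan B) P (timeVec b - timeVec a) (timeVec z)| ≤ 2 * (b - a) := by
  rw [hB.isCenteredGaussianSpace.gcov_sub_left, hB.gcov_timeVec ⟨ha.trans hab, hb⟩ hz,
    hB.gcov_timeVec ⟨ha, hab.trans hb⟩ hz]
  exact bifracCov_lip hp hpK ha hab hz.1

lemma abs_gcov_incr_incr_le (hB : IsRegularBifracBM p K T B P) (hp : 1 ≤ p) (hp2 : p ≤ 2)
    (hpK : p * K = 1) {a b c d : ℝ} (ha : 0 ≤ a) (hab : a ≤ b) (hbc : b ≤ c) (hc : 0 < c)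
    (hcd : c ≤ d) (hd : d ≤ T) :
    |gcov (processSpan B) P (timeVec d - timeVec c) (timeVec b - timeVec a)| ≤
      (b - a) * (d - c) / c := by
  have hG := hB.isCenteredGaussianSpace
  have ma : a ∈ Icc 0 T := ⟨ha, by linarith⟩
  have mb : b ∈ Icc 0 T := ⟨by linarith, by linarith⟩
  have mc : c ∈ Icc 0 T := ⟨by linarith, by linarith⟩
  have md : d ∈ Icc 0 T := ⟨by linarith, by linarith⟩
  rw [hG.gcov_sub_left, hG.gcov_sub_right, hG.gcov_sub_right, hB.gcov_timeVec md mb,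
    hB.gcov_timeVec md ma, hB.gcov_timeVec mc mb, hB.gcov_timeVec mc ma]
  exact abs_bifracCov_rect_le hp hp2 hpK ha hab hbc hc hcd

lemma abs_gcov_incr_past_le (hB : IsRegularBifracBM p K T B P) (hp : 1 ≤ p) (hp2 : p ≤ 2)
    (hpK : p * K = 1) {b c d : ℝ} (hb : 0 ≤ b) (hbc : b ≤ c) (hc : 0 < c)
    (hcd : c ≤ d) (hd : d ≤ T) :
    |gcov (processSpan B) P (timeVec d - timeVec c) (timeVec b)| ≤ b * (d - c) / c := by
  have hG := hB.isCenteredGaussianSpace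
  have h := hB.abs_gcov_incr_incr_le hp hp2 hpK le_rfl hb hbc hc hcd hd
  have m0 : (0 : ℝ) ∈ Icc 0 T := ⟨le_rfl, by linarith⟩
  have mc : c ∈ Icc 0 T := ⟨by linarith, by linarith⟩
  have md : d ∈ Icc 0 T := ⟨by linarith, by linarith⟩
  rwa [hG.gcov_sub_right, hG.gcov_sub_left _ _ (timeVec 0), hB.gcov_timeVec md m0,
    hB.gcov_timeVec mc m0, bifracCov_zero hp hpK md.1, bifracCov_zero hp hpK mc.1, sub_zero,
    sub_zero, sub_zero] at h

/-- The conditional variance of `B_s` given `B_r` is at least `s - r`. -/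
lemma sub_le_condVar (hp : 1 ≤ p) (hpK : p * K = 1) {r s : ℝ} (hr : 0 < r) (hrs : r ≤ s) :
    s - r ≤ s - bifracCov p K s r ^ 2 / r := by
  obtain ⟨h0, h1, -⟩ := bifracCov_bounds hp hpK hr.le hrs
  have : bifracCov p K s r ^ 2 / r ≤ r := by
    rw [div_le_iff₀ hr]; nlinarith
  linarith

/-- The coefficient of `u` along the innovation of `B_s` over `B_r`. -/
noncomputable def innovCov (p K : ℝ) (B : ℝ → Ω → ℝ) (P : Measure Ω) (r s : ℝ) (u : ℝ →₀ ℝ) : ℝ :=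
  gcov (processSpan B) P u (timeVec s) -
    bifracCov p K s r / r * gcov (processSpan B) P u (timeVec r)

/-- An upper bound for the variance of the projection of `u` on the span of `B_r` and `B_s`. -/
noncomputable def projBound (p K : ℝ) (B : ℝ → Ω → ℝ) (P : Measure Ω) (r s : ℝ) (u : ℝ →₀ ℝ) : ℝ :=
  gcov (processSpan B) P u (timeVec r) ^ 2 / r + innovCov p K B P r s u ^ 2 / (s - r)

lemma exists_proj_timeVec (hB : IsRegularBifracBM p K T B P) (hp : 1 ≤ p)
    (hpK : p * K = 1) {r s : ℝ} (hr : 0 < r) (hrs : r < s) (hs : s ≤ T) (u : ℝ →₀ ℝ) :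
    ∃ α β : ℝ,
      gcov (processSpan B) P (u - (α • timeVec s + β • timeVec r)) (timeVec s) = 0 ∧
      gcov (processSpan B) P (u - (α • timeVec s + β • timeVec r)) (timeVec r) = 0 ∧
      gcov (processSpan B) P (α • timeVec s + β • timeVec r) (α • timeVec s + β • timeVec r) ≤
        projBound p K B P r s u := by
  have hG := hB.isCenteredGaussianSpace
  have mr : r ∈ Icc 0 T := ⟨hr.le, by linarith⟩
  have ms : s ∈ Icc 0 T := ⟨by linarith, hs⟩
  have hcv := sub_le_condVar hp hpK hr hrs.le
  obtain ⟨α, β, h1, h2, h3⟩ := hG.exists_proj (x := timeVec s) (y := timeVec r)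
    (by rw [hB.gcov_timeVec_self hpK mr]; exact hr)
    (by rw [hB.gcov_timeVec_self hpK mr, hB.gcov_timeVec_self hpK ms, hB.gcov_timeVec ms mr]
        linarith) u
  refine ⟨α, β, h1, h2, ?_⟩
  rw [h3, hB.gcov_timeVec_self hpK mr, hB.gcov_timeVec_self hpK ms, hB.gcov_timeVec ms mr,
    projBound, innovCov]
  have : 0 < s - r := by linarith
  gcongr

/-- Bound for the mixed moment of two increments weighted by `f(B_s) f(B_r)`, in terms of their
covariance and their projections on the span of `B_s` and `B_r`. -/
lemma abs_integral_le_of_projBound (hB : IsRegularBifracBM p K T B P) (hp : 1 ≤ p)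
    (hpK : p * K = 1) {f : ℝ → ℝ} (hf : Measurable f) {r s ε : ℝ} (hr : 0 < r) (hrs : r < s)
    (hs : s ≤ T) (gr : GoodTime B P f r) (gs : GoodTime B P f s)
    {u v : ℝ →₀ ℝ}
    (huv : |gcov (processSpan B) P u v| ≤ 2 * ε ^ 2 / s)
    (hproj : projBound p K B P r s u * projBound p K B P r s v ≤ 320 * ε ^ 4 / (r * (s - r))) :
    |∫ ω, (f (B s ω) * processSpan B u ω) * (f (B r ω) * processSpan B v ω) ∂P| ≤
      √(timeWeight B P f s) * √(timeWeight B P f r) * (38 * ε ^ 2 / √(r * (s - r))) := by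
  have hG := hB.isCenteredGaussianSpace
  have mr : r ∈ Icc 0 T := ⟨hr.le, by linarith⟩
  have ms : s ∈ Icc 0 T := ⟨by linarith, hs⟩
  obtain ⟨α, β, u1, u2, u3⟩ := hB.exists_proj_timeVec hp hpK hr hrs hs u
  obtain ⟨α', β', v1, v2, v3⟩ := hB.exists_proj_timeVec hp hpK hr hrs hs v
  have h := hG.abs_integral_mul_mul_le hf (x := timeVec s) (y := timeVec r)
    (by rw [hB.gcov_timeVec_self hpK ms]; linarith) (by rw [hB.gcov_timeVec_self hpK mr]; exact hr)
    (by simpa using gs.1) (by simpa using gs.2) (by simpa using gr.1) (by simpa using gr.2)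
    (u := u) (v := v) rfl rfl u1 u2 v1 v2
  rw [hB.gweight_timeVec hpK f ms, hB.gweight_timeVec hpK f mr, processSpan_timeVec,
    processSpan_timeVec] at h
  refine h.trans ?_
  have hsr : 0 < s - r := by linarith
  have hq : 0 < r * (s - r) := mul_pos hr hsr
  gcongr
  have k1 : 2 * ε ^ 2 / s ≤ 2 * ε ^ 2 / √(r * (s - r)) := by
    gcongr
    rw [Real.sqrt_le_left (by linarith)]
    nlinarith
  -- `320 ≤ 18 ^ 2`, and the total constant is `2 + 2 * 18 = 38`
  have k2 : √(gcov (processSpan B) P (α • timeVec s + β • timeVec r)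
      (α • timeVec s + β • timeVec r)) *
      √(gcov (processSpan B) P (α' • timeVec s + β' • timeVec r)
        (α' • timeVec s + β' • timeVec r)) ≤ 18 * ε ^ 2 / √(r * (s - r)) := by
    rw [← Real.sqrt_mul (IsCenteredGaussianSpace.gcov_self_nonneg _), Real.sqrt_le_left
        (by positivity)]
    calc _ ≤ projBound p K B P r s u * projBound p K B P r s v :=
          mul_le_mul u3 v3 (IsCenteredGaussianSpace.gcov_self_nonneg _)
            (by unfold projBound; positivity)
      _ ≤ 320 * ε ^ 4 / (r * (s - r)) := hproj
      _ ≤ 324 * ε ^ 4 / (r * (s - r)) := by gcongr; norm_num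
      _ = (18 * ε ^ 2 / √(r * (s - r))) ^ 2 := by
          rw [div_pow, Real.sq_sqrt hq.le]; ring
  calc _ ≤ 2 * ε ^ 2 / √(r * (s - r)) + 2 * (18 * ε ^ 2 / √(r * (s - r))) := by
        have := huv.trans k1; linarith
    _ = _ := by ring

lemma abs_innovCov_le (hp : 1 ≤ p) (hpK : p * K = 1)
    (hB : IsRegularBifracBM p K T B P) {r s : ℝ} (hr : 0 < r) (hrs : r ≤ s) {u : ℝ →₀ ℝ}
    {m n : ℝ} (hm : |gcov (processSpan B) P u (timeVec s - timeVec r)| ≤ m)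
    (hn : |gcov (processSpan B) P u (timeVec r)| ≤ n) :
    |innovCov p K B P r s u| ≤ m + (s - r) / r * n := by
  have e : innovCov p K B P r s u = gcov (processSpan B) P u (timeVec s - timeVec r) +
      (r - bifracCov p K s r) / r * gcov (processSpan B) P u (timeVec r) := by
    rw [innovCov, hB.isCenteredGaussianSpace.gcov_sub_right]; field_simp; ring
  obtain ⟨-, h1, h2⟩ := bifracCov_bounds hp hpK hr.le hrs
  rw [e]
  refine (abs_add_le _ _).trans (add_le_add hm ?_)
  rw [abs_mul, abs_of_nonneg (div_nonneg (by linarith) hr.le)]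
  have : 0 ≤ s - r := by linarith
  gcongr

lemma abs_innovCov_le' (hp : 1 ≤ p) (hpK : p * K = 1) {r s : ℝ} (hr : 0 < r) (hrs : r ≤ s)
    {u : ℝ →₀ ℝ}
    {m n : ℝ} (hm : |gcov (processSpan B) P u (timeVec s)| ≤ m)
    (hn : |gcov (processSpan B) P u (timeVec r)| ≤ n) :
    |innovCov p K B P r s u| ≤ m + n := by
  obtain ⟨h0, h1, h2⟩ := bifracCov_bounds hp hpK hr.le hrs
  have h3 : bifracCov p K s r / r ≤ 1 := (div_le_one hr).2 h1
  have h4 : 0 ≤ bifracCov p K s r / r := div_nonneg h0 hr.le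
  rw [innovCov]
  refine (abs_sub _ _).trans (add_le_add hm ?_)
  rw [abs_mul, abs_of_nonneg h4]
  nlinarith [abs_nonneg (gcov (processSpan B) P u (timeVec r))]

lemma projBound_le {r s : ℝ} (hr : 0 < r) (hrs : r < s) {u : ℝ →₀ ℝ} {m n : ℝ}
    (hm : |gcov (processSpan B) P u (timeVec r)| ≤ m) (hn : |innovCov p K B P r s u| ≤ n) :
    projBound p K B P r s u ≤ m ^ 2 / r + n ^ 2 / (s - r) := by
  have : 0 < s - r := by linarith
  unfold projBound
  have h1 : gcov (processSpan B) P u (timeVec r) ^ 2 ≤ m ^ 2 := sq_le_sq' (abs_le.1 hm).1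
      (abs_le.1 hm).2
  have h2 : innovCov p K B P r s u ^ 2 ≤ n ^ 2 := sq_le_sq' (abs_le.1 hn).1 (abs_le.1 hn).2
  gcongr

lemma projBound_nonneg {r s : ℝ} (hr : 0 < r) (hrs : r < s) (u : ℝ →₀ ℝ) :
    0 ≤ projBound p K B P r s u := by
  have : 0 < s - r := by linarith
  unfold projBound; positivity

/-- A forward increment at the later time is almost orthogonal to the past. -/
lemma projBound_forward_late (hB : IsRegularBifracBM p K T B P) (hp : 1 ≤ p) (hp2 : p ≤ 2)
    (hpK : p * K = 1) {r s ε : ℝ} (hr : 0 < r) (hrs : r < s) (hε : 0 ≤ ε)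
    (hs : s + ε ≤ T) : projBound p K B P r s (timeVec (s + ε) - timeVec s) ≤ 4 * ε ^ 2 / s := by
  have hs0 : 0 < s := by linarith
  have hsr : 0 < s - r := by linarith
  have h1 := hB.abs_gcov_incr_past_le hp hp2 hpK hr.le hrs.le hs0 (d := s + ε) (by linarith) hs
  have h2 := hB.abs_gcov_incr_incr_le hp hp2 hpK hr.le hrs.le le_rfl hs0 (d := s + ε)
    (by linarith) hs
  rw [add_sub_cancel_left] at h1 h2
  have h3 := abs_innovCov_le hp hpK hB hr hrs.le h2 h1
  have e : (s - r) * ε / s + (s - r) / r * (r * ε / s) = 2 * (s - r) * ε / s := by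
    field_simp; ring
  rw [e] at h3
  refine (projBound_le hr hrs h1 h3).trans ?_
  have e2 : (r * ε / s) ^ 2 / r + (2 * (s - r) * ε / s) ^ 2 / (s - r) =
      (r + 4 * (s - r)) / s * (ε ^ 2 / s) := by
    field_simp
    ring
  rw [e2]
  have : (r + 4 * (s - r)) / s ≤ 4 := by rw [div_le_iff₀ hs0]; linarith
  calc _ ≤ 4 * (ε ^ 2 / s) := by gcongr
    _ = _ := by ring

/-- For an arbitrary increment only the Lipschitz bound on the covariance is available; this is
enough for the earlier of two increments. -/
lemma projBound_early (hB : IsRegularBifracBM p K T B P) (hp : 1 ≤ p)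
    (hpK : p * K = 1) {r s a b : ℝ} (hr : 0 < r) (hrs : r < s) (hs : s ≤ T) (ha : 0 ≤ a)
    (hab : a ≤ b) (hb : b ≤ T) : projBound p K B P r s (timeVec b - timeVec a) ≤
      4 * (b - a) ^ 2 / r + 16 * (b - a) ^ 2 / (s - r) := by
  have h1 := hB.abs_gcov_incr_le hp hpK ha hab hb (z := r) ⟨hr.le, by linarith⟩
  have h2 := hB.abs_gcov_incr_le hp hpK ha hab hb (z := s) ⟨by linarith, hs⟩
  have h3 := abs_innovCov_le' hp hpK hr hrs.le h2 h1
  refine (projBound_le hr hrs h1 h3).trans (le_of_eq ?_)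
  ring

/-- Correlations of weighted forward increments away from the diagonal. -/
lemma forward_far (hB : IsRegularBifracBM p K T B P) (hp : 1 ≤ p) (hp2 : p ≤ 2)
    (hpK : p * K = 1) {f : ℝ → ℝ} (hf : Measurable f) {r s ε : ℝ} (hr : 0 < r) (hε : 0 < ε)
    (hrs : r + 2 * ε ≤ s) (hs : s + ε ≤ T) (gr : GoodTime B P f r) (gs : GoodTime B P f s) :
    |∫ ω, (f (B s ω) * (B (s + ε) ω - B s ω)) * (f (B r ω) * (B (r + ε) ω - B r ω)) ∂P| ≤
      √(timeWeight B P f s) * √(timeWeight B P f r) * (38 * ε ^ 2 / √(r * (s - r))) := by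
  have hs0 : 0 < s := by linarith
  have hsr : 0 < s - r := by linarith
  have h := hB.abs_integral_le_of_projBound hp hpK hf hr (by linarith) (by linarith) gr gs
    (ε := ε) (u := timeVec (s + ε) - timeVec s) (v := timeVec (r + ε) - timeVec r) ?_ ?_
  · simpa only [processSpan_incr] using h
  · refine (hB.abs_gcov_incr_incr_le hp hp2 hpK hr.le (by linarith) (by linarith) hs0
      (by linarith) hs).trans ?_
    rw [add_sub_cancel_left, add_sub_cancel_left, ← sq]
    gcongr
    nlinarith [sq_nonneg ε]
  · have h1 := hB.projBound_forward_late hp hp2 hpK hr (s := s) (by linarith) hε.le hs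
    have h2 := hB.projBound_early hp hpK hr (s := s) (by linarith) (by linarith) hr.le
      (b := r + ε) (by linarith) (by linarith)
    rw [add_sub_cancel_left] at h2
    refine (mul_le_mul h1 h2 (projBound_nonneg hr (by linarith) _) (by positivity)).trans ?_
    have e : 4 * ε ^ 2 / s * (4 * ε ^ 2 / r + 16 * ε ^ 2 / (s - r)) =
        ((16 * (s - r) + 64 * r) / s) * ε ^ 4 / (r * (s - r)) := by
      field_simp; ring
    rw [e]
    have : (16 * (s - r) + 64 * r) / s ≤ 320 := by
      rw [div_le_iff₀ hs0]; nlinarith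
    gcongr

/-- Correlations of weighted backward increments away from the diagonal. The projection of
the later increment is essentially along the innovation of `B_s` over `B_r`, that of the earlier one
along `B_r`; this produces the factors `s - r` and `r`. -/
lemma backward_far (hB : IsRegularBifracBM p K T B P) (hp : 1 ≤ p) (hp2 : p ≤ 2)
    (hpK : p * K = 1) {f : ℝ → ℝ} (hf : Measurable f) {r s ε : ℝ} (hr : ε ≤ r) (hε : 0 < ε)
    (hrs : r + 2 * ε ≤ s) (hs : s ≤ T) (gr : GoodTime B P f r) (gs : GoodTime B P f s) :
    |∫ ω, (f (B s ω) * (B s ω - B (s - ε) ω)) * (f (B r ω) * (B r ω - B (r - ε) ω)) ∂P| ≤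
      √(timeWeight B P f s) * √(timeWeight B P f r) * (38 * ε ^ 2 / √(r * (s - r))) := by
  have hs0 : 0 < s := by linarith
  have hr0 : 0 < r := by linarith
  have hsr : 0 < s - r := by linarith
  have hs2 : s / 2 ≤ s - ε := by linarith
  have h := hB.abs_integral_le_of_projBound hp hpK hf hr0 (by linarith) (by linarith) gr gs
    (ε := ε) (u := timeVec s - timeVec (s - ε)) (v := timeVec r - timeVec (r - ε)) ?_ ?_
  · simpa only [processSpan_incr] using h
  · refine (hB.abs_gcov_incr_incr_le hp hp2 hpK (by linarith) (by linarith) (by linarith)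
      (by linarith) (by linarith) hs).trans ?_
    rw [sub_sub_cancel, sub_sub_cancel]
    calc ε * ε / (s - ε) ≤ ε * ε / (s / 2) := by gcongr
      _ = 2 * ε ^ 2 / s := by field_simp
  · have hu1 := hB.abs_gcov_incr_past_le hp hp2 hpK hr0.le (c := s - ε) (d := s) (by linarith)
      (by linarith) (by linarith) hs
    have hu2 := hB.abs_gcov_incr_le hp hpK (a := s - ε) (b := s) (z := s) (by linarith)
      (by linarith) hs ⟨hs0.le, hs⟩
    have hu3 := hB.abs_gcov_incr_le hp hpK (a := s - ε) (b := s) (z := r) (by linarith)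
      (by linarith) hs ⟨hr0.le, by linarith⟩
    have hu4 := projBound_le hr0 (by linarith) hu1
      (abs_innovCov_le' hp hpK hr0 (by linarith) hu2 hu3)
    rw [sub_sub_cancel] at hu4
    have hu : projBound p K B P r s (timeVec s - timeVec (s - ε)) ≤ 20 * ε ^ 2 / (s - r) := by
      refine hu4.trans ?_
      have e1 : (r * ε / (s - ε)) ^ 2 / r ≤ 4 * ε ^ 2 / (s - r) := by
        calc (r * ε / (s - ε)) ^ 2 / r ≤ (r * ε / (s / 2)) ^ 2 / r := by
              have : 0 < s - ε := by linarith
              gcongr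
          _ = r / s * (4 * ε ^ 2 / s) := by field_simp; ring
          _ ≤ 1 * (4 * ε ^ 2 / (s - r)) := by
              gcongr
              · rw [div_le_one hs0]; linarith
              · linarith
          _ = _ := one_mul _
      calc _ ≤ 4 * ε ^ 2 / (s - r) + (2 * ε + 2 * ε) ^ 2 / (s - r) := by gcongr
        _ = _ := by ring
    have hv1 := hB.abs_gcov_incr_le hp hpK (a := r - ε) (b := r) (z := r) (by linarith)
      (by linarith) (by linarith) ⟨hr0.le, by linarith⟩
    have hv2 := hB.abs_gcov_incr_le hp hpK (a := r - ε) (b := r) (z := s) (by linarith)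
      (by linarith) (by linarith) ⟨hs0.le, hs⟩
    have hv3 := hB.abs_gcov_incr_incr_le hp hp2 hpK (a := r - ε) (b := r) (c := r) (d := s)
      (by linarith) (by linarith) le_rfl hr0 (by linarith) hs
    rw [IsCenteredGaussianSpace.gcov_comm] at hv3
    rw [sub_sub_cancel] at hv1 hv2 hv3
    have hv4 := abs_innovCov_le hp hpK hB hr0 (by linarith) hv3 hv1
    have hv5 := abs_innovCov_le' hp hpK hr0 (by linarith : r ≤ s) hv2 hv1
    have hv : projBound p K B P r s (timeVec r - timeVec (r - ε)) ≤ 16 * ε ^ 2 / r := by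
      have k1 : innovCov p K B P r s (timeVec r - timeVec (r - ε)) ^ 2 ≤
          (ε * (s - r) / r + (s - r) / r * (2 * ε)) * (2 * ε + 2 * ε) := by
        rw [← sq_abs, sq]
        exact mul_le_mul hv4 hv5 (abs_nonneg _) (by positivity)
      have k2 : gcov (processSpan B) P (timeVec r - timeVec (r - ε)) (timeVec r) ^ 2 ≤
          (2 * ε) ^ 2 := by
        rw [← sq_abs]; gcongr
      calc _ ≤ (2 * ε) ^ 2 / r +
            (ε * (s - r) / r + (s - r) / r * (2 * ε)) * (2 * ε + 2 * ε) / (s - r) := by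
            unfold projBound; gcongr
        _ = _ := by field_simp; ring
    refine (mul_le_mul hu hv (projBound_nonneg hr0 (by linarith) _) (by positivity)).trans ?_
    apply le_of_eq
    field_simp
    ring

/-- The second moment of a weighted increment. -/
lemma memLp_and_integral_sq_le (hB : IsRegularBifracBM p K T B P) (hp : 1 ≤ p)
    (hpK : p * K = 1) {f : ℝ → ℝ} (hf : Measurable f) {s a b : ℝ} (hs0 : 0 < s) (hs : s ≤ T)
    (ha : 0 ≤ a) (hab : a ≤ b) (hb : b ≤ T) (gs : GoodTime B P f s) :
    MemLp (fun ω => f (B s ω) * (B b ω - B a ω)) 2 P ∧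
    ∫ ω, (f (B s ω) * (B b ω - B a ω)) ^ 2 ∂P ≤ 3 * (b - a) * timeWeight B P f s := by
  have h := hB.isCenteredGaussianSpace.memLp_mul_and_integral_sq_le hf (x := timeVec s)
    (by rw [hB.gcov_timeVec_self hpK ⟨hs0.le, hs⟩]; exact hs0) (by simpa using gs.1)
    (by simpa using gs.2) (timeVec b - timeVec a)
  rw [hB.gweight_timeVec hpK f ⟨hs0.le, hs⟩] at h
  simp only [processSpan_incr, processSpan_timeVec] at h
  refine ⟨h.1, h.2.trans ?_⟩
  have := hB.timeWeight_nonneg hpK f ⟨hs0.le, hs⟩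
  gcongr
  exact hB.gcov_incr_self_le hp hpK ha hab hb

end IsRegularBifracBM

/-! ### The singular correlation kernel and second moments of time integrals -/

section SingularKernel

lemma lintegral_Ioc_rpow {a c : ℝ} (ha : 0 < a) (hc : 0 ≤ c) :
    ∫⁻ z in Ioc 0 c, ENNReal.ofReal (z ^ (a - 1)) = ENNReal.ofReal (c ^ a / a) := by
  have hi : IntervalIntegrable (fun z : ℝ => z ^ (a - 1)) volume 0 c :=
    intervalIntegral.intervalIntegrable_rpow' (by linarith)
  rw [← ofReal_integral_eq_lintegral_ofReal
      ((intervalIntegrable_iff_integrableOn_Ioc_of_le hc).1 hi)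
    ((ae_restrict_iff' measurableSet_Ioc).2 (ae_of_all _ fun z hz => Real.rpow_nonneg hz.1.le _)),
    ← intervalIntegral.integral_of_le hc, integral_rpow (Or.inl (by linarith))]
  simp [Real.zero_rpow ha.ne']

/-- The kernel bounding the correlations of the increments, integrable near the diagonal but only
borderline at the origin. -/
noncomputable def corrKernel (r s : ℝ) : ℝ := 1 / √(min r s * |s - r|)

lemma corrKernel_comm (r s : ℝ) : corrKernel r s = corrKernel s r := by
  rw [corrKernel, corrKernel, min_comm, abs_sub_comm]

lemma corrKernel_nonneg (r s : ℝ) : 0 ≤ corrKernel r s := by unfold corrKernel; positivity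

lemma measurable_corrKernel : Measurable fun z : ℝ × ℝ => corrKernel z.1 z.2 := by
  unfold corrKernel; fun_prop

lemma one_div_sqrt_eq {x : ℝ} (hx : 0 ≤ x) : 1 / √x = x ^ (-(1 / 2) : ℝ) := by
  rw [Real.sqrt_eq_rpow, Real.rpow_neg hx, one_div]

lemma corrKernel_of_lt {r s : ℝ} (hr : 0 < r) (hrs : r < s) :
    corrKernel r s = r ^ (-(1 / 2) : ℝ) * (s - r) ^ (-(1 / 2) : ℝ) := by
  rw [corrKernel, min_eq_left hrs.le, abs_of_pos (by linarith),
    one_div_sqrt_eq (mul_nonneg hr.le (by linarith)), Real.mul_rpow hr.le (by linarith)]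

lemma two_rpow_le {a : ℝ} (ha : 0 ≤ a) (ha1 : a ≤ 1) {s z : ℝ} (hs : 0 < s) (hz : s / 2 ≤ z) :
    z ^ (-a) ≤ 2 * s ^ (-a) := by
  calc z ^ (-a) ≤ (s / 2) ^ (-a) :=
        Real.rpow_le_rpow_of_nonpos (by positivity) hz (by linarith)
    _ = 2 ^ a * s ^ (-a) := by
        rw [Real.div_rpow hs.le (by norm_num), Real.rpow_neg (x := 2) (by norm_num), div_inv_eq_mul,
          mul_comm]
    _ ≤ 2 * s ^ (-a) := by
        gcongr
        calc (2 : ℝ) ^ a ≤ 2 ^ (1 : ℝ) := Real.rpow_le_rpow_of_exponent_le (by norm_num) ha1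
          _ = 2 := Real.rpow_one 2

/-- The weighted kernel before time `s`, split according to whether `r` is closer to `0` or to
`s`. -/
lemma corrKernel_mul_le_of_lt {r s : ℝ} (hr : 0 < r) (hrs : r < s) :
    corrKernel r s * (s / r) ^ (1 / 4 : ℝ) ≤
      2 * s ^ (-(1 / 4) : ℝ) * r ^ ((1 / 4 : ℝ) - 1) +
        2 * s ^ (-(1 / 2) : ℝ) * (s - r) ^ ((1 / 2 : ℝ) - 1) := by
  have hs : 0 < s := hr.trans hrs
  have hsr : 0 < s - r := by linarith
  have e : corrKernel r s * (s / r) ^ (1 / 4 : ℝ) =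
      s ^ (1 / 4 : ℝ) * (r ^ (-(3 / 4) : ℝ) * (s - r) ^ (-(1 / 2) : ℝ)) := by
    have : r ^ (-(3 / 4) : ℝ) = r ^ (-(1 / 2) : ℝ) * r ^ (-(1 / 4) : ℝ) := by
      rw [← Real.rpow_add hr]; norm_num
    rw [corrKernel_of_lt hr hrs, Real.div_rpow hs.le hr.le, this, Real.rpow_neg hr.le (1 / 4)]
    field_simp
  have e1 : ((1 / 4 : ℝ) - 1) = -(3 / 4) := by norm_num
  have e2 : ((1 / 2 : ℝ) - 1) = -(1 / 2) := by norm_num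
  rw [e, e1, e2]
  rcases le_or_gt r (s / 2) with h | h
  · have h1 := two_rpow_le (a := 1 / 2) (by norm_num) (by norm_num) hs (z := s - r) (by linarith)
    have h2 : s ^ (1 / 4 : ℝ) * s ^ (-(1 / 2) : ℝ) = s ^ (-(1 / 4) : ℝ) := by
      rw [← Real.rpow_add hs]; norm_num
    calc _ ≤ s ^ (1 / 4 : ℝ) * (r ^ (-(3 / 4) : ℝ) * (2 * s ^ (-(1 / 2) : ℝ))) := by gcongr
      _ = 2 * s ^ (-(1 / 4) : ℝ) * r ^ (-(3 / 4) : ℝ) := by rw [← h2]; ring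
      _ ≤ _ := le_add_of_nonneg_right (by positivity)
  · have h1 := two_rpow_le (a := 3 / 4) (by norm_num) (by norm_num) hs (z := r) h.le
    have h2 : s ^ (1 / 4 : ℝ) * s ^ (-(3 / 4) : ℝ) = s ^ (-(1 / 2) : ℝ) := by
      rw [← Real.rpow_add hs]; norm_num
    calc _ ≤ s ^ (1 / 4 : ℝ) * ((2 * s ^ (-(3 / 4) : ℝ)) * (s - r) ^ (-(1 / 2) : ℝ)) := by gcongr
      _ = 2 * s ^ (-(1 / 2) : ℝ) * (s - r) ^ (-(1 / 2) : ℝ) := by rw [← h2]; ring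
      _ ≤ _ := le_add_of_nonneg_left (by positivity)

lemma corrKernel_mul_le_of_gt {r s : ℝ} (hs : 0 < s) (hsr : s < r) :
    corrKernel r s * (s / r) ^ (1 / 4 : ℝ) ≤ s ^ (-(1 / 4) : ℝ) * (r - s) ^ ((1 / 4 : ℝ) - 1) := by
  have hr : 0 < r := hs.trans hsr
  have hrs : 0 < r - s := by linarith
  have e1 : s ^ (-(1 / 4) : ℝ) = s ^ (-(1 / 2) : ℝ) * s ^ (1 / 4 : ℝ) := by
    rw [← Real.rpow_add hs]; norm_num
  have e2 : (r - s) ^ ((1 / 4 : ℝ) - 1) = (r - s) ^ (-(1 / 2) : ℝ) * (r - s) ^ (-(1 / 4) : ℝ) := by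
    rw [← Real.rpow_add hrs]; norm_num
  have h : (s / r) ^ (1 / 4 : ℝ) ≤ s ^ (1 / 4 : ℝ) * (r - s) ^ (-(1 / 4) : ℝ) := by
    rw [Real.div_rpow hs.le hr.le, div_eq_mul_inv, ← Real.rpow_neg hr.le]
    gcongr ?_ * ?_
    exact Real.rpow_le_rpow_of_nonpos hrs (by linarith) (by norm_num)
  rw [corrKernel_comm, corrKernel_of_lt hs hsr, e1, e2]
  calc _ ≤ s ^ (-(1 / 2) : ℝ) * (r - s) ^ (-(1 / 2) : ℝ) *
        (s ^ (1 / 4 : ℝ) * (r - s) ^ (-(1 / 4) : ℝ)) := by gcongr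
    _ = _ := by ring

lemma lintegral_sub_rpow_le {a c s : ℝ} (ha : 0 < a) (hc : 0 ≤ c) (A : Set ℝ) (hA : MeasurableSet A)
    (h : ∀ r ∈ A, s - r ∈ Ioc 0 c) :
    ∫⁻ r in A, ENNReal.ofReal ((s - r) ^ (a - 1)) ≤ ENNReal.ofReal (c ^ a / a) := by
  rw [← lintegral_Ioc_rpow ha hc, ← lintegral_indicator hA, ← lintegral_indicator measurableSet_Ioc,
    ← lintegral_sub_left_eq_self (indicator (Ioc 0 c) fun z => ENNReal.ofReal (z ^ (a - 1))) s]
  refine lintegral_mono fun r => ?_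
  by_cases hr : r ∈ A
  · rw [indicator_of_mem hr, indicator_of_mem (h r hr)]
  · rw [indicator_of_notMem hr]; exact zero_le

lemma lintegral_sub_rpow_le' {a c s : ℝ} (ha : 0 < a) (hc : 0 ≤ c) (A : Set ℝ)
    (hA : MeasurableSet A) (h : ∀ r ∈ A, r - s ∈ Ioc 0 c) :
    ∫⁻ r in A, ENNReal.ofReal ((r - s) ^ (a - 1)) ≤ ENNReal.ofReal (c ^ a / a) := by
  rw [← lintegral_Ioc_rpow ha hc, ← lintegral_indicator hA, ← lintegral_indicator measurableSet_Ioc,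
    ← lintegral_sub_right_eq_self (indicator (Ioc 0 c) fun z => ENNReal.ofReal (z ^ (a - 1))) s]
  refine lintegral_mono fun r => ?_
  by_cases hr : r ∈ A
  · rw [indicator_of_mem hr, indicator_of_mem (h r hr)]
  · rw [indicator_of_notMem hr]; exact zero_le

/-- Schur's test for the kernel with the weights `s ^ (1 / 4)`: the tail of the kernel towards `T`
is controlled by `(T / s) ^ (1 / 4)` only. -/
lemma lintegral_corrKernel_le {s T : ℝ} (hs : 0 < s) (hsT : s ≤ T) :
    ∫⁻ r in Ioc 0 T, ENNReal.ofReal (corrKernel r s * (s / r) ^ (1 / 4 : ℝ)) ≤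
      ENNReal.ofReal (16 * (T / s) ^ (1 / 4 : ℝ)) := by
  have hT : 0 < T := hs.trans_le hsT
  have h1 : ∫⁻ r in Ioo 0 s, ENNReal.ofReal (corrKernel r s * (s / r) ^ (1 / 4 : ℝ)) ≤
      ENNReal.ofReal 12 := by
    calc _ ≤ ∫⁻ r in Ioo 0 s, (ENNReal.ofReal (2 * s ^ (-(1 / 4) : ℝ)) *
            ENNReal.ofReal (r ^ ((1 / 4 : ℝ) - 1)) +
          ENNReal.ofReal (2 * s ^ (-(1 / 2) : ℝ)) *
            ENNReal.ofReal ((s - r) ^ ((1 / 2 : ℝ) - 1))) := by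
          refine setLIntegral_mono' measurableSet_Ioo fun r hr => ?_
          have : 0 < s - r := by linarith [hr.2]
          rw [← ENNReal.ofReal_mul (by positivity), ← ENNReal.ofReal_mul (by positivity),
            ← ENNReal.ofReal_add (mul_nonneg (by positivity) (Real.rpow_nonneg hr.1.le _))
              (by positivity)]
          exact ENNReal.ofReal_le_ofReal (corrKernel_mul_le_of_lt hr.1 hr.2)
      _ ≤ ENNReal.ofReal (2 * s ^ (-(1 / 4) : ℝ)) * ENNReal.ofReal (s ^ (1 / 4 : ℝ) / (1 / 4)) +
          ENNReal.ofReal (2 * s ^ (-(1 / 2) : ℝ)) * ENNReal.ofReal (s ^ (1 / 2 : ℝ) / (1 / 2)) := by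
          rw [lintegral_add_left (by fun_prop), lintegral_const_mul _ (by fun_prop),
            lintegral_const_mul _ (by fun_prop)]
          gcongr
          · rw [← lintegral_Ioc_rpow (by norm_num) hs.le]
            exact lintegral_mono_set Ioo_subset_Ioc_self
          · exact lintegral_sub_rpow_le (by norm_num) hs.le _ measurableSet_Ioo
              fun r hr => ⟨by linarith [hr.2], by linarith [hr.1]⟩
      _ = ENNReal.ofReal 12 := by
          rw [← ENNReal.ofReal_mul (by positivity), ← ENNReal.ofReal_mul (by positivity),
            ← ENNReal.ofReal_add (by positivity) (by positivity), Real.rpow_neg hs.le,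
            Real.rpow_neg hs.le]
          congr 1
          field_simp
          norm_num
  have h2 : ∫⁻ r in Ioc s T, ENNReal.ofReal (corrKernel r s * (s / r) ^ (1 / 4 : ℝ)) ≤
      ENNReal.ofReal (4 * (T / s) ^ (1 / 4 : ℝ)) := by
    calc _ ≤ ∫⁻ r in Ioc s T, ENNReal.ofReal (s ^ (-(1 / 4) : ℝ)) *
            ENNReal.ofReal ((r - s) ^ ((1 / 4 : ℝ) - 1)) := by
          refine setLIntegral_mono' measurableSet_Ioc fun r hr => ?_
          rw [← ENNReal.ofReal_mul (by positivity)]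
          exact ENNReal.ofReal_le_ofReal (corrKernel_mul_le_of_gt hs hr.1)
      _ ≤ ENNReal.ofReal (s ^ (-(1 / 4) : ℝ)) * ENNReal.ofReal (T ^ (1 / 4 : ℝ) / (1 / 4)) := by
          rw [lintegral_const_mul _ (by fun_prop)]
          gcongr
          exact lintegral_sub_rpow_le' (by norm_num) hT.le _ measurableSet_Ioc
              fun r hr => ⟨by linarith [hr.1], by linarith [hr.2]⟩
      _ = _ := by
          rw [← ENNReal.ofReal_mul (by positivity), Real.div_rpow hT.le hs.le, Real.rpow_neg hs.le]
          congr 1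
          field_simp
  have hsub : Ioc 0 T ⊆ Ioo 0 s ∪ ({s} ∪ Ioc s T) := by
    intro r hr
    rcases lt_trichotomy r s with h | h | h
    · exact Or.inl ⟨hr.1, h⟩
    · exact Or.inr (Or.inl h)
    · exact Or.inr (Or.inr ⟨h, hr.2⟩)
  calc _ ≤ ∫⁻ r in Ioo 0 s ∪ ({s} ∪ Ioc s T),
        ENNReal.ofReal (corrKernel r s * (s / r) ^ (1 / 4 : ℝ)) := lintegral_mono_set hsub
    _ ≤ ENNReal.ofReal 12 + (0 + ENNReal.ofReal (4 * (T / s) ^ (1 / 4 : ℝ))) := by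
        refine (lintegral_union_le _ _ _).trans (add_le_add h1 ?_)
        refine (lintegral_union_le _ _ _).trans (add_le_add (le_of_eq ?_) h2)
        simp
    _ ≤ _ := by
        have h3 : (1 : ℝ) ≤ (T / s) ^ (1 / 4 : ℝ) :=
          Real.one_le_rpow ((one_le_div hs).2 hsT) (by norm_num)
        rw [zero_add, ← ENNReal.ofReal_add (by norm_num) (by positivity)]
        exact ENNReal.ofReal_le_ofReal (by linarith)

/-- A symmetrization form of Schur's test. -/
lemma lintegral_lintegral_mul_le {A : Set ℝ} (hA : MeasurableSet A) {g : ℝ → ℝ} (hg : Measurable g)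
    {k : ℝ → ℝ → ℝ} (hk : Measurable fun z : ℝ × ℝ => k z.1 z.2) (hk0 : ∀ r s, 0 ≤ k r s)
    (hsymm : ∀ r s, k r s = k s r) {w : ℝ → ℝ} (hw : Measurable w) (hw0 : ∀ s ∈ A, 0 < w s)
    {b : ℝ → ENNReal}
    (hb : ∀ s ∈ A, ∫⁻ r in A, ENNReal.ofReal (k r s * (w s / w r)) ≤ b s) :
    ∫⁻ r in A, ∫⁻ s in A, ENNReal.ofReal (g s * g r * k r s) ≤
      ∫⁻ s in A, b s * ENNReal.ofReal (g s ^ 2) := by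
  have hm : Measurable fun z : ℝ × ℝ =>
      ENNReal.ofReal (1 / 2) * (ENNReal.ofReal (k z.1 z.2 * (w z.2 / w z.1)) *
        ENNReal.ofReal (g z.2 ^ 2)) := by fun_prop
  have hm' : Measurable fun z : ℝ × ℝ =>
      ENNReal.ofReal (1 / 2) * (ENNReal.ofReal (k z.2 z.1 * (w z.1 / w z.2)) *
        ENNReal.ofReal (g z.1 ^ 2)) := hm.comp measurable_swap
  have key : ∀ r ∈ A, ∀ s ∈ A, ENNReal.ofReal (g s * g r * k r s) ≤
      ENNReal.ofReal (1 / 2) * (ENNReal.ofReal (k r s * (w s / w r)) * ENNReal.ofReal (g s ^ 2)) +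
      ENNReal.ofReal (1 / 2) *
        (ENNReal.ofReal (k s r * (w r / w s)) * ENNReal.ofReal (g r ^ 2)) := by
    intro r hr s hs
    have h1 := hw0 r hr
    have h2 := hw0 s hs
    have h3 := hk0 r s
    rw [← hsymm r s, ← ENNReal.ofReal_mul (by positivity), ← ENNReal.ofReal_mul (by positivity),
      ← ENNReal.ofReal_mul (by positivity), ← ENNReal.ofReal_mul (by positivity),
      ← ENNReal.ofReal_add (by positivity) (by positivity)]
    refine ENNReal.ofReal_le_ofReal ?_
    have h4 : g s * g r ≤ 1 / 2 * (w s / w r * g s ^ 2 + w r / w s * g r ^ 2) := by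
      have e : 1 / 2 * (w s / w r * g s ^ 2 + w r / w s * g r ^ 2) - g s * g r =
          1 / 2 * (w s * g s - w r * g r) ^ 2 / (w s * w r) := by
        field_simp; ring
      have : 0 ≤ 1 / 2 * (w s * g s - w r * g r) ^ 2 / (w s * w r) := by positivity
      linarith
    calc g s * g r * k r s
        ≤ 1 / 2 * (w s / w r * g s ^ 2 + w r / w s * g r ^ 2) * k r s := by gcongr
      _ = _ := by ring
  have hsec : ∀ r, Measurable fun s => ENNReal.ofReal (1 / 2) *
      (ENNReal.ofReal (k r s * (w s / w r)) * ENNReal.ofReal (g s ^ 2)) :=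
    fun r => hm.comp measurable_prodMk_left
  calc _ ≤ ∫⁻ r in A, ((∫⁻ s in A, ENNReal.ofReal (1 / 2) *
          (ENNReal.ofReal (k r s * (w s / w r)) * ENNReal.ofReal (g s ^ 2))) +
        ∫⁻ s in A, ENNReal.ofReal (1 / 2) *
          (ENNReal.ofReal (k s r * (w r / w s)) * ENNReal.ofReal (g r ^ 2))) := by
        refine setLIntegral_mono' hA fun r hr => ?_
        rw [← lintegral_add_left (hsec r)]
        exact setLIntegral_mono' hA fun s hs => key r hr s hs
    _ = (∫⁻ r in A, ∫⁻ s in A, ENNReal.ofReal (1 / 2) *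
          (ENNReal.ofReal (k r s * (w s / w r)) * ENNReal.ofReal (g s ^ 2))) +
        ∫⁻ r in A, ∫⁻ s in A, ENNReal.ofReal (1 / 2) *
          (ENNReal.ofReal (k s r * (w r / w s)) * ENNReal.ofReal (g r ^ 2)) :=
        lintegral_add_left hm.lintegral_prod_right' _
    _ = ∫⁻ r in A, ∫⁻ s in A, ENNReal.ofReal (k s r * (w r / w s)) * ENNReal.ofReal (g r ^ 2) := by
        rw [lintegral_lintegral_swap hm.aemeasurable,
          ← lintegral_add_left hm'.lintegral_prod_right']
        refine lintegral_congr fun r => ?_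
        have hr : Measurable fun s =>
            ENNReal.ofReal (k s r * (w r / w s)) * ENNReal.ofReal (g r ^ 2) := by
          have := hk.comp (measurable_prodMk_right (y := r))
          simp only [Function.comp_def] at this
          fun_prop
        rw [lintegral_const_mul _ hr, ← add_mul, ← ENNReal.ofReal_add (by norm_num) (by norm_num)]
        norm_num
    _ ≤ _ := by
        refine setLIntegral_mono' hA fun r hr => ?_
        have h1 : Measurable fun s => ENNReal.ofReal (k s r * (w r / w s)) := by
          have := hk.comp (measurable_prodMk_right (y := r))
          simp only [Function.comp_def] at this
          fun_prop
        rw [lintegral_mul_const _ h1]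
        gcongr
        exact hb r hr

end SingularKernel

section SecondMoment

variable {Ω : Type*} [MeasurableSpace Ω] {P : Measure Ω} [IsProbabilityMeasure P]
  {ν : Measure ℝ} [IsFiniteMeasure ν]

/-- The second moment of a time integral is the double time integral of the correlations. -/
lemma memLp_integral_and_integral_sq_le {F : Ω → ℝ → ℝ} (hF : Measurable (Function.uncurry F))
    (hfin : ∫⁻ s, ∫⁻ ω, ENNReal.ofReal (F ω s ^ 2) ∂P ∂ν ≠ ⊤) :
    (∀ᵐ ω ∂P, Integrable (F ω) ν) ∧ MemLp (fun ω => ∫ s, F ω s ∂ν) 2 P ∧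
    ENNReal.ofReal (∫ ω, (∫ s, F ω s ∂ν) ^ 2 ∂P) ≤
      ∫⁻ r, ∫⁻ s, ENNReal.ofReal |∫ ω, F ω s * F ω r ∂P| ∂ν ∂ν := by
  have hFω : ∀ ω, Measurable (F ω) := fun ω => hF.comp measurable_prodMk_left
  have hsq : Integrable (fun z : Ω × ℝ => F z.1 z.2 ^ 2) (P.prod ν) := by
    refine ⟨(hF.pow_const 2).aestronglyMeasurable, ?_⟩
    rw [hasFiniteIntegral_iff_ofReal (ae_of_all _ fun z => sq_nonneg _),
      lintegral_prod_symm' (fun z : Ω × ℝ => ENNReal.ofReal (F z.1 z.2 ^ 2))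
        (ENNReal.measurable_ofReal.comp (hF.pow_const 2))]
    exact hfin.lt_top
  have h2 : ∀ᵐ ω ∂P, MemLp (F ω) 2 ν := by
    filter_upwards [hsq.prod_right_ae] with ω hω
    exact (memLp_two_iff_integrable_sq (hFω ω).aestronglyMeasurable).2 hω
  have h1 : ∀ᵐ ω ∂P, Integrable (F ω) ν := h2.mono fun ω hω => hω.integrable (by norm_num)
  have hCS : ∀ᵐ ω ∂P, (∫ s, |F ω s| ∂ν) ^ 2 ≤ ν.real univ * ∫ s, F ω s ^ 2 ∂ν := by
    filter_upwards [h2] with ω hω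
    have := sq_integral_mul_le hω.abs (memLp_const (1 : ℝ) (μ := ν))
    simpa [mul_comm] using this
  have hmabs : Measurable fun ω => ∫ s, |F ω s| ∂ν := by
    have : Measurable fun z : Ω × ℝ => |F z.1 z.2| := hF.abs
    exact this.stronglyMeasurable.integral_prod_right'.measurable
  have hm : Measurable fun ω => ∫ s, F ω s ∂ν :=
    hF.stronglyMeasurable.integral_prod_right'.measurable
  have habs : Integrable (fun ω => (∫ s, |F ω s| ∂ν) ^ 2) P := by
    refine (hsq.integral_prod_left.const_mul (ν.real univ)).mono'
      (hmabs.pow_const 2).aestronglyMeasurable ?_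
    filter_upwards [hCS] with ω hω
    rwa [Real.norm_eq_abs, abs_of_nonneg (sq_nonneg _)]
  have hmem : MemLp (fun ω => ∫ s, F ω s ∂ν) 2 P := by
    refine (memLp_two_iff_integrable_sq hm.aestronglyMeasurable).2
      (habs.mono' (hm.pow_const 2).aestronglyMeasurable (ae_of_all _ fun ω => ?_))
    rw [Real.norm_eq_abs, abs_of_nonneg (sq_nonneg _)]
    exact sq_le_sq' (by
      have := abs_integral_le_integral_abs (f := F ω) (μ := ν)
      linarith [neg_abs_le (∫ s, F ω s ∂ν)])
      ((le_abs_self _).trans abs_integral_le_integral_abs)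
  refine ⟨h1, hmem, ?_⟩
  have hH : Measurable fun z : Ω × (ℝ × ℝ) => F z.1 z.2.1 * F z.1 z.2.2 :=
    (hF.comp (by fun_prop : Measurable fun z : Ω × (ℝ × ℝ) => (z.1, z.2.1))).mul
      (hF.comp (by fun_prop : Measurable fun z : Ω × (ℝ × ℝ) => (z.1, z.2.2)))
  have hint : Integrable (fun z : Ω × (ℝ × ℝ) => F z.1 z.2.1 * F z.1 z.2.2)
      (P.prod (ν.prod ν)) := by
    rw [integrable_prod_iff hH.aestronglyMeasurable]
    constructor
    · filter_upwards [h1] with ω hω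
      exact hω.mul_prod hω
    · refine habs.congr (ae_of_all _ fun ω => ?_)
      simp only [norm_mul, Real.norm_eq_abs]
      rw [integral_prod_mul (fun s => |F ω s|) (fun s => |F ω s|), sq]
  have hswap : ∫ ω, (∫ s, F ω s ∂ν) ^ 2 ∂P =
      ∫ z, ∫ ω, F ω z.1 * F ω z.2 ∂P ∂(ν.prod ν) := by
    rw [← integral_integral_swap (f := fun ω (z : ℝ × ℝ) => F ω z.1 * F ω z.2) hint]
    congr 1
    ext ω
    rw [integral_prod_mul (F ω) (F ω), sq]
  have hmz : Measurable fun z : ℝ × ℝ => ∫ ω, F ω z.1 * F ω z.2 ∂P :=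
    (hH.comp measurable_swap).stronglyMeasurable.integral_prod_right'.measurable
  rw [hswap]
  calc _ ≤ ENNReal.ofReal |∫ z, ∫ ω, F ω z.1 * F ω z.2 ∂P ∂(ν.prod ν)| :=
        ENNReal.ofReal_le_ofReal (le_abs_self _)
    _ ≤ ∫⁻ z, ENNReal.ofReal |∫ ω, F ω z.1 * F ω z.2 ∂P| ∂(ν.prod ν) := by
        have := enorm_integral_le_lintegral_enorm (μ := ν.prod ν)
          fun z : ℝ × ℝ => ∫ ω, F ω z.1 * F ω z.2 ∂P
        simpa only [Real.enorm_eq_ofReal_abs] using this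
    _ = _ := lintegral_prod_symm' _ (by fun_prop)

end SecondMoment

/-! ### The norm of `𝓗` as an integral over time and as a Gaussian `L²` norm -/

section HNorm

/-- The contribution of time `s` to `‖f‖²_𝓗`. -/
noncomputable def hWeight (f : ℝ → ℝ) (s : ℝ) : ENNReal :=
  ∫⁻ x, ENNReal.ofReal (f x ^ 2 * (1 + x ^ 2 / s) * gaussDensity s x)

lemma gaussDensity_nonneg (s x : ℝ) : 0 ≤ gaussDensity s x := by
  unfold gaussDensity; positivity

lemma measurable_gaussDensity : Measurable fun z : ℝ × ℝ => gaussDensity z.1 z.2 := by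
  unfold gaussDensity; fun_prop

lemma measurable_hWeight_integrand {f : ℝ → ℝ} (hf : Measurable f) :
    Measurable fun z : ℝ × ℝ =>
      ENNReal.ofReal (f z.2 ^ 2 * (1 + z.2 ^ 2 / z.1) * gaussDensity z.1 z.2) := by
  have := measurable_gaussDensity
  fun_prop

lemma measurable_hWeight {f : ℝ → ℝ} (hf : Measurable f) : Measurable (hWeight f) :=
  (measurable_hWeight_integrand hf).lintegral_prod_right'

lemma eNormSqH_eq {f : ℝ → ℝ} (hf : Measurable f) (T : ℝ) :
    eNormSqH T f = ∫⁻ s in Ioc 0 T, hWeight f s := by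
  have hd := measurable_gaussDensity
  have m1 : Measurable fun z : ℝ × ℝ => ENNReal.ofReal (|f z.2| ^ 2 * gaussDensity z.1 z.2) := by
    fun_prop
  have m2 : Measurable fun x : ℝ => ENNReal.ofReal (|f x| ^ 2) := by fun_prop
  rw [eNormSqH, ← lintegral_add_left m1.lintegral_prod_right']
  refine setLIntegral_congr_fun measurableSet_Ioc fun s hs => ?_
  have m3 : Measurable fun x => ENNReal.ofReal (|f x| ^ 2 * gaussDensity s x) :=
    m1.comp measurable_prodMk_left
  simp only
  rw [hWeight, ← lintegral_add_left m3]
  refine lintegral_congr fun x => ?_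
  have := gaussDensity_nonneg s x
  have h0 : 0 < s := hs.1
  rw [← ENNReal.ofReal_add (by positivity) (by positivity), sq_abs, sq_abs]
  congr 1
  ring

/-- `s ^ a * exp (-x² / (2 s))` is an antiderivative in `s`. -/
lemma hasDerivAt_rpow_mul_exp (a x : ℝ) {s : ℝ} (hs : 0 < s) :
    HasDerivAt (fun s => s ^ a * Real.exp (-(x ^ 2 / (2 * s))))
      (s ^ (a - 1) * (a + x ^ 2 / (2 * s)) * Real.exp (-(x ^ 2 / (2 * s)))) s := by
  have h1 : HasDerivAt (fun s : ℝ => -(x ^ 2 / (2 * s))) (x ^ 2 / (2 * s ^ 2)) s := by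
    have e : (fun s : ℝ => -(x ^ 2 / (2 * s))) = fun s => -(x ^ 2 / 2 * s⁻¹) := by
      ext y
      rw [← div_div, div_eq_mul_inv (x ^ 2 / 2)]
    rw [e]
    refine ((hasDerivAt_inv hs.ne').const_mul (x ^ 2 / 2)).fun_neg.congr_deriv ?_
    field_simp
  refine ((Real.hasDerivAt_rpow_const (p := a) (Or.inl hs.ne')).fun_mul h1.exp).congr_deriv ?_
  have : s ^ a = s ^ (a - 1) * s := by rw [← Real.rpow_add_one hs.ne']; simp
  rw [this]
  field_simp

lemma lintegral_rpow_mul_exp {a : ℝ} (ha : 0 < a) (x : ℝ) {T : ℝ} (hT : 0 ≤ T) :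
    ∫⁻ s in Ioc 0 T, ENNReal.ofReal
      (s ^ (a - 1) * (a + x ^ 2 / (2 * s)) * Real.exp (-(x ^ 2 / (2 * s)))) =
    ENNReal.ofReal (T ^ a * Real.exp (-(x ^ 2 / (2 * T)))) := by
  set F := fun s : ℝ => s ^ a * Real.exp (-(x ^ 2 / (2 * s)))
  have hcont : ContinuousOn F (Icc 0 T) := by
    intro s hs
    rcases hs.1.eq_or_lt with h | h
    · subst h
      have h1 : Tendsto (fun s : ℝ => s ^ a) (𝓝[Icc 0 T] 0) (𝓝 0) := by
        have : ContinuousAt (fun s : ℝ => s ^ a) 0 :=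
          Real.continuousAt_rpow_const _ _ (Or.inr ha.le)
        have h2 := this.tendsto
        rw [Real.zero_rpow ha.ne'] at h2
        exact h2.mono_left nhdsWithin_le_nhds
      have h0 : F 0 = 0 := by simp [F, Real.zero_rpow ha.ne']
      rw [ContinuousWithinAt, h0]
      refine squeeze_zero' (eventually_mem_nhdsWithin.mono fun s hs => ?_)
        (eventually_mem_nhdsWithin.mono fun s hs => ?_) h1
      · exact mul_nonneg (Real.rpow_nonneg hs.1 _) (Real.exp_nonneg _)
      · refine mul_le_of_le_one_right (Real.rpow_nonneg hs.1 _) (Real.exp_le_one_iff.2 ?_)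
        have := hs.1
        have : 0 ≤ x ^ 2 / (2 * s) := by positivity
        linarith
    · exact (hasDerivAt_rpow_mul_exp a x h).continuousAt.continuousWithinAt
  have hnn : ∀ s ∈ Ioc 0 T,
      0 ≤ s ^ (a - 1) * (a + x ^ 2 / (2 * s)) * Real.exp (-(x ^ 2 / (2 * s))) := by
    intro s hs
    have := hs.1
    positivity
  have hint : IntervalIntegrable (fun s : ℝ =>
      s ^ (a - 1) * (a + x ^ 2 / (2 * s)) * Real.exp (-(x ^ 2 / (2 * s)))) volume 0 T := by
    refine intervalIntegral.intervalIntegrable_deriv_of_nonneg (g := F)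
      (by rwa [uIcc_of_le hT]) ?_ ?_
    · intro s hs
      rw [min_eq_left hT, max_eq_right hT] at hs
      exact hasDerivAt_rpow_mul_exp a x hs.1
    · intro s hs
      rw [min_eq_left hT, max_eq_right hT] at hs
      exact hnn s ⟨hs.1, hs.2.le⟩
  rw [← ofReal_integral_eq_lintegral_ofReal
      ((intervalIntegrable_iff_integrableOn_Ioc_of_le hT).1 hint)
    ((ae_restrict_iff' measurableSet_Ioc).2 (ae_of_all _ hnn)),
    ← intervalIntegral.integral_of_le hT,
    intervalIntegral.integral_eq_sub_of_hasDerivAt_of_le hT hcont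
      (fun s hs => hasDerivAt_rpow_mul_exp a x hs.1) hint]
  simp [Real.zero_rpow ha.ne', F]

lemma gaussDensity_eq {s : ℝ} (hs : 0 < s) (x : ℝ) :
    gaussDensity s x =
      1 / √(2 * Real.pi) * (s ^ (-(1 / 2) : ℝ) * Real.exp (-(x ^ 2 / (2 * s)))) := by
  rw [gaussDensity, Real.sqrt_mul (by positivity), ← one_div_mul_one_div, one_div_sqrt_eq hs.le]
  ring

/-- The identity `∂ₛ(s φ_s(x)) = φ_s(x) (1 + x² / s) / 2`, integrated over `(0, T]`. -/
lemma lintegral_gaussDensity_mul (x : ℝ) {T : ℝ} (hT : 0 < T) :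
    ∫⁻ s in Ioc 0 T, ENNReal.ofReal ((1 + x ^ 2 / s) * gaussDensity s x) =
      ENNReal.ofReal (2 * T * gaussDensity T x) := by
  have h := lintegral_rpow_mul_exp (a := 1 / 2) (by norm_num) x hT.le
  have e : ∀ s ∈ Ioc 0 T, ENNReal.ofReal ((1 + x ^ 2 / s) * gaussDensity s x) =
      ENNReal.ofReal (2 / √(2 * Real.pi)) * ENNReal.ofReal
        (s ^ ((1 / 2 : ℝ) - 1) * (1 / 2 + x ^ 2 / (2 * s)) * Real.exp (-(x ^ 2 / (2 * s)))) := by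
    intro s hs
    have hs0 := hs.1
    rw [← ENNReal.ofReal_mul (by positivity), gaussDensity_eq hs0,
      (by norm_num : ((1 / 2 : ℝ) - 1) = -(1 / 2))]
    congr 1
    field_simp
  rw [setLIntegral_congr_fun measurableSet_Ioc e, lintegral_const_mul _ (by fun_prop), h,
    ← ENNReal.ofReal_mul (by positivity), gaussDensity_eq hT]
  congr 1
  have : T * T ^ (-(1 / 2) : ℝ) = T ^ (1 / 2 : ℝ) := by
    rw [mul_comm, ← Real.rpow_add_one hT.ne']; norm_num
  rw [← this]
  ring

/-- The weight `(T / s) ^ (1 / 4)` at the origin does not enlarge the norm. -/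
lemma lintegral_rpow_gaussDensity_mul_le (x : ℝ) {T : ℝ} (hT : 0 < T) :
    ∫⁻ s in Ioc 0 T, ENNReal.ofReal ((T / s) ^ (1 / 4 : ℝ)) *
      ENNReal.ofReal ((1 + x ^ 2 / s) * gaussDensity s x) ≤
      2 * ENNReal.ofReal (2 * T * gaussDensity T x) := by
  have h := lintegral_rpow_mul_exp (a := 1 / 4) (by norm_num) x hT.le
  have e : ∀ s ∈ Ioc 0 T, ENNReal.ofReal ((T / s) ^ (1 / 4 : ℝ)) *
      ENNReal.ofReal ((1 + x ^ 2 / s) * gaussDensity s x) ≤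
      ENNReal.ofReal (4 * T ^ (1 / 4 : ℝ) / √(2 * Real.pi)) * ENNReal.ofReal
        (s ^ ((1 / 4 : ℝ) - 1) * (1 / 4 + x ^ 2 / (2 * s)) * Real.exp (-(x ^ 2 / (2 * s)))) := by
    intro s hs
    have hs0 := hs.1
    have e1 : s ^ ((1 / 4 : ℝ) - 1) = s ^ (-(1 / 2) : ℝ) * (s ^ (1 / 4 : ℝ))⁻¹ := by
      rw [← Real.rpow_neg hs0.le, ← Real.rpow_add hs0]; norm_num
    rw [← ENNReal.ofReal_mul (by positivity), ← ENNReal.ofReal_mul (by positivity),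
      gaussDensity_eq hs0, e1, Real.div_rpow hT.le hs0.le]
    refine ENNReal.ofReal_le_ofReal ?_
    have h1 : 1 + x ^ 2 / s ≤ 4 * (1 / 4 + x ^ 2 / (2 * s)) := by
      have : 0 ≤ x ^ 2 / s := by positivity
      have e : x ^ 2 / (2 * s) = x ^ 2 / s / 2 := by field_simp
      rw [e]; linarith
    calc _ = (1 + x ^ 2 / s) * (T ^ (1 / 4 : ℝ) / √(2 * Real.pi) *
          (s ^ (-(1 / 2) : ℝ) * (s ^ (1 / 4 : ℝ))⁻¹) * Real.exp (-(x ^ 2 / (2 * s)))) := by ring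
      _ ≤ 4 * (1 / 4 + x ^ 2 / (2 * s)) * (T ^ (1 / 4 : ℝ) / √(2 * Real.pi) *
          (s ^ (-(1 / 2) : ℝ) * (s ^ (1 / 4 : ℝ))⁻¹) * Real.exp (-(x ^ 2 / (2 * s)))) := by gcongr
      _ = _ := by ring
  refine (setLIntegral_mono' measurableSet_Ioc e).trans ?_
  rw [lintegral_const_mul _ (by fun_prop), h,
    ← ENNReal.ofReal_mul (by positivity), gaussDensity_eq hT,
    (by simp : (2 : ENNReal) = ENNReal.ofReal 2), ← ENNReal.ofReal_mul (by positivity)]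
  apply le_of_eq
  congr 1
  have h1 : T * T ^ (-(1 / 2) : ℝ) = T ^ (1 / 4 : ℝ) * T ^ (1 / 4 : ℝ) := by
    rw [mul_comm, ← Real.rpow_add_one hT.ne', ← Real.rpow_add hT]; norm_num
  calc _ = 4 * (T ^ (1 / 4 : ℝ) * T ^ (1 / 4 : ℝ)) / √(2 * Real.pi) *
        Real.exp (-(x ^ 2 / (2 * T))) := by ring
    _ = _ := by rw [← h1]; ring

lemma ofReal_hWeight_integrand (f : ℝ → ℝ) (s x : ℝ) :
    ENNReal.ofReal (f x ^ 2 * (1 + x ^ 2 / s) * gaussDensity s x) =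
      ENNReal.ofReal (f x ^ 2) * ENNReal.ofReal ((1 + x ^ 2 / s) * gaussDensity s x) := by
  rw [← ENNReal.ofReal_mul (sq_nonneg _)]
  congr 1
  ring

/-- `𝓗` is the `L²` space of the law of `B_T`. -/
lemma eNormSqH_eq_gaussDensity {f : ℝ → ℝ} (hf : Measurable f) {T : ℝ} (hT : 0 < T) :
    eNormSqH T f = ∫⁻ x, ENNReal.ofReal (f x ^ 2) * ENNReal.ofReal (2 * T * gaussDensity T x) := by
  have hd := measurable_gaussDensity
  rw [eNormSqH_eq hf]
  unfold hWeight
  rw [lintegral_lintegral_swap (measurable_hWeight_integrand hf).aemeasurable]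
  refine lintegral_congr fun x => ?_
  have hm : Measurable fun s => ENNReal.ofReal ((1 + x ^ 2 / s) * gaussDensity s x) := by
    have := hd.comp (measurable_prodMk_right (y := x))
    simp only [Function.comp_def] at this
    fun_prop
  simp_rw [ofReal_hWeight_integrand]
  rw [lintegral_const_mul _ hm, lintegral_gaussDensity_mul x hT]

lemma lintegral_rpow_mul_hWeight_le {f : ℝ → ℝ} (hf : Measurable f) {T : ℝ} (hT : 0 < T) :
    ∫⁻ s in Ioc 0 T, ENNReal.ofReal ((T / s) ^ (1 / 4 : ℝ)) * hWeight f s ≤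
      2 * eNormSqH T f := by
  have hd := measurable_gaussDensity
  have hm : ∀ x, Measurable fun s => ENNReal.ofReal ((T / s) ^ (1 / 4 : ℝ)) *
      ENNReal.ofReal ((1 + x ^ 2 / s) * gaussDensity s x) := by
    intro x
    have := hd.comp (measurable_prodMk_right (y := x))
    simp only [Function.comp_def] at this
    fun_prop
  have hm2 : Measurable fun x =>
      ENNReal.ofReal (f x ^ 2) * ENNReal.ofReal (2 * T * gaussDensity T x) := by
    have := hd.comp (measurable_prodMk_left (x := T))
    simp only [Function.comp_def] at this
    fun_prop
  have hm3 := measurable_hWeight_integrand hf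
  have hm4 : ∀ s, Measurable fun x =>
      ENNReal.ofReal (f x ^ 2 * (1 + x ^ 2 / s) * gaussDensity s x) :=
    fun s => hm3.comp measurable_prodMk_left
  calc _ = ∫⁻ s in Ioc 0 T, ∫⁻ x, ENNReal.ofReal ((T / s) ^ (1 / 4 : ℝ)) *
        ENNReal.ofReal (f x ^ 2 * (1 + x ^ 2 / s) * gaussDensity s x) := by
        refine lintegral_congr fun s => ?_
        rw [hWeight, lintegral_const_mul _ (hm4 s)]
    _ = ∫⁻ x, ∫⁻ s in Ioc 0 T, ENNReal.ofReal ((T / s) ^ (1 / 4 : ℝ)) *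
        ENNReal.ofReal (f x ^ 2 * (1 + x ^ 2 / s) * gaussDensity s x) := by
        refine lintegral_lintegral_swap (Measurable.aemeasurable ?_)
        exact (by fun_prop : Measurable fun z : ℝ × ℝ =>
          ENNReal.ofReal ((T / z.1) ^ (1 / 4 : ℝ))).mul hm3
    _ ≤ ∫⁻ x, 2 * (ENNReal.ofReal (f x ^ 2) * ENNReal.ofReal (2 * T * gaussDensity T x)) := by
        refine lintegral_mono fun x => ?_
        simp_rw [ofReal_hWeight_integrand, mul_left_comm _ (ENNReal.ofReal (f x ^ 2))]
        rw [lintegral_const_mul _ (hm x)]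
        gcongr
        exact lintegral_rpow_gaussDensity_mul_le x hT
    _ = _ := by rw [lintegral_const_mul _ hm2, eNormSqH_eq_gaussDensity hf hT]

lemma gaussianReal_eq_withDensity {s : ℝ} (hs : 0 < s) :
    gaussianReal 0 s.toNNReal = volume.withDensity fun x => ENNReal.ofReal (gaussDensity s x) := by
  rw [gaussianReal_of_var_ne_zero _ (by simpa using hs)]
  congr 1
  ext x
  simp [gaussianPDF, gaussianPDFReal, gaussDensity, hs.le, neg_div]

lemma lintegral_gaussianReal {s : ℝ} (hs : 0 < s) {g : ℝ → ENNReal} (hg : Measurable g) :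
    ∫⁻ x, g x ∂(gaussianReal 0 s.toNNReal) = ∫⁻ x, g x * ENNReal.ofReal (gaussDensity s x) := by
  have hd : Measurable fun x => ENNReal.ofReal (gaussDensity s x) := by
    have := measurable_gaussDensity.comp (measurable_prodMk_left (x := s))
    simp only [Function.comp_def] at this
    fun_prop
  rw [gaussianReal_eq_withDensity hs, lintegral_withDensity_eq_lintegral_mul _ hd hg]
  simp [mul_comm]

/-- `𝓗` in terms of the Gaussian measure of variance `T`. -/
lemma eNormSqH_eq_gaussianReal {f : ℝ → ℝ} (hf : Measurable f) {T : ℝ} (hT : 0 < T) :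
    eNormSqH T f = ENNReal.ofReal (2 * T) *
      ∫⁻ x, ENNReal.ofReal (f x ^ 2) ∂(gaussianReal 0 T.toNNReal) := by
  have hd : Measurable fun x => ENNReal.ofReal (gaussDensity T x) := by
    have := measurable_gaussDensity.comp (measurable_prodMk_left (x := T))
    simp only [Function.comp_def] at this
    fun_prop
  rw [lintegral_gaussianReal hT (by fun_prop), eNormSqH_eq_gaussDensity hf hT,
    ← lintegral_const_mul _ (by fun_prop)]
  refine lintegral_congr fun x => ?_
  rw [ENNReal.ofReal_mul (by positivity)]
  ring

end HNorm

namespace IsRegularBifracBM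

variable {Ω : Type*} [MeasurableSpace Ω] {p K T : ℝ} {B : ℝ → Ω → ℝ} {P : Measure Ω}

lemma map_eq (hB : IsRegularBifracBM p K T B P) (hpK : p * K = 1) {s : ℝ} (hs : s ∈ Icc 0 T) :
    P.map (B s) = gaussianReal 0 s.toNNReal := by
  have := hB.isCenteredGaussianSpace.map_eq (timeVec s)
  rwa [processSpan_timeVec, hB.gcov_timeVec_self hpK hs] at this

lemma lintegral_eq_hWeight (hB : IsRegularBifracBM p K T B P) (hpK : p * K = 1) {f : ℝ → ℝ}
    (hf : Measurable f) {s : ℝ} (hs : s ∈ Ioc 0 T) :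
    ∫⁻ ω, ENNReal.ofReal (f (B s ω) ^ 2 * (1 + B s ω ^ 2 / s)) ∂P = hWeight f s := by
  have hs' : s ∈ Icc 0 T := ⟨hs.1.le, hs.2⟩
  have hs0 : 0 < s := hs.1
  have h : ∫⁻ ω, ENNReal.ofReal (f (B s ω) ^ 2 * (1 + B s ω ^ 2 / s)) ∂P =
      ∫⁻ x, ENNReal.ofReal (f x ^ 2 * (1 + x ^ 2 / s)) ∂(P.map (B s)) := by
    rw [lintegral_map (by fun_prop) (hB.measurable s)]
  rw [h, hB.map_eq hpK hs', lintegral_gaussianReal hs0 (by fun_prop), hWeight]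
  refine lintegral_congr fun x => ?_
  rw [← ENNReal.ofReal_mul (by positivity)]

lemma goodTime_and_ofReal_timeWeight (hB : IsRegularBifracBM p K T B P) (hpK : p * K = 1)
    {f : ℝ → ℝ} (hf : Measurable f) {s : ℝ} (hs : s ∈ Ioc 0 T) (hfin : hWeight f s < ⊤) :
    GoodTime B P f s ∧ ENNReal.ofReal (timeWeight B P f s) = hWeight f s := by
  have hs0 : 0 < s := hs.1
  have hfm : Measurable fun ω => f (B s ω) := hf.comp (hB.measurable s)
  have hBm := hB.measurable s
  have hm : Measurable fun ω => f (B s ω) ^ 2 * (1 + B s ω ^ 2 / s) := by fun_prop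
  have hnn : ∀ ω, 0 ≤ f (B s ω) ^ 2 * (1 + B s ω ^ 2 / s) := fun ω => by positivity
  have hint : Integrable (fun ω => f (B s ω) ^ 2 * (1 + B s ω ^ 2 / s)) P := by
    refine ⟨hm.aestronglyMeasurable, ?_⟩
    rw [hasFiniteIntegral_iff_ofReal (ae_of_all _ hnn), hB.lintegral_eq_hWeight hpK hf hs]
    exact hfin
  refine ⟨⟨?_, ?_⟩, ?_⟩
  · refine (memLp_two_iff_integrable_sq hfm.aestronglyMeasurable).2
      (hint.mono' (hfm.pow_const 2).aestronglyMeasurable (ae_of_all _ fun ω => ?_))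
    rw [Real.norm_eq_abs, abs_of_nonneg (sq_nonneg _)]
    exact le_mul_of_one_le_right (sq_nonneg _) (le_add_of_nonneg_right (by positivity))
  · refine (memLp_two_iff_integrable_sq (hfm.mul hBm).aestronglyMeasurable).2
      ((hint.const_mul s).mono' ((hfm.mul hBm).pow_const 2).aestronglyMeasurable
        (ae_of_all _ fun ω => ?_))
    rw [Real.norm_eq_abs, abs_of_nonneg (sq_nonneg _)]
    have e : s * (f (B s ω) ^ 2 * (1 + B s ω ^ 2 / s)) =
        s * f (B s ω) ^ 2 + (f (B s ω) * B s ω) ^ 2 := by field_simp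
    rw [e]
    exact le_add_of_nonneg_left (by positivity)
  · rw [timeWeight, ofReal_integral_eq_lintegral_ofReal hint (ae_of_all _ hnn),
      hB.lintegral_eq_hWeight hpK hf hs]

end IsRegularBifracBM

/-! ### Uniform bounds for the approximations -/

/-- The indicator of the strip `|s - r| < 2 * ε` around the diagonal. -/
noncomputable def nearKernel (ε r s : ℝ) : ℝ := if |s - r| < 2 * ε then 1 else 0

lemma measurable_nearKernel (ε : ℝ) : Measurable fun z : ℝ × ℝ => nearKernel ε z.1 z.2 :=
  Measurable.ite (measurableSet_lt (by fun_prop) measurable_const) measurable_const measurable_const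

lemma nearKernel_nonneg (ε r s : ℝ) : 0 ≤ nearKernel ε r s := by
  rw [nearKernel]; split_ifs <;> norm_num

/-- The double integral controlling the second moment of the approximations: near the diagonal the
increments are bounded by their variances, away from it by the singular correlation kernel. -/
lemma lintegral_lintegral_kernels_le {f : ℝ → ℝ} (hf : Measurable f) {T : ℝ} (hT : 0 < T)
    {g : ℝ → ℝ} (hgm : Measurable g) (hgsq : ∀ s, ENNReal.ofReal (g s ^ 2) ≤ hWeight f s)
    {ε : ℝ} (hε : 0 < ε) :
    ∫⁻ r in Ioc 0 T, ∫⁻ s in Ioc 0 T,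
        (ENNReal.ofReal (3 * ε) * ENNReal.ofReal (g s * g r * nearKernel ε r s) +
        ENNReal.ofReal (38 * ε ^ 2) * ENNReal.ofReal (g s * g r * corrKernel r s)) ≤
      ENNReal.ofReal (1240 * ε ^ 2) * eNormSqH T f := by
  have hWm := measurable_hWeight hf
  have hb₁ : ∫⁻ r in Ioc 0 T, ∫⁻ s in Ioc 0 T, ENNReal.ofReal (g s * g r * nearKernel ε r s) ≤
      ENNReal.ofReal (4 * ε) *
        ∫⁻ s in Ioc 0 T, ENNReal.ofReal ((T / s) ^ (1 / 4 : ℝ)) * hWeight f s := by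
    refine (lintegral_lintegral_mul_le measurableSet_Ioc hgm (measurable_nearKernel ε)
        (nearKernel_nonneg ε)
      (fun r s => by simp only [nearKernel, abs_sub_comm]) (w := fun _ => 1) measurable_const
      (fun _ _ => one_pos) (b := fun _ => ENNReal.ofReal (4 * ε)) ?_).trans ?_
    · intro s _
      calc _ ≤ ∫⁻ r, indicator (Ioo (s - 2 * ε) (s + 2 * ε)) 1 r := by
            refine (setLIntegral_le_lintegral _ _).trans (lintegral_mono fun r => ?_)
            simp only [nearKernel, div_one, mul_one]
            split_ifs with h
            · rw [abs_lt] at h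
              rw [indicator_of_mem (by constructor <;> linarith)]
              simp
            · simp
        _ = ENNReal.ofReal (4 * ε) := by
            rw [lintegral_indicator_one measurableSet_Ioo, Real.volume_Ioo]
            congr 1; ring
    · rw [← lintegral_const_mul _ (by fun_prop)]
      refine setLIntegral_mono' measurableSet_Ioc fun s hs => ?_
      have h1 : (1 : ENNReal) ≤ ENNReal.ofReal ((T / s) ^ (1 / 4 : ℝ)) := by
        rw [ENNReal.one_le_ofReal]
        exact Real.one_le_rpow ((one_le_div hs.1).2 hs.2) (by norm_num)
      gcongr
      exact (hgsq s).trans (le_mul_of_one_le_left zero_le h1)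
  have hb₂ : ∫⁻ r in Ioc 0 T, ∫⁻ s in Ioc 0 T, ENNReal.ofReal (g s * g r * corrKernel r s) ≤
      ENNReal.ofReal 16 *
        ∫⁻ s in Ioc 0 T, ENNReal.ofReal ((T / s) ^ (1 / 4 : ℝ)) * hWeight f s := by
    refine (lintegral_lintegral_mul_le measurableSet_Ioc hgm measurable_corrKernel corrKernel_nonneg
      corrKernel_comm (w := fun s => s ^ (1 / 4 : ℝ)) (by fun_prop)
      (fun s hs => Real.rpow_pos_of_pos hs.1 _)
      (b := fun s => ENNReal.ofReal (16 * (T / s) ^ (1 / 4 : ℝ))) ?_).trans ?_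
    · intro s hs
      refine le_trans (le_of_eq ?_) (lintegral_corrKernel_le hs.1 hs.2)
      refine setLIntegral_congr_fun measurableSet_Ioc fun r hr => ?_
      rw [Real.div_rpow hs.1.le hr.1.le]
    · rw [← lintegral_const_mul _ (by fun_prop)]
      refine lintegral_mono fun s => ?_
      rw [ENNReal.ofReal_mul (by norm_num), mul_assoc]
      gcongr
      exact hgsq s
  have hm1 : Measurable fun z : ℝ × ℝ => ENNReal.ofReal (g z.2 * g z.1 * nearKernel ε z.1 z.2) :=
    (((hgm.comp measurable_snd).mul (hgm.comp measurable_fst)).mul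
      (measurable_nearKernel ε)).ennreal_ofReal
  have hm2 : Measurable fun z : ℝ × ℝ => ENNReal.ofReal (g z.2 * g z.1 * corrKernel z.1 z.2) :=
    (((hgm.comp measurable_snd).mul (hgm.comp measurable_fst)).mul
      measurable_corrKernel).ennreal_ofReal
  -- the constant is `3 * 4 * 2` from the strip and `38 * 16 * 2` from the correlation kernel
  calc _ = ENNReal.ofReal (3 * ε) * (∫⁻ r in Ioc 0 T, ∫⁻ s in Ioc 0 T,
          ENNReal.ofReal (g s * g r * nearKernel ε r s)) +
        ENNReal.ofReal (38 * ε ^ 2) * ∫⁻ r in Ioc 0 T, ∫⁻ s in Ioc 0 T,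
          ENNReal.ofReal (g s * g r * corrKernel r s) := by
        rw [← lintegral_const_mul _ hm1.lintegral_prod_right',
          ← lintegral_const_mul _ hm2.lintegral_prod_right',
          ← lintegral_add_left (hm1.lintegral_prod_right'.const_mul _)]
        refine lintegral_congr fun r => ?_
        have hr1 : Measurable fun s => ENNReal.ofReal (g s * g r * nearKernel ε r s) :=
          hm1.comp measurable_prodMk_left
        have hr2 : Measurable fun s => ENNReal.ofReal (g s * g r * corrKernel r s) :=
          hm2.comp measurable_prodMk_left
        rw [lintegral_add_left (hr1.const_mul _), lintegral_const_mul _ hr1,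
          lintegral_const_mul _ hr2]
    _ ≤ ENNReal.ofReal (3 * ε) * (ENNReal.ofReal (4 * ε) * (2 * eNormSqH T f)) +
        ENNReal.ofReal (38 * ε ^ 2) * (ENNReal.ofReal 16 * (2 * eNormSqH T f)) := by
        have := lintegral_rpow_mul_hWeight_le hf hT
        gcongr
        · exact hb₁.trans (by gcongr)
        · exact hb₂.trans (by gcongr)
    _ = _ := by
        rw [(by simp : (2 : ENNReal) = ENNReal.ofReal 2), ← mul_assoc, ← mul_assoc, ← mul_assoc,
          ← mul_assoc, ← add_mul, ← ENNReal.ofReal_mul (by positivity),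
          ← ENNReal.ofReal_mul (by positivity), ← ENNReal.ofReal_mul (by positivity),
          ← ENNReal.ofReal_mul (by positivity), ← ENNReal.ofReal_add (by positivity)
              (by positivity)]
        congr 2
        ring

namespace IsRegularBifracBM

variable {Ω : Type*} [MeasurableSpace Ω] {p K T : ℝ} {B : ℝ → Ω → ℝ} {P : Measure Ω}

lemma measurable_uncurry (hB : IsRegularBifracBM p K T B P) :
    Measurable fun z : ℝ × Ω => B z.1 z.2 :=
  measurable_uncurry_of_continuous_of_measurable hB.continuous hB.measurable

/-- From bounds on the correlations of weighted increments to a bound on the second moment of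
their time integral. -/
lemma timeIntegral_bound [IsProbabilityMeasure P] (hB : IsRegularBifracBM p K T B P)
    (hpK : p * K = 1) {f : ℝ → ℝ} (hf : Measurable f) (hT : 0 < T) (hfin : eNormSqH T f < ⊤)
    {ε : ℝ} (hε : 0 < ε) {A : Set ℝ} (hA : MeasurableSet A) (hAT : A ⊆ Ioc 0 T)
    {F : Ω → ℝ → ℝ} (hF : Measurable (Function.uncurry F))
    (hdiag : ∀ s ∈ A, GoodTime B P f s → MemLp (fun ω => F ω s) 2 P ∧
      ∫ ω, F ω s ^ 2 ∂P ≤ 3 * ε * timeWeight B P f s)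
    (hfar : ∀ r ∈ A, ∀ s ∈ A, r + 2 * ε ≤ s → GoodTime B P f r → GoodTime B P f s →
      |∫ ω, F ω s * F ω r ∂P| ≤
        √(timeWeight B P f s) * √(timeWeight B P f r) * (38 * ε ^ 2 / √(r * (s - r)))) :
    (∀ᵐ ω ∂P, IntegrableOn (F ω) A) ∧ MemLp (fun ω => ∫ s in A, F ω s) 2 P ∧
    ENNReal.ofReal (∫ ω, (∫ s in A, F ω s) ^ 2 ∂P) ≤
      ENNReal.ofReal (1240 * ε ^ 2) * eNormSqH T f := by
  have hWm := measurable_hWeight hf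
  have hbase : ∫⁻ s in Ioc 0 T, hWeight f s < ⊤ := by rwa [← eNormSqH_eq hf]
  have hgood : ∀ᵐ s ∂volume.restrict A, s ∈ A ∧ GoodTime B P f s ∧
      ENNReal.ofReal (timeWeight B P f s) = hWeight f s ∧ hWeight f s < ⊤ := by
    have h1 : ∀ᵐ s ∂volume.restrict A, hWeight f s < ⊤ := by
      refine ae_lt_top hWm (ne_of_lt ?_)
      exact (lintegral_mono_set hAT).trans_lt hbase
    filter_upwards [h1, ae_restrict_mem hA] with s hs hsA
    exact ⟨hsA, (hB.goodTime_and_ofReal_timeWeight hpK hf (hAT hsA) hs).1,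
      (hB.goodTime_and_ofReal_timeWeight hpK hf (hAT hsA) hs).2, hs⟩
  have : IsFiniteMeasure (volume.restrict A) :=
    ⟨by rw [Measure.restrict_apply_univ]
        exact (measure_mono hAT).trans_lt (by simp)⟩
  set g : ℝ → ℝ := fun s => √(hWeight f s).toReal with hg
  have hgm : Measurable g := by fun_prop
  have hg0 : ∀ s, 0 ≤ g s := fun s => Real.sqrt_nonneg _
  have hgsq : ∀ s, ENNReal.ofReal (g s ^ 2) ≤ hWeight f s := by
    intro s
    rw [hg]
    simp only
    rw [Real.sq_sqrt ENNReal.toReal_nonneg]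
    exact ENNReal.ofReal_toReal_le
  have hgW : ∀ s ∈ A, ENNReal.ofReal (timeWeight B P f s) = hWeight f s →
      √(timeWeight B P f s) = g s := by
    intro s hs h
    rw [hg]
    simp only
    rw [← h, ENNReal.toReal_ofReal (hB.timeWeight_nonneg hpK f ⟨(hAT hs).1.le, (hAT hs).2⟩)]
  have hfinF : ∫⁻ s in A, ∫⁻ ω, ENNReal.ofReal (F ω s ^ 2) ∂P ≠ ⊤ := by
    refine ne_of_lt (lt_of_le_of_lt (b := ∫⁻ s in A, ENNReal.ofReal (3 * ε) * hWeight f s) ?_ ?_)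
    · refine lintegral_mono_ae ?_
      filter_upwards [hgood] with s hs
      obtain ⟨hs1, hs2, hs3, -⟩ := hs
      obtain ⟨hd1, hd2⟩ := hdiag s hs1 hs2
      rw [← ofReal_integral_eq_lintegral_ofReal hd1.integrable_sq
          (ae_of_all _ fun ω => sq_nonneg _),
        ← hs3, ← ENNReal.ofReal_mul (by positivity)]
      exact ENNReal.ofReal_le_ofReal hd2
    · rw [lintegral_const_mul _ hWm]
      exact ENNReal.mul_lt_top ENNReal.ofReal_lt_top ((lintegral_mono_set hAT).trans_lt hbase)
  obtain ⟨c1, c2, c3⟩ := memLp_integral_and_integral_sq_le hF hfinF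
  refine ⟨c1, c2, c3.trans ?_⟩
  have hcorr : ∀ r s, r ∈ A → GoodTime B P f r →
      ENNReal.ofReal (timeWeight B P f r) = hWeight f r → s ∈ A → GoodTime B P f s →
      ENNReal.ofReal (timeWeight B P f s) = hWeight f s → r + 2 * ε ≤ s →
      |∫ ω, F ω s * F ω r ∂P| ≤ g s * g r * (38 * ε ^ 2 * corrKernel r s) := by
    intro r s hr gr wr hs gs ws hrs
    refine (hfar r hr s hs hrs gr gs).trans (le_of_eq ?_)
    rw [hgW r hr wr, hgW s hs ws, corrKernel, min_eq_left (by linarith), abs_of_pos (by linarith)]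
    ring
  have hpt : ∀ᵐ r ∂volume.restrict A, ∀ᵐ s ∂volume.restrict A,
      ENNReal.ofReal |∫ ω, F ω s * F ω r ∂P| ≤
        ENNReal.ofReal (3 * ε) * ENNReal.ofReal (g s * g r * nearKernel ε r s) +
        ENNReal.ofReal (38 * ε ^ 2) * ENNReal.ofReal (g s * g r * corrKernel r s) := by
    filter_upwards [hgood] with r hr
    filter_upwards [hgood] with s hs
    obtain ⟨hr1, hr2, hr3, -⟩ := hr
    obtain ⟨hs1, hs2, hs3, -⟩ := hs
    have hk := corrKernel_nonneg r s
    have hk1 := nearKernel_nonneg ε r s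
    have hgr := hg0 r
    have hgs := hg0 s
    rw [← ENNReal.ofReal_mul (by positivity), ← ENNReal.ofReal_mul (by positivity),
      ← ENNReal.ofReal_add (by positivity) (by positivity)]
    refine ENNReal.ofReal_le_ofReal ?_
    by_cases hnear : |s - r| < 2 * ε
    · have e : nearKernel ε r s = 1 := by simp [nearKernel, hnear]
      have h1 := abs_integral_mul_le_sqrt (hdiag s hs1 hs2).1 (hdiag r hr1 hr2).1
      have h2 : ∀ q ∈ A, GoodTime B P f q → ENNReal.ofReal (timeWeight B P f q) = hWeight f q →
          √(∫ ω, F ω q ^ 2 ∂P) ≤ √(3 * ε) * g q := by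
        intro q hq gq wq
        rw [← hgW q hq wq, ← Real.sqrt_mul (by positivity)]
        exact Real.sqrt_le_sqrt (hdiag q hq gq).2
      have h3 := h1.trans (mul_le_mul (h2 s hs1 hs2 hs3) (h2 r hr1 hr2 hr3) (by positivity)
        (by positivity))
      have h4 : √(3 * ε) * g s * (√(3 * ε) * g r) = 3 * ε * (g s * g r * nearKernel ε r s) := by
        rw [e]
        have := Real.mul_self_sqrt (by positivity : 0 ≤ 3 * ε)
        linear_combination (g s * g r) * this
      have h5 : 0 ≤ 38 * ε ^ 2 * (g s * g r * corrKernel r s) := by positivity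
      linarith
    · rw [not_lt] at hnear
      have h5 : 0 ≤ 3 * ε * (g s * g r * nearKernel ε r s) := by positivity
      rcases le_total r s with h | h
      · rw [abs_of_nonneg (by linarith)] at hnear
        have := hcorr r s hr1 hr2 hr3 hs1 hs2 hs3 (by linarith)
        linarith
      · rw [abs_of_nonpos (by linarith)] at hnear
        have := hcorr s r hs1 hs2 hs3 hr1 hr2 hr3 (by linarith)
        rw [corrKernel_comm] at this
        simp_rw [mul_comm (F _ r)] at this
        linarith
  calc _ ≤ ∫⁻ r in A, ∫⁻ s in A,
          (ENNReal.ofReal (3 * ε) * ENNReal.ofReal (g s * g r * nearKernel ε r s) +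
        ENNReal.ofReal (38 * ε ^ 2) * ENNReal.ofReal (g s * g r * corrKernel r s)) :=
        lintegral_mono_ae (hpt.mono fun r hr => lintegral_mono_ae hr)
    _ ≤ ∫⁻ r in Ioc 0 T, ∫⁻ s in Ioc 0 T,
        (ENNReal.ofReal (3 * ε) * ENNReal.ofReal (g s * g r * nearKernel ε r s) +
        ENNReal.ofReal (38 * ε ^ 2) * ENNReal.ofReal (g s * g r * corrKernel r s)) :=
        (lintegral_mono fun r => lintegral_mono_set hAT).trans (lintegral_mono_set hAT)
    _ ≤ _ := lintegral_lintegral_kernels_le hf hT hgm hgsq hε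

end IsRegularBifracBM

/-- The properties of the approximations at scale `ε` that are uniform in `ε`: the pathwise
integrals exist and are bounded in `L²` by the norm of `f`. -/
def IsBoundedApprox {Ω : Type*} [MeasurableSpace Ω] (P : Measure Ω) (T : ℝ)
    (g : ℝ → ℝ → Ω → ℝ) (t ε : ℝ) (M : ENNReal) : Prop :=
  (∀ᵐ ω ∂P, IntervalIntegrable (fun s => g ε s ω) volume 0 (min t (T - ε))) ∧
  MemLp (fun ω => 1 / ε * ∫ s in (0 : ℝ)..min t (T - ε), g ε s ω) 2 P ∧
  ENNReal.ofReal (∫ ω, (1 / ε * ∫ s in (0 : ℝ)..min t (T - ε), g ε s ω) ^ 2 ∂P) ≤ M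

namespace IsRegularBifracBM

variable {Ω : Type*} [MeasurableSpace Ω] {p K T : ℝ} {B : ℝ → Ω → ℝ} {P : Measure Ω}

/-- Passing from a time integral to its normalization by `1 / ε`. -/
lemma ofReal_scale {ε : ℝ} (hε : 0 < ε) {J : Ω → ℝ} {N : ENNReal}
    (h : ENNReal.ofReal (∫ ω, J ω ^ 2 ∂P) ≤ ENNReal.ofReal (1240 * ε ^ 2) * N) :
    ENNReal.ofReal (∫ ω, (1 / ε * J ω) ^ 2 ∂P) ≤ 1240 * N := by
  simp_rw [mul_pow]
  rw [integral_const_mul, ENNReal.ofReal_mul (by positivity)]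
  calc _ ≤ ENNReal.ofReal ((1 / ε) ^ 2) * (ENNReal.ofReal (1240 * ε ^ 2) * N) := by gcongr
    _ = _ := by
      rw [← mul_assoc, ← ENNReal.ofReal_mul (by positivity)]
      congr 1
      have : (1 / ε) ^ 2 * (1240 * ε ^ 2) = 1240 := by field_simp
      rw [this]; simp

lemma forward_bound [IsProbabilityMeasure P] (hB : IsRegularBifracBM p K T B P) (hp : 1 ≤ p)
    (hp2 : p ≤ 2) (hpK : p * K = 1) {f : ℝ → ℝ} (hf : Measurable f) (hT : 0 < T)
    (hfin : eNormSqH T f < ⊤) {t ε : ℝ} (ht : 0 ≤ t) (hε : 0 < ε) (hεT : ε < T) :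
    IsBoundedApprox P T (forwardIntegrand B f) t ε (1240 * eNormSqH T f) := by
  set τ := min t (T - ε)
  have hτ0 : 0 ≤ τ := le_min ht (by linarith)
  have hτT : τ ≤ T - ε := min_le_right _ _
  have hBm := hB.measurable_uncurry
  have hF : Measurable (Function.uncurry fun ω s => forwardIntegrand B f ε s ω) := by
    have h1 : Measurable fun z : Ω × ℝ => B z.2 z.1 := hBm.comp measurable_swap
    have h2 : Measurable fun z : Ω × ℝ => B (z.2 + ε) z.1 :=
      hBm.comp (by fun_prop : Measurable fun z : Ω × ℝ => (z.2 + ε, z.1))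
    exact (hf.comp h1).mul (h2.sub h1)
  obtain ⟨h1, h2, h3⟩ := hB.timeIntegral_bound hpK hf hT hfin hε (A := Ioc 0 τ) measurableSet_Ioc
    (Ioc_subset_Ioc_right (by linarith)) hF
    (fun s hs gs => by
      have := hB.memLp_and_integral_sq_le hp hpK hf hs.1 (by linarith [hs.2]) hs.1.le
        (b := s + ε) (by linarith) (by linarith [hs.2]) gs
      rwa [add_sub_cancel_left] at this)
    (fun r hr s hs hrs gr gs => hB.forward_far hp hp2 hpK hf hr.1 hε hrs (by linarith [hs.2]) gr gs)
  refine ⟨?_, ?_, ?_⟩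
  · filter_upwards [h1] with ω hω
    exact (intervalIntegrable_iff_integrableOn_Ioc_of_le hτ0).2 hω
  · change MemLp (fun ω => 1 / ε * ∫ s in (0 : ℝ)..τ, forwardIntegrand B f ε s ω) 2 P
    simp_rw [intervalIntegral.integral_of_le hτ0]
    exact h2.const_mul _
  · change ENNReal.ofReal (∫ ω, (1 / ε * ∫ s in (0 : ℝ)..τ, forwardIntegrand B f ε s ω) ^ 2 ∂P) ≤ _
    simp_rw [intervalIntegral.integral_of_le hτ0]
    exact ofReal_scale hε h3

lemma backward_bound [IsProbabilityMeasure P] (hB : IsRegularBifracBM p K T B P) (hp : 1 ≤ p)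
    (hp2 : p ≤ 2) (hpK : p * K = 1) {f : ℝ → ℝ} (hf : Measurable f) (hT : 0 < T)
    (hfin : eNormSqH T f < ⊤) {t ε : ℝ} (ht : 0 ≤ t) (hε : 0 < ε) (hεT : ε < T) :
    IsBoundedApprox P T (backwardIntegrand B f) t ε (1240 * eNormSqH T f) := by
  set τ := min t (T - ε)
  have hτ0 : 0 ≤ τ := le_min ht (by linarith)
  have hτT : τ ≤ T - ε := min_le_right _ _
  have hBm := hB.measurable_uncurry
  set F : Ω → ℝ → ℝ := fun ω s => f (B s ω) * (B s ω - B (s - ε) ω) with hFdef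
  have hF : Measurable (Function.uncurry F) := by
    have h1 : Measurable fun z : Ω × ℝ => B z.2 z.1 := hBm.comp measurable_swap
    have h2 : Measurable fun z : Ω × ℝ => B (z.2 - ε) z.1 :=
      hBm.comp (by fun_prop : Measurable fun z : Ω × ℝ => (z.2 - ε, z.1))
    exact (hf.comp h1).mul (h1.sub h2)
  obtain ⟨h1, h2, h3⟩ := hB.timeIntegral_bound hpK hf hT hfin hε (A := Ioc ε (τ + ε))
    measurableSet_Ioc (Ioc_subset_Ioc hε.le (by linarith)) hF
    (fun s hs gs => by
      have := hB.memLp_and_integral_sq_le hp hpK hf (hε.trans hs.1) (by linarith [hs.2])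
        (a := s - ε) (b := s) (by linarith [hs.1]) (by linarith) (by linarith [hs.2]) gs
      rwa [sub_sub_cancel] at this)
    (fun r hr s hs hrs gr gs => hB.backward_far hp hp2 hpK hf hr.1.le hε hrs
      (by linarith [hs.2]) gr gs)
  -- the backward integrand at time `s` is `F ω (s + ε)`, so the time integral of `F` runs over
  -- the shifted interval
  have hshift : ∀ ω, (fun s => backwardIntegrand B f ε s ω) = fun s => F ω (s + ε) := by
    intro ω; ext s; simp [backwardIntegrand, hFdef]
  have hint : ∀ ω,
      ∫ s in (0 : ℝ)..τ, backwardIntegrand B f ε s ω = ∫ s in Ioc ε (τ + ε), F ω s := by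
    intro ω
    rw [hshift, intervalIntegral.integral_comp_add_right (F ω), zero_add,
      intervalIntegral.integral_of_le (by linarith)]
  refine ⟨?_, ?_, ?_⟩
  · filter_upwards [h1] with ω hω
    have := ((intervalIntegrable_iff_integrableOn_Ioc_of_le (by linarith)).2 hω).comp_add_right ε
    rw [hshift]
    simpa using this
  · change MemLp (fun ω => 1 / ε * ∫ s in (0 : ℝ)..τ, backwardIntegrand B f ε s ω) 2 P
    simp_rw [hint]
    exact h2.const_mul _
  · change ENNReal.ofReal (∫ ω, (1 / ε * ∫ s in (0 : ℝ)..τ, backwardIntegrand B f ε s ω) ^ 2 ∂P) ≤ _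
    simp_rw [hint]
    exact ofReal_scale hε h3

end IsRegularBifracBM

/-! ### Correlations of squares of Gaussian variables -/

namespace IsCenteredGaussianSpace

variable {Ω E : Type*} [MeasurableSpace Ω] [AddCommGroup E] [Module ℝ E]
  {G : E →ₗ[ℝ] Ω → ℝ} {P : Measure Ω}

/-- The correlation of two centered squares weighted by bounded functions of `X` and `Y`. Here `w`
is the projection of `u` on the span of `x`, `y` and `v`; the rest of `u` is independent of
everything else and only contributes through its variance. -/
lemma abs_integral_mul_sq_sub_mul_sq_sub_le (hG : IsCenteredGaussianSpace G P) {g : ℝ → ℝ}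
    (hg : Measurable g) {M : ℝ} (hM : ∀ z, |g z| ≤ M) {x y u v w : E}
    (hx : gcov G P (u - w) x = 0) (hy : gcov G P (u - w) y = 0) (hv : gcov G P (u - w) v = 0)
    (hw : gcov G P (u - w) w = 0) (a b : ℝ) :
    |∫ ω, (g (G x ω) * (G u ω ^ 2 - a)) * (g (G y ω) * (G v ω ^ 2 - b)) ∂P| ≤
      M ^ 2 * √(∫ ω, (G v ω ^ 2 - b) ^ 2 ∂P) *
        (√(stdMoment 2) * gcov G P w w + gcov G P w w + |gcov G P u u - a|) := by
  have := hG.isGaussian.isProbabilityMeasure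
  have hM0 : 0 ≤ M := (abs_nonneg _).trans (hM 0)
  set u' := u - w with hu'
  have hU : ∀ ω, G u ω = G w ω + G u' ω := fun ω => by simp [u']
  set q := gcov G P w w
  have hq : 0 ≤ q := gcov_self_nonneg w
  have hu'u' : gcov G P u' u' = gcov G P u u - q := by
    have h1 : gcov G P u' u' = gcov G P u' u - gcov G P u' w := hG.gcov_sub_right _ _ _
    have h2 : gcov G P u' u = gcov G P u u - gcov G P w u := hG.gcov_sub_left _ _ _
    have h3 : gcov G P u' w = gcov G P u w - gcov G P w w := hG.gcov_sub_left _ _ _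
    rw [gcov_comm w u] at h2
    linarith
  set Φ : Ω → ℝ := fun ω => g (G x ω) * g (G y ω) * (G v ω ^ 2 - b) with hΦ
  have hgx : Measurable fun ω => g (G x ω) := hg.comp (hG.measurable x)
  have hgy : Measurable fun ω => g (G y ω) := hg.comp (hG.measurable y)
  have hV2 : MemLp (fun ω => G v ω ^ 2 - b) 2 P := (hG.memLp_pow v 2).sub (memLp_const b)
  have hgg : ∀ ω, |g (G x ω) * g (G y ω)| ≤ M ^ 2 := fun ω => by
    rw [abs_mul, sq]; exact mul_le_mul (hM _) (hM _) (abs_nonneg _) hM0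
  have hΦm : Measurable Φ := (hgx.mul hgy).mul (((hG.measurable v).pow_const 2).sub_const b)
  have hΦ2 : MemLp Φ 2 P := by
    refine (hV2.const_mul (M ^ 2)).mono hΦm.aestronglyMeasurable (ae_of_all _ fun ω => ?_)
    simp only [hΦ, norm_mul, Real.norm_eq_abs]
    rw [← abs_mul, abs_of_nonneg (by positivity : 0 ≤ M ^ 2)]
    exact mul_le_mul_of_nonneg_right (hgg ω) (abs_nonneg _)
  have hΦN : √(∫ ω, Φ ω ^ 2 ∂P) ≤ M ^ 2 * √(∫ ω, (G v ω ^ 2 - b) ^ 2 ∂P) := by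
    rw [← Real.sqrt_sq (by positivity : 0 ≤ M ^ 2), ← Real.sqrt_mul (by positivity),
      ← integral_const_mul]
    refine Real.sqrt_le_sqrt (integral_mono hΦ2.integrable_sq (hV2.integrable_sq.const_mul _)
      fun ω => ?_)
    simp only [hΦ, mul_pow _ (G v ω ^ 2 - b)]
    refine mul_le_mul_of_nonneg_right ?_ (sq_nonneg _)
    rw [← sq_abs]
    exact pow_le_pow_left₀ (abs_nonneg _) (hgg ω) 2
  have hind : IndepFun (fun ω (i : Fin 4) => G (![x, y, v, w] i) ω)
      (fun ω (_ : Unit) => G u' ω) P := by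
    refine hG.indepFun _ (fun _ => u') fun i _ => ?_
    rw [gcov_comm]
    fin_cases i <;> assumption
  have hprod : ∀ (φ : (Fin 4 → ℝ) → ℝ) (ψ : ℝ → ℝ), Measurable φ → Measurable ψ →
      ∫ ω, φ (fun i => G (![x, y, v, w] i) ω) * ψ (G u' ω) ∂P =
        (∫ ω, φ (fun i => G (![x, y, v, w] i) ω) ∂P) * ∫ ω, ψ (G u' ω) ∂P := by
    intro φ ψ hφ hψ
    exact (hind.comp hφ (hψ.comp (measurable_pi_apply ()))).integral_fun_mul_eq_mul_integral
      (hφ.comp (measurable_pi_lambda _ fun i => hG.measurable _)).aestronglyMeasurable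
      (hψ.comp (hG.measurable u')).aestronglyMeasurable
  have hm : ∀ i : Fin 4, Measurable fun z : Fin 4 → ℝ => z i := measurable_pi_apply
  have hc1 : ∫ ω, Φ ω * (2 * (G w ω * G u' ω)) ∂P = 0 := by
    have h := hprod (fun z => 2 * (g (z 0) * g (z 1) * (z 2 ^ 2 - b) * z 3)) id
      (by fun_prop) measurable_id
    simp only [id, hG.integral_eq_zero, mul_zero] at h
    rw [← h]; congr 1; ext ω; simp [hΦ]; ring
  have hc2 : ∫ ω, Φ ω * (G u' ω ^ 2 - a) ∂P = (∫ ω, Φ ω ∂P) * (gcov G P u u - q - a) := by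
    have h := hprod (fun z => g (z 0) * g (z 1) * (z 2 ^ 2 - b)) (fun z => z ^ 2 - a)
      (by fun_prop) (by fun_prop)
    rw [integral_sub (hG.memLp_two u').integrable_sq (integrable_const _), ← gcov_self, hu'u'] at h
    simpa using h
  have i1 : Integrable (fun ω => Φ ω * G w ω ^ 2) P :=
    integrable_mul_of_memLp_two hΦ2 (hG.memLp_pow w 2)
  have i2 : Integrable (fun ω => Φ ω * (2 * (G w ω * G u' ω))) P := by
    refine integrable_mul_of_memLp_two hΦ2 ?_
    have h := ((hG.memLp_pow u 2).sub (hG.memLp_pow w 2)).sub (hG.memLp_pow u' 2)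
    refine h.ae_eq (ae_of_all _ fun ω => ?_)
    simp only [Pi.sub_apply, hU]; ring
  have i3 : Integrable (fun ω => Φ ω * (G u' ω ^ 2 - a)) P :=
    integrable_mul_of_memLp_two hΦ2 ((hG.memLp_pow u' 2).sub (memLp_const a))
  have hexp : ∫ ω, (g (G x ω) * (G u ω ^ 2 - a)) * (g (G y ω) * (G v ω ^ 2 - b)) ∂P =
      ∫ ω, Φ ω * G w ω ^ 2 ∂P + (∫ ω, Φ ω ∂P) * (gcov G P u u - q - a) := by
    have e : (fun ω => (g (G x ω) * (G u ω ^ 2 - a)) * (g (G y ω) * (G v ω ^ 2 - b))) = fun ω =>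
        Φ ω * G w ω ^ 2 + (Φ ω * (2 * (G w ω * G u' ω)) + Φ ω * (G u' ω ^ 2 - a)) := by
      ext ω; rw [hU]; simp only [hΦ]; ring
    rw [e, integral_add_three i1 i2 i3, hc1, hc2]
    ring
  have t1 : |∫ ω, Φ ω * G w ω ^ 2 ∂P| ≤
      M ^ 2 * √(∫ ω, (G v ω ^ 2 - b) ^ 2 ∂P) * (√(stdMoment 2) * q) := by
    refine (abs_integral_mul_le_sqrt hΦ2 (hG.memLp_pow w 2)).trans
      (mul_le_mul hΦN (le_of_eq ?_) (Real.sqrt_nonneg _) (by positivity))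
    have h4 := hG.integral_pow w 2
    simp_rw [← pow_mul]
    rw [h4, mul_comm, Real.sqrt_mul (stdMoment_nonneg 2), Real.sqrt_sq hq]
  have t2 : |∫ ω, Φ ω ∂P| ≤ M ^ 2 * √(∫ ω, (G v ω ^ 2 - b) ^ 2 ∂P) := by
    have h := abs_integral_mul_le_sqrt hΦ2 (memLp_const (1 : ℝ))
    simp at h
    exact h.trans hΦN
  have t3 : |gcov G P u u - q - a| ≤ q + |gcov G P u u - a| := by
    have e : gcov G P u u - q - a = (gcov G P u u - a) - q := by ring
    rw [e, add_comm]
    refine (abs_sub _ _).trans ?_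
    rw [abs_of_nonneg hq]
  rw [hexp]
  refine (abs_add_le _ _).trans ?_
  rw [abs_mul]
  calc _ ≤ M ^ 2 * √(∫ ω, (G v ω ^ 2 - b) ^ 2 ∂P) * (√(stdMoment 2) * q) +
        M ^ 2 * √(∫ ω, (G v ω ^ 2 - b) ^ 2 ∂P) * (q + |gcov G P u u - a|) :=
        add_le_add t1 (mul_le_mul t2 t3 (abs_nonneg _) (by positivity))
    _ = _ := by ring

/-- The projection on the span of `x`, `y` and `v` is obtained from the projection on the span of
`x` and `y` by adding the component along `v' = v - v₁`. -/
lemma exists_proj_add (hG : IsCenteredGaussianSpace G P) {x y u v u₁ v₁ : E} {α β α' β' : ℝ}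
    (hu₁ : u₁ = α • x + β • y) (hv₁ : v₁ = α' • x + β' • y)
    (hux : gcov G P (u - u₁) x = 0) (huy : gcov G P (u - u₁) y = 0)
    (hvx : gcov G P (v - v₁) x = 0) (hvy : gcov G P (v - v₁) y = 0)
    (hv' : 0 < gcov G P v v - gcov G P v₁ v₁) :
    ∃ w, gcov G P (u - w) x = 0 ∧ gcov G P (u - w) y = 0 ∧ gcov G P (u - w) v = 0 ∧
      gcov G P (u - w) w = 0 ∧
      gcov G P w w = gcov G P u₁ u₁ +
        (gcov G P u v - gcov G P u₁ v₁) ^ 2 / (gcov G P v v - gcov G P v₁ v₁) := by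
  set d := gcov G P v v - gcov G P v₁ v₁ with hd
  set e := gcov G P u v - gcov G P u₁ v₁ with he
  have hd0 : d ≠ 0 := hv'.ne'
  have ortho : ∀ z, gcov G P z x = 0 → gcov G P z y = 0 →
      gcov G P z u₁ = 0 ∧ gcov G P z v₁ = 0 := by
    intro z h1 h2
    rw [hu₁, hv₁, hG.gcov_add_right, hG.gcov_add_right]
    simp [gcov_smul_right, h1, h2]
  obtain ⟨a1, a2⟩ := ortho _ hux huy
  obtain ⟨b1, b2⟩ := ortho _ hvx hvy
  rw [hG.gcov_sub_left, sub_eq_zero] at hux huy hvx hvy a1 a2 b1 b2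
  have c1 : gcov G P u₁ v = gcov G P u₁ v₁ := by rw [gcov_comm, b1, gcov_comm]
  have c2 : gcov G P v₁ v = gcov G P v₁ v₁ := by rw [gcov_comm, b2]
  have c3 : gcov G P v₁ u₁ = gcov G P u₁ v₁ := gcov_comm _ _
  have c5 : gcov G P u v = e + gcov G P u₁ v₁ := by rw [he]; ring
  have c6 : gcov G P v v = d + gcov G P v₁ v₁ := by rw [hd]; ring
  refine ⟨u₁ + (e / d) • (v - v₁), ?_, ?_, ?_, ?_, ?_⟩ <;>
    simp only [hG.gcov_sub_left, hG.gcov_add_left, hG.gcov_sub_right, hG.gcov_add_right,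
      gcov_smul_left, gcov_smul_right, hux, huy, hvx, hvy, a1, a2, b1, b2, c1, c2, c3, c5, c6] <;>
    field_simp <;> ring

end IsCenteredGaussianSpace

/-! ### Correlations of squared increments -/

lemma one_le_two_mul_one_div_two_rpow {K : ℝ} (hK : K ≤ 1) : 1 ≤ 2 * (1 / (2 : ℝ) ^ K) := by
  rw [mul_one_div, one_le_div (by positivity)]
  calc (2 : ℝ) ^ K ≤ 2 ^ (1 : ℝ) := Real.rpow_le_rpow_of_exponent_le (by norm_num) hK
    _ = 2 := Real.rpow_one 2

namespace IsRegularBifracBM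

variable {Ω : Type*} [MeasurableSpace Ω] {p K T : ℝ} {B : ℝ → Ω → ℝ} {P : Measure Ω}

/-- The integrand of the weighted quadratic variation, centered by its asymptotic mean. -/
noncomputable def quadVarIntegrand (K : ℝ) (B : ℝ → Ω → ℝ) (g : ℝ → ℝ) (ε s : ℝ) (ω : Ω) : ℝ :=
  g (B s ω) * ((B (s + ε) ω - B s ω) ^ 2 - 2 * (1 / 2 ^ K) * ε)

lemma integral_incr_pow_le (hB : IsRegularBifracBM p K T B P) (hp : 1 ≤ p) (hpK : p * K = 1)
    {r s : ℝ} (hr : 0 ≤ r) (hrs : r ≤ s) (hs : s ≤ T) (k : ℕ) :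
    ∫ ω, (B s ω - B r ω) ^ (2 * k) ∂P ≤ (3 * (s - r)) ^ k * stdMoment k := by
  have h := hB.isCenteredGaussianSpace.integral_pow (timeVec s - timeVec r) k
  simp only [processSpan_incr] at h
  rw [h]
  have := stdMoment_nonneg k
  have h1 := hB.gcov_incr_self_le hp hpK hr hrs hs
  have h2 := IsCenteredGaussianSpace.gcov_self_nonneg (G := processSpan B) (P := P)
    (timeVec s - timeVec r)
  gcongr

lemma memLp_incr_pow (hB : IsRegularBifracBM p K T B P) (r s : ℝ) (k : ℕ) :
    MemLp (fun ω => (B s ω - B r ω) ^ k) 2 P := by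
  have h := hB.isCenteredGaussianSpace.memLp_pow (timeVec s - timeVec r) k
  simpa only [processSpan_incr] using h

lemma integral_incr_sq_sub_sq_le [IsProbabilityMeasure P] (hB : IsRegularBifracBM p K T B P)
    (hp : 1 ≤ p) (hpK : p * K = 1) {s ε : ℝ} (hs : 0 ≤ s) (hε : 0 ≤ ε) (hsT : s + ε ≤ T) :
    ∫ ω, ((B (s + ε) ω - B s ω) ^ 2 - 2 * (1 / 2 ^ K) * ε) ^ 2 ∂P ≤
      (18 * stdMoment 2 + 8) * ε ^ 2 := by
  have hK0 : 0 ≤ K := by nlinarith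
  have hc1 := one_div_two_rpow_le_one hK0
  have hc0 : 0 < 1 / (2 : ℝ) ^ K := by positivity
  set c := 1 / (2 : ℝ) ^ K
  have h4 := hB.integral_incr_pow_le hp hpK hs (by linarith : s ≤ s + ε) hsT 2
  rw [add_sub_cancel_left] at h4
  have m2 := hB.memLp_incr_pow s (s + ε) 2
  have i4 : Integrable (fun ω => (B (s + ε) ω - B s ω) ^ (2 * 2)) P := by
    simpa only [← pow_mul] using m2.integrable_sq
  calc _ ≤ ∫ ω, (2 * (B (s + ε) ω - B s ω) ^ (2 * 2) + 8 * ε ^ 2) ∂P := by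
        refine integral_mono (m2.sub (memLp_const _)).integrable_sq
          ((i4.const_mul 2).add (integrable_const _)) fun ω => ?_
        simp only [pow_mul]
        set X := (B (s + ε) ω - B s ω) ^ 2
        have : (2 * c * ε) ^ 2 ≤ 4 * ε ^ 2 := by
          have : c ^ 2 ≤ 1 := by nlinarith
          nlinarith [sq_nonneg ε]
        nlinarith [sq_nonneg (X + 2 * c * ε)]
    _ = 2 * ∫ ω, (B (s + ε) ω - B s ω) ^ (2 * 2) ∂P + 8 * ε ^ 2 := by
        rw [integral_add (i4.const_mul 2) (integrable_const _), integral_const_mul]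
        simp
    _ ≤ 2 * ((3 * ε) ^ 2 * stdMoment 2) + 8 * ε ^ 2 := by gcongr
    _ = _ := by ring

lemma integral_quadVarIntegrand_sq_le [IsProbabilityMeasure P] (hB : IsRegularBifracBM p K T B P)
    (hp : 1 ≤ p) (hpK : p * K = 1) {g : ℝ → ℝ} (hg : Measurable g) {M : ℝ} (hM : ∀ z, |g z| ≤ M)
    {s ε : ℝ} (hs : 0 ≤ s) (hε : 0 ≤ ε) (hsT : s + ε ≤ T) :
    MemLp (fun ω => quadVarIntegrand K B g ε s ω) 2 P ∧
    ∫ ω, quadVarIntegrand K B g ε s ω ^ 2 ∂P ≤ M ^ 2 * ((18 * stdMoment 2 + 8) * ε ^ 2) := by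
  have m : MemLp (fun ω => (B (s + ε) ω - B s ω) ^ 2 - 2 * (1 / 2 ^ K) * ε) 2 P :=
    (hB.memLp_incr_pow s (s + ε) 2).sub (memLp_const _)
  have hm : MemLp (fun ω => quadVarIntegrand K B g ε s ω) 2 P := by
    refine (m.const_mul M).mono ?_ (ae_of_all _ fun ω => ?_)
    · have h1 := hB.measurable s
      have h2 := hB.measurable (s + ε)
      unfold quadVarIntegrand
      exact ((hg.comp h1).mul (((h2.sub h1).pow_const 2).sub_const _)).aestronglyMeasurable
    · simp only [quadVarIntegrand, norm_mul, Real.norm_eq_abs]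
      exact mul_le_mul_of_nonneg_right ((hM _).trans (le_abs_self M)) (abs_nonneg _)
  refine ⟨hm, ?_⟩
  calc _ ≤ ∫ ω, M ^ 2 * ((B (s + ε) ω - B s ω) ^ 2 - 2 * (1 / 2 ^ K) * ε) ^ 2 ∂P := by
        refine integral_mono hm.integrable_sq (m.integrable_sq.const_mul _) fun ω => ?_
        simp only [quadVarIntegrand, mul_pow]
        refine mul_le_mul_of_nonneg_right ?_ (sq_nonneg _)
        rw [← sq_abs]
        exact pow_le_pow_left₀ (abs_nonneg _) (hM _) 2
    _ ≤ _ := by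
        rw [integral_const_mul]
        gcongr
        exact hB.integral_incr_sq_sub_sq_le hp hpK hs hε hsT

set_option maxHeartbeats 1000000 in
/-- For increments that are short compared with the distance of the two times to each other and to
the origin, the correlation of the centered squares is of third order. -/
lemma abs_integral_quadVarIntegrand_mul_le [IsProbabilityMeasure P]
    (hB : IsRegularBifracBM p K T B P)
    (hp : 1 ≤ p) (hp2 : p ≤ 2) (hpK : p * K = 1) {g : ℝ → ℝ} (hg : Measurable g) {M : ℝ}
    (hM : ∀ z, |g z| ≤ M) {r s m ε : ℝ} (hm : 0 < m) (hmr : m ≤ r) (hms : m ≤ s - r) (hε : 0 < ε)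
    (hεm : 64 * ε ≤ m) (hsT : s + ε ≤ T) :
    |∫ ω, quadVarIntegrand K B g ε s ω * quadVarIntegrand K B g ε r ω ∂P| ≤
      M ^ 2 * √((18 * stdMoment 2 + 8) * ε ^ 2) * ((√(stdMoment 2) * 8 + 9) * (ε ^ 2 / m)) := by
  have hG := hB.isCenteredGaussianSpace
  have hr : 0 < r := by linarith
  have hs : 0 < s := by linarith
  have hrs : r < s := by linarith
  have hcc := one_le_two_mul_one_div_two_rpow (K := K) (by nlinarith)
  set c := 2 * (1 / (2 : ℝ) ^ K) with hc
  set u := timeVec (s + ε) - timeVec s with hu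
  set v := timeVec (r + ε) - timeVec r with hv
  set Γ := gcov (processSpan B) P with hΓ
  obtain ⟨α, β, u1, u2, u3⟩ := hB.exists_proj_timeVec hp hpK hr hrs (by linarith) u
  obtain ⟨α', β', v1, v2, v3⟩ := hB.exists_proj_timeVec hp hpK hr hrs (by linarith) v
  set up := α • timeVec s + β • timeVec r with hup
  set vp := α' • timeVec s + β' • timeVec r with hvp
  have hq : 0 < ε ^ 2 / m := by positivity
  have bu : Γ up up ≤ 4 * (ε ^ 2 / m) := by
    refine u3.trans ((hB.projBound_forward_late hp hp2 hpK hr hrs hε.le hsT).trans ?_)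
    rw [mul_div_assoc]
    gcongr
    linarith
  have bv : Γ vp vp ≤ 20 * (ε ^ 2 / m) := by
    refine v3.trans ((hB.projBound_early hp hpK hr hrs (by linarith) hr.le (b := r + ε)
      (by linarith) (by linarith)).trans ?_)
    rw [add_sub_cancel_left, mul_div_assoc, mul_div_assoc]
    have k1 : ε ^ 2 / r ≤ ε ^ 2 / m := by gcongr
    have k2 : ε ^ 2 / (s - r) ≤ ε ^ 2 / m := by gcongr
    linarith
  have bvar : ∀ z, m ≤ z → z + ε ≤ T →
      |Γ (timeVec (z + ε) - timeVec z) (timeVec (z + ε) - timeVec z) - c * ε| ≤ ε ^ 2 / m := by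
    intro z hz hzT
    have h := abs_bifracCov_incr_sub_le hp hp2 hpK (hm.trans_le hz) (by linarith : z ≤ z + ε)
    rw [add_sub_cancel_left] at h
    rw [hΓ, hB.gcov_incr_self hpK ⟨by linarith, by linarith⟩ ⟨by linarith, hzT⟩]
    exact h.trans (by gcongr)
  have bU := bvar s (by linarith) hsT
  have bV := bvar r hmr (by linarith)
  have hqε : 64 * (ε ^ 2 / m) ≤ ε := by
    rw [← mul_div_assoc, div_le_iff₀ hm]; nlinarith
  have bd : ε / 2 ≤ Γ v v - Γ vp vp := by
    have := (abs_le.1 bV).1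
    have h3 : ε ≤ c * ε := by nlinarith
    linarith
  have bUV : |Γ u v| ≤ ε ^ 2 / m := by
    refine (hB.abs_gcov_incr_incr_le hp hp2 hpK hr.le (by linarith) (by linarith) hs
      (by linarith) hsT).trans ?_
    rw [add_sub_cancel_left, add_sub_cancel_left, ← sq]
    gcongr
    linarith
  have bupvp : |Γ up vp| ≤ 9 * (ε ^ 2 / m) := by
    refine abs_le_of_sq_le_sq ?_ (by positivity)
    have h1 := hG.gcov_sq_le up vp
    have h2 : Γ up up * Γ vp vp ≤ 4 * (ε ^ 2 / m) * (20 * (ε ^ 2 / m)) :=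
      mul_le_mul bu bv (IsCenteredGaussianSpace.gcov_self_nonneg _) (by positivity)
    refine h1.trans (h2.trans ?_)
    nlinarith [sq_nonneg (ε ^ 2 / m)]
  obtain ⟨w, w1, w2, w3, w4, w5⟩ := hG.exists_proj_add (u := u) (v := v) hup hvp u1 u2 v1 v2
    (by linarith : 0 < gcov (processSpan B) P v v - gcov (processSpan B) P vp vp)
  have bw : Γ w w ≤ 8 * (ε ^ 2 / m) := by
    have h1 : |Γ u v - Γ up vp| ≤ 10 * (ε ^ 2 / m) := (abs_sub _ _).trans (by linarith)
    have h2 : (Γ u v - Γ up vp) ^ 2 ≤ (10 * (ε ^ 2 / m)) ^ 2 := by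
      rw [← sq_abs]; gcongr
    have h3 : (Γ u v - Γ up vp) ^ 2 / (Γ v v - Γ vp vp) ≤ 4 * (ε ^ 2 / m) := by
      rw [div_le_iff₀ (by linarith)]
      refine h2.trans ?_
      have : 4 * (ε ^ 2 / m) * (ε / 2) ≤ 4 * (ε ^ 2 / m) * (Γ v v - Γ vp vp) := by gcongr
      nlinarith
    rw [hΓ] at bu h3 ⊢
    rw [w5]
    linarith
  have h := hG.abs_integral_mul_sq_sub_mul_sq_sub_le hg hM w1 w2 w3 w4 (c * ε) (c * ε)
  simp only [hu, hv, processSpan_incr, processSpan_timeVec] at h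
  refine h.trans ?_
  have hD := hB.integral_incr_sq_sub_sq_le hp hpK hr.le hε.le (by linarith : r + ε ≤ T)
  have hw0 : 0 ≤ Γ w w := IsCenteredGaussianSpace.gcov_self_nonneg _
  gcongr
  calc √(stdMoment 2) * Γ w w + Γ w w + |Γ u u - c * ε|
      ≤ √(stdMoment 2) * (8 * (ε ^ 2 / m)) + 8 * (ε ^ 2 / m) + ε ^ 2 / m := by gcongr
    _ = _ := by ring

/-- The kernel controlling the correlations of the centered squared increments of length `ε`. -/
noncomputable def quadVarKernel (ε r s : ℝ) : ℝ := min 1 (ε / min (min r s) |s - r|)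

/-- Far from the diagonal and the origin the correlations are of third order; elsewhere the kernel
is at least `1 / 64` and the Cauchy-Schwarz inequality suffices. -/
lemma exists_abs_integral_quadVarIntegrand_mul_le [IsProbabilityMeasure P]
    (hB : IsRegularBifracBM p K T B P)
    (hp : 1 ≤ p) (hp2 : p ≤ 2) (hpK : p * K = 1) {g : ℝ → ℝ} (hg : Measurable g) {M : ℝ}
    (hM : ∀ z, |g z| ≤ M) :
    ∃ A, 0 ≤ A ∧ ∀ ε > 0, ∀ r > 0, ∀ s > 0, r + ε ≤ T → s + ε ≤ T → r ≠ s →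
      |∫ ω, quadVarIntegrand K B g ε s ω * quadVarIntegrand K B g ε r ω ∂P| ≤
        A * ε ^ 2 * quadVarKernel ε r s := by
  have hm0 := stdMoment_nonneg 2
  set D := 18 * stdMoment 2 + 8 with hD
  have hD0 : 0 ≤ D := by positivity
  set A := M ^ 2 * √D * (√(stdMoment 2) * 8 + 9) + 64 * (M ^ 2 * D) with hA
  refine ⟨A, by positivity, ?_⟩
  have key : ∀ ε > 0, ∀ r > 0, ∀ s, s + ε ≤ T → r < s →
      |∫ ω, quadVarIntegrand K B g ε s ω * quadVarIntegrand K B g ε r ω ∂P| ≤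
        A * ε ^ 2 * quadVarKernel ε r s := by
    intro ε hε r hr s hsT hrs
    have e : quadVarKernel ε r s = min 1 (ε / min r (s - r)) := by
      rw [quadVarKernel, min_eq_left hrs.le, abs_of_pos (by linarith)]
    rw [e]
    set m := min r (s - r) with hm
    have hm0 : 0 < m := lt_min hr (by linarith)
    rcases le_or_gt (64 * ε) m with h | h
    · rw [min_eq_right ((div_le_one hm0).2 (by linarith))]
      refine (hB.abs_integral_quadVarIntegrand_mul_le hp hp2 hpK hg hM hm0 (min_le_left _ _)
        (min_le_right _ _) hε h hsT).trans ?_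
      rw [Real.sqrt_mul hD0, Real.sqrt_sq hε.le]
      calc _ = M ^ 2 * √D * (√(stdMoment 2) * 8 + 9) * ε ^ 2 * (ε / m) := by ring
        _ ≤ _ := by
          have : 0 ≤ 64 * (M ^ 2 * D) := by positivity
          gcongr
          linarith
    · obtain ⟨s1, s2⟩ := hB.integral_quadVarIntegrand_sq_le hp hpK hg hM (by linarith : 0 ≤ s)
        hε.le hsT
      obtain ⟨r1, r2⟩ := hB.integral_quadVarIntegrand_sq_le hp hpK hg hM hr.le hε.le
        (by linarith : r + ε ≤ T)
      refine (abs_integral_mul_le_sqrt s1 r1).trans ?_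
      have hmin : 1 / 64 ≤ min 1 (ε / m) := by
        refine le_min (by norm_num) ?_
        rw [le_div_iff₀ hm0]; linarith
      calc _ ≤ √(M ^ 2 * (D * ε ^ 2)) * √(M ^ 2 * (D * ε ^ 2)) := by gcongr
        _ = 64 * (M ^ 2 * D) * ε ^ 2 * (1 / 64) := by
          rw [Real.mul_self_sqrt (by positivity)]; ring
        _ ≤ _ := by
          have : 0 ≤ M ^ 2 * √D * (√(stdMoment 2) * 8 + 9) := by positivity
          gcongr
          linarith
  intro ε hε r hr s hs hrT hsT hrs
  rcases lt_or_gt_of_ne hrs with h | h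
  · exact key ε hε r hr s hsT h
  · have := key ε hε s hs r hrT h
    simp_rw [mul_comm (quadVarIntegrand K B g ε r _)] at this
    rwa [quadVarKernel, min_comm s r, abs_sub_comm] at this

lemma tendsto_lintegral_quadVarKernel (T : ℝ) :
    Tendsto (fun ε => ∫⁻ r in Ioc 0 T, ∫⁻ s in Ioc 0 T, ENNReal.ofReal (quadVarKernel ε r s))
      (𝓝[>] 0) (𝓝 0) := by
  have hm : ∀ ε, Measurable fun z : ℝ × ℝ => ENNReal.ofReal (quadVarKernel ε z.1 z.2) := by
    intro ε
    unfold quadVarKernel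
    fun_prop
  have hle : ∀ ε r s, ENNReal.ofReal (quadVarKernel ε r s) ≤ 1 := fun ε r s => by
    rw [← ENNReal.ofReal_one]
    exact ENNReal.ofReal_le_ofReal (min_le_left _ _)
  have hpt : ∀ r s, Tendsto (fun ε => ENNReal.ofReal (quadVarKernel ε r s)) (𝓝[>] 0) (𝓝 0) := by
    intro r s
    have h : Continuous fun ε => ENNReal.ofReal (quadVarKernel ε r s) := by
      unfold quadVarKernel
      exact ENNReal.continuous_ofReal.comp (by fun_prop)
    have := h.tendsto 0
    simp only [quadVarKernel, zero_div] at this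
    rw [min_eq_right zero_le_one, ENNReal.ofReal_zero] at this
    exact this.mono_left nhdsWithin_le_nhds
  have hin : ∀ r, Tendsto (fun ε => ∫⁻ s in Ioc 0 T, ENNReal.ofReal (quadVarKernel ε r s))
      (𝓝[>] 0) (𝓝 0) := by
    intro r
    have := tendsto_lintegral_filter_of_dominated_convergence (μ := volume.restrict (Ioc 0 T))
      (l := 𝓝[>] (0 : ℝ)) (F := fun ε s => ENNReal.ofReal (quadVarKernel ε r s)) (f := fun _ => 0)
      (fun _ => 1) (Eventually.of_forall fun ε => (hm ε).comp measurable_prodMk_left)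
      (Eventually.of_forall fun ε => ae_of_all _ fun s => hle ε r s) (by simp)
      (ae_of_all _ fun s => hpt r s)
    simpa using this
  have := tendsto_lintegral_filter_of_dominated_convergence (μ := volume.restrict (Ioc 0 T))
    (l := 𝓝[>] (0 : ℝ))
    (F := fun ε r => ∫⁻ s in Ioc 0 T, ENNReal.ofReal (quadVarKernel ε r s)) (f := fun _ => 0)
    (fun _ => ∫⁻ s in Ioc 0 T, 1) (Eventually.of_forall fun ε => (hm ε).lintegral_prod_right')
    (Eventually.of_forall fun ε => ae_of_all _ fun r => lintegral_mono fun s => hle ε r s)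
    (by simp [ENNReal.mul_ne_top]) (ae_of_all _ fun r => hin r)
  simpa using this

end IsRegularBifracBM

/-! ### Convergence in `L²` and the quadratic variation -/

/-- Convergence in `L²(P)` of a family of random variables as `ε ↓ 0`. -/
def L2Tendsto {Ω : Type*} [MeasurableSpace Ω] (P : Measure Ω) (X : ℝ → Ω → ℝ) (I : Ω → ℝ) : Prop :=
  (∀ᶠ ε in 𝓝[>] (0 : ℝ), MemLp (X ε) 2 P) ∧ MemLp I 2 P ∧
    Tendsto (fun ε => eLpNorm (fun ω => X ε ω - I ω) 2 P) (𝓝[>] 0) (𝓝 0)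

section L2

variable {Ω : Type*} [MeasurableSpace Ω] {P : Measure Ω}

lemma eLpNorm_two_eq {X : Ω → ℝ} (hX : MemLp X 2 P) :
    eLpNorm X 2 P = ENNReal.ofReal √(∫ ω, X ω ^ 2 ∂P) := by
  rw [hX.eLpNorm_eq_integral_rpow_norm (by norm_num) (by norm_num)]
  congr 1
  rw [Real.sqrt_eq_rpow]
  simp

namespace L2Tendsto

variable {X Y : ℝ → Ω → ℝ} {I J : Ω → ℝ}

lemma add (hX : L2Tendsto P X I) (hY : L2Tendsto P Y J) :
    L2Tendsto P (fun ε ω => X ε ω + Y ε ω) (fun ω => I ω + J ω) := by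
  refine ⟨?_, hX.2.1.add hY.2.1, ?_⟩
  · filter_upwards [hX.1, hY.1] with ε h1 h2 using h1.add h2
  · have h := hX.2.2.add hY.2.2
    rw [add_zero] at h
    refine tendsto_of_tendsto_of_tendsto_of_le_of_le' tendsto_const_nhds h
      (Eventually.of_forall fun _ => zero_le) ?_
    filter_upwards [hX.1, hY.1] with ε h1 h2
    have := eLpNorm_add_le (h1.sub hX.2.1).1 (h2.sub hY.2.1).1 (p := 2) (by norm_num)
    refine le_trans (le_of_eq ?_) this
    congr 1
    ext ω
    simp only [Pi.add_apply, Pi.sub_apply]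
    ring

lemma const_mul (hX : L2Tendsto P X I) (c : ℝ) :
    L2Tendsto P (fun ε ω => c * X ε ω) (fun ω => c * I ω) := by
  refine ⟨hX.1.mono fun ε h => h.const_mul c, hX.2.1.const_mul c, ?_⟩
  have h := ENNReal.Tendsto.const_mul (a := ‖c‖ₑ) hX.2.2 (Or.inr (by simp))
  rw [mul_zero] at h
  refine h.congr fun ε => ?_
  rw [← eLpNorm_const_smul]
  congr 1
  ext ω
  simp only [Pi.smul_apply, smul_eq_mul]
  ring

lemma sub (hX : L2Tendsto P X I) (hY : L2Tendsto P Y J) :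
    L2Tendsto P (fun ε ω => X ε ω - Y ε ω) (fun ω => I ω - J ω) := by
  have := hX.add (hY.const_mul (-1))
  simpa only [neg_one_mul, ← sub_eq_add_neg] using this

lemma congr' (hX : L2Tendsto P X I) (h : ∀ᶠ ε in 𝓝[>] (0 : ℝ), X ε =ᵐ[P] Y ε) :
    L2Tendsto P Y I := by
  refine ⟨?_, hX.2.1, hX.2.2.congr' ?_⟩
  · filter_upwards [hX.1, h] with ε h1 h2 using h1.ae_eq h2
  · filter_upwards [h] with ε h2
    refine eLpNorm_congr_ae ?_
    filter_upwards [h2] with ω hω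
    rw [hω]

lemma of_integral_sq_le (hI : MemLp I 2 P) {b : ℝ → ℝ} (hb : Tendsto b (𝓝[>] 0) (𝓝 0))
    (h : ∀ᶠ ε in 𝓝[>] (0 : ℝ), MemLp (fun ω => X ε ω - I ω) 2 P ∧
      ∫ ω, (X ε ω - I ω) ^ 2 ∂P ≤ b ε) : L2Tendsto P X I := by
  refine ⟨?_, hI, ?_⟩
  · filter_upwards [h] with ε h1
    have := h1.1.add hI
    refine this.ae_eq (ae_of_all _ fun ω => ?_)
    simp
  · have hb' : Tendsto (fun ε => ENNReal.ofReal √(b ε)) (𝓝[>] 0) (𝓝 0) := by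
      have := ((ENNReal.continuous_ofReal.comp Real.continuous_sqrt).tendsto 0).comp hb
      simpa [Function.comp_def] using this
    refine tendsto_of_tendsto_of_tendsto_of_le_of_le' tendsto_const_nhds hb'
      (Eventually.of_forall fun _ => zero_le) ?_
    filter_upwards [h] with ε h1
    rw [eLpNorm_two_eq h1.1]
    exact ENNReal.ofReal_le_ofReal (Real.sqrt_le_sqrt h1.2)

lemma of_integral_sq_le_zero {b : ℝ → ℝ} (hb : Tendsto b (𝓝[>] 0) (𝓝 0))
    (h : ∀ᶠ ε in 𝓝[>] (0 : ℝ), MemLp (X ε) 2 P ∧ ∫ ω, X ε ω ^ 2 ∂P ≤ b ε) :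
    L2Tendsto P X fun _ => 0 := by
  refine of_integral_sq_le (by simp) hb ?_
  simpa using h

lemma eLpNorm_le (hX : L2Tendsto P X I) {M : ENNReal}
    (h : ∀ᶠ ε in 𝓝[>] (0 : ℝ), eLpNorm (X ε) 2 P ≤ M) : eLpNorm I 2 P ≤ M := by
  have h1 : Tendsto (fun ε => eLpNorm (fun ω => X ε ω - I ω) 2 P + M) (𝓝[>] 0) (𝓝 (0 + M)) :=
    hX.2.2.add tendsto_const_nhds
  rw [zero_add] at h1
  refine ge_of_tendsto h1 ?_
  filter_upwards [h, hX.1] with ε h2 h3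
  have h4 := eLpNorm_sub_le h3.1 (h3.sub hX.2.1).1 (p := 2) (by norm_num)
  have e : X ε - (X ε - I) = I := by simp
  rw [e] at h4
  calc _ ≤ _ := h4
    _ ≤ _ := by
      rw [add_comm]
      exact add_le_add le_rfl h2

end L2Tendsto

/-- A family that can be approximated, uniformly for small `ε`, by families converging in `L²`
converges in `L²`. -/
lemma exists_l2Tendsto {X : ℝ → Ω → ℝ} (hX : ∀ᶠ ε in 𝓝[>] (0 : ℝ), MemLp (X ε) 2 P)
    (h : ∀ δ : ENNReal, 0 < δ → ∃ (Y : ℝ → Ω → ℝ) (J : Ω → ℝ), L2Tendsto P Y J ∧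
      ∀ᶠ ε in 𝓝[>] (0 : ℝ), eLpNorm (fun ω => X ε ω - Y ε ω) 2 P ≤ δ) :
    ∃ I, L2Tendsto P X I := by
  classical
  set x : ℝ → Lp ℝ 2 P := fun ε => if h : MemLp (X ε) 2 P then h.toLp else 0 with hx
  have hxe : ∀ ε (hm : MemLp (X ε) 2 P), x ε = hm.toLp := fun ε hm => by simp [hx, hm]
  have hne : (𝓝[>] (0 : ℝ)).NeBot := inferInstance
  have hc : Cauchy (map x (𝓝[>] (0 : ℝ))) := by
    rw [EMetric.cauchy_iff]
    refine ⟨(inferInstance : (map x (𝓝[>] (0 : ℝ))).NeBot).ne, fun η hη => ?_⟩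
    obtain ⟨δ, hδ0, hδ⟩ : ∃ δ : ENNReal, 0 < δ ∧ 4 * δ < η := by
      obtain ⟨δ, h1, h2⟩ := ENNReal.exists_nnreal_pos_mul_lt (a := 4) (by simp) hη.ne'
      exact ⟨δ, by exact_mod_cast h1, by rwa [mul_comm]⟩
    obtain ⟨Y, J, hYJ, hXY⟩ := h δ hδ0
    have hev : ∀ᶠ ε in 𝓝[>] (0 : ℝ), MemLp (X ε) 2 P ∧ edist (x ε) hYJ.2.1.toLp ≤ 2 * δ := by
      have h1 : ∀ᶠ ε in 𝓝[>] (0 : ℝ), eLpNorm (fun ω => Y ε ω - J ω) 2 P < δ :=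
        hYJ.2.2.eventually_lt_const hδ0
      filter_upwards [hX, hYJ.1, hXY, h1] with ε e1 e2 e3 e4
      refine ⟨e1, ?_⟩
      rw [hxe ε e1, Lp.edist_toLp_toLp]
      have e5 := eLpNorm_add_le (e1.sub e2).1 (e2.sub hYJ.2.1).1 (p := 2) (by norm_num)
      rw [sub_add_sub_cancel] at e5
      refine e5.trans ?_
      rw [two_mul]
      exact add_le_add e3 e4.le
    refine ⟨x '' {ε | MemLp (X ε) 2 P ∧ edist (x ε) hYJ.2.1.toLp ≤ 2 * δ}, image_mem_map hev, ?_⟩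
    rintro _ ⟨a, ha, rfl⟩ _ ⟨b, hb, rfl⟩
    refine lt_of_le_of_lt (edist_triangle_right _ _ hYJ.2.1.toLp) (lt_of_le_of_lt ?_ hδ)
    calc _ ≤ 2 * δ + 2 * δ := add_le_add ha.2 hb.2
      _ = 4 * δ := by ring
  obtain ⟨z, hz⟩ := cauchy_iff_exists_le_nhds.1 hc
  refine ⟨z, hX, Lp.memLp z, ?_⟩
  have h2 : Tendsto (fun ε => edist (x ε) z) (𝓝[>] 0) (𝓝 0) := tendsto_iff_edist_tendsto_0.1 hz
  refine h2.congr' ?_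
  filter_upwards [hX] with ε e1
  rw [hxe ε e1, Lp.edist_def]
  refine eLpNorm_congr_ae ?_
  filter_upwards [e1.coeFn_toLp] with ω hω
  simp [hω]

/-- The time integral of a family bounded in `L²`. -/
lemma memLp_intervalIntegral_and_integral_sq_le [IsProbabilityMeasure P] {F : Ω → ℝ → ℝ}
    (hF : Measurable (Function.uncurry F)) {a b m : ℝ} (hab : a ≤ b) (hm : 0 ≤ m)
    (h : ∀ s ∈ Ioc a b, MemLp (fun ω => F ω s) 2 P ∧ ∫ ω, F ω s ^ 2 ∂P ≤ m) :
    MemLp (fun ω => ∫ s in a..b, F ω s) 2 P ∧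
      ∫ ω, (∫ s in a..b, F ω s) ^ 2 ∂P ≤ (b - a) ^ 2 * m := by
  simp_rw [intervalIntegral.integral_of_le hab]
  have hfin : ∫⁻ s in Ioc a b, ∫⁻ ω, ENNReal.ofReal (F ω s ^ 2) ∂P ≠ ⊤ := by
    refine ne_of_lt (lt_of_le_of_lt (setLIntegral_mono' (g := fun _ => ENNReal.ofReal m)
      measurableSet_Ioc fun s hs => ?_) (by simp [ENNReal.mul_lt_top]))
    obtain ⟨h1, h2⟩ := h s hs
    rw [← ofReal_integral_eq_lintegral_ofReal h1.integrable_sq (ae_of_all _ fun ω => sq_nonneg _)]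
    exact ENNReal.ofReal_le_ofReal h2
  obtain ⟨-, c2, c3⟩ := memLp_integral_and_integral_sq_le hF hfin
  refine ⟨c2, ?_⟩
  rw [← ENNReal.ofReal_le_ofReal_iff (by positivity)]
  refine c3.trans ?_
  calc _ ≤ ∫⁻ r in Ioc a b, ∫⁻ s in Ioc a b, ENNReal.ofReal m := by
        refine setLIntegral_mono' measurableSet_Ioc fun r hr => ?_
        refine setLIntegral_mono' measurableSet_Ioc fun s hs => ?_
        refine ENNReal.ofReal_le_ofReal ?_
        refine (abs_integral_mul_le_sqrt (h s hs).1 (h r hr).1).trans ?_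
        rw [← Real.mul_self_sqrt hm]
        exact mul_le_mul (Real.sqrt_le_sqrt (h s hs).2) (Real.sqrt_le_sqrt (h r hr).2)
          (Real.sqrt_nonneg _) (Real.sqrt_nonneg _)
    _ = _ := by
        have : 0 ≤ b - a := by linarith
        simp only [lintegral_const, Measure.restrict_apply_univ, Real.volume_Ioc]
        rw [← ENNReal.ofReal_mul hm, ← ENNReal.ofReal_mul (by positivity)]
        congr 1; ring

end L2

namespace IsRegularBifracBM

variable {Ω : Type*} [MeasurableSpace Ω] {p K T : ℝ} {B : ℝ → Ω → ℝ} {P : Measure Ω}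

lemma measurable_swap_uncurry (hB : IsRegularBifracBM p K T B P) :
    Measurable fun z : Ω × ℝ => B z.2 z.1 := hB.measurable_uncurry.comp measurable_swap

lemma measurable_swap_uncurry_add (hB : IsRegularBifracBM p K T B P) (ε : ℝ) :
    Measurable fun z : Ω × ℝ => B (z.2 + ε) z.1 :=
  hB.measurable_uncurry.comp (by fun_prop : Measurable fun z : Ω × ℝ => (z.2 + ε, z.1))

lemma eventually_mem_Ioo {T : ℝ} (hT : 0 < T) : ∀ᶠ ε in 𝓝[>] (0 : ℝ), ε ∈ Ioo 0 T :=
  Ioo_mem_nhdsGT hT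

/-- The weighted quadratic variation is `2 ^ (1 - K)` times the weighted time, tested against
bounded functions of the process. -/
lemma l2Tendsto_quadVar [IsProbabilityMeasure P] (hB : IsRegularBifracBM p K T B P)
    (hp : 1 ≤ p) (hp2 : p ≤ 2) (hpK : p * K = 1) {g : ℝ → ℝ} (hg : Measurable g) {M : ℝ}
    (hM : ∀ z, |g z| ≤ M) (hT : 0 < T) {t : ℝ} (ht : 0 ≤ t) :
    L2Tendsto P (fun ε ω => 1 / ε * ∫ s in (0 : ℝ)..min t (T - ε), quadVarIntegrand K B g ε s ω)
      fun _ => 0 := by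
  obtain ⟨A, hA0, hA⟩ := hB.exists_abs_integral_quadVarIntegrand_mul_le hp hp2 hpK hg hM
  have hlim : Tendsto (fun ε => (ENNReal.ofReal A * ∫⁻ r in Ioc 0 T, ∫⁻ s in Ioc 0 T,
      ENNReal.ofReal (quadVarKernel ε r s)).toReal) (𝓝[>] 0) (𝓝 0) := by
    have h := ENNReal.Tendsto.const_mul (a := ENNReal.ofReal A) (tendsto_lintegral_quadVarKernel T)
      (Or.inr ENNReal.ofReal_ne_top)
    rw [mul_zero] at h
    have := (ENNReal.tendsto_toReal ENNReal.zero_ne_top).comp h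
    simpa [Function.comp_def] using this
  have hfinK : ∀ᶠ ε in 𝓝[>] (0 : ℝ), ∫⁻ r in Ioc 0 T, ∫⁻ s in Ioc 0 T,
      ENNReal.ofReal (quadVarKernel ε r s) < ⊤ :=
    (tendsto_lintegral_quadVarKernel T).eventually_lt_const ENNReal.zero_lt_top
  refine L2Tendsto.of_integral_sq_le_zero hlim ?_
  filter_upwards [eventually_mem_Ioo hT, hfinK] with ε hε hfinε
  obtain ⟨hε0, hεT⟩ := hε
  have hτ0 : 0 ≤ min t (T - ε) := le_min ht (by linarith)
  have hτT : min t (T - ε) ≤ T - ε := min_le_right _ _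
  set τ := min t (T - ε)
  have hF : Measurable (Function.uncurry fun ω s => quadVarIntegrand K B g ε s ω) := by
    have h1 := hB.measurable_swap_uncurry
    have h2 := hB.measurable_swap_uncurry_add ε
    exact (hg.comp h1).mul (((h2.sub h1).pow_const 2).sub_const _)
  simp_rw [intervalIntegral.integral_of_le hτ0]
  have hsq := fun s (hs : s ∈ Ioc 0 τ) => hB.integral_quadVarIntegrand_sq_le hp hpK hg hM hs.1.le
    hε0.le (by linarith [hs.2])
  have hfin : ∫⁻ s in Ioc 0 τ, ∫⁻ ω, ENNReal.ofReal (quadVarIntegrand K B g ε s ω ^ 2) ∂P ≠ ⊤ := by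
    refine ne_of_lt (lt_of_le_of_lt (setLIntegral_mono'
      (g := fun _ => ENNReal.ofReal (M ^ 2 * ((18 * stdMoment 2 + 8) * ε ^ 2)))
      measurableSet_Ioc fun s hs => ?_) (by simp [ENNReal.mul_lt_top]))
    rw [← ofReal_integral_eq_lintegral_ofReal (hsq s hs).1.integrable_sq
      (ae_of_all _ fun ω => sq_nonneg _)]
    exact ENNReal.ofReal_le_ofReal (hsq s hs).2
  obtain ⟨-, c2, c3⟩ := memLp_integral_and_integral_sq_le hF hfin
  refine ⟨c2.const_mul _, ?_⟩
  have hb : ENNReal.ofReal (∫ ω, (∫ s in Ioc 0 τ, quadVarIntegrand K B g ε s ω) ^ 2 ∂P) ≤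
      ENNReal.ofReal (ε ^ 2) * (ENNReal.ofReal A * ∫⁻ r in Ioc 0 T, ∫⁻ s in Ioc 0 T,
        ENNReal.ofReal (quadVarKernel ε r s)) := by
    refine c3.trans ?_
    have hmk : Measurable fun z : ℝ × ℝ => ENNReal.ofReal (quadVarKernel ε z.1 z.2) := by
      unfold quadVarKernel
      fun_prop
    calc _ ≤ ∫⁻ r in Ioc 0 τ, ∫⁻ s in Ioc 0 τ,
          ENNReal.ofReal (A * ε ^ 2) * ENNReal.ofReal (quadVarKernel ε r s) := by
          refine setLIntegral_mono' measurableSet_Ioc fun r hr => ?_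
          refine lintegral_mono_ae ?_
          have hne : ∀ᵐ s ∂volume.restrict (Ioc 0 τ), s ≠ r :=
            ae_restrict_of_ae (Measure.ae_ne volume r)
          filter_upwards [hne, ae_restrict_mem measurableSet_Ioc] with s hs hsm
          rw [← ENNReal.ofReal_mul (by positivity)]
          exact ENNReal.ofReal_le_ofReal (hA ε hε0 r hr.1 s hsm.1 (by linarith [hr.2])
            (by linarith [hsm.2]) hs.symm)
      _ ≤ ∫⁻ r in Ioc 0 T, ∫⁻ s in Ioc 0 T,
          ENNReal.ofReal (A * ε ^ 2) * ENNReal.ofReal (quadVarKernel ε r s) := by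
          have hsub : Ioc 0 τ ⊆ Ioc 0 T := Ioc_subset_Ioc_right (by linarith)
          exact (lintegral_mono fun r => lintegral_mono_set hsub).trans (lintegral_mono_set hsub)
      _ = _ := by
          rw [← mul_assoc, ← ENNReal.ofReal_mul (by positivity), mul_comm (ε ^ 2),
            ← lintegral_const_mul _ hmk.lintegral_prod_right']
          refine lintegral_congr fun r => ?_
          exact lintegral_const_mul _ (hmk.comp measurable_prodMk_left)
  rw [ENNReal.ofReal_le_iff_le_toReal (ENNReal.mul_ne_top ENNReal.ofReal_ne_top
    (ENNReal.mul_ne_top ENNReal.ofReal_ne_top hfinε.ne)), ENNReal.toReal_mul,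
    ENNReal.toReal_ofReal (by positivity)] at hb
  simp_rw [mul_pow]
  rw [integral_const_mul]
  calc _ ≤ (1 / ε) ^ 2 * (ε ^ 2 * _) := by gcongr
    _ = _ := by rw [← mul_assoc, ← mul_pow, one_div_mul_cancel hε0.ne']; ring

end IsRegularBifracBM

/-! ### Test functions and the terms of their Taylor expansions -/

/-- A test function `f` with an antiderivative `F` and a derivative `f'`, where `f` and `f'` are
bounded by `C` and `f'` is `C`-Lipschitz. -/
structure IsTestFunction (F f f' : ℝ → ℝ) (C : ℝ) : Prop where
  hasDerivAt_antideriv : ∀ x, HasDerivAt F (f x) x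
  hasDerivAt : ∀ x, HasDerivAt f (f' x) x
  continuous_deriv : Continuous f'
  abs_le : ∀ x, |f x| ≤ C
  abs_deriv_le : ∀ x, |f' x| ≤ C
  lipschitz_deriv : ∀ x y, |f' y - f' x| ≤ C * |y - x|

lemma abs_sub_le_of_hasDerivAt {φ φ' : ℝ → ℝ} (hφ : ∀ z, HasDerivAt φ (φ' z) z) {x y M : ℝ}
    (hM : ∀ z, |z - x| ≤ |y - x| → |φ' z| ≤ M) : |φ y - φ x| ≤ M * |y - x| := by
  refine (convex_uIcc x y).norm_image_sub_le_of_norm_hasDerivWithin_le (f' := φ')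
    (fun z _ => (hφ z).hasDerivWithinAt) (fun z hz => hM z ?_) left_mem_uIcc right_mem_uIcc
  exact abs_sub_left_of_mem_uIcc hz

lemma exists_isTestFunction {f : ℝ → ℝ} (hf : ContDiff ℝ 2 f) (hfc : HasCompactSupport f) :
    ∃ F f' C, IsTestFunction F f f' C := by
  have hd1 : Differentiable ℝ f := hf.differentiable (by norm_num)
  have hc1 : ContDiff ℝ 1 (deriv f) := by
    have := (contDiff_succ_iff_deriv (n := 1)).1 (by simpa [one_add_one_eq_two] using hf)
    exact this.2.2
  have hd2 : Differentiable ℝ (deriv f) := hc1.differentiable (by norm_num)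
  have hc2 : Continuous (deriv (deriv f)) := hc1.continuous_deriv (by norm_num)
  obtain ⟨C0, h0⟩ := hfc.exists_bound_of_continuous hf.continuous
  obtain ⟨C1, h1⟩ := hfc.deriv.exists_bound_of_continuous hc1.continuous
  obtain ⟨C2, h2⟩ := hfc.deriv.deriv.exists_bound_of_continuous hc2
  refine ⟨fun x => ∫ u in (0 : ℝ)..x, f u, deriv f, max C0 (max C1 C2), ?_, ?_, ?_, ?_, ?_, ?_⟩
  · exact fun x => intervalIntegral.integral_hasDerivAt_right (hf.continuous.intervalIntegrable _ _)
      (hf.continuous.stronglyMeasurableAtFilter _ _) hf.continuous.continuousAt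
  · exact fun x => (hd1 x).hasDerivAt
  · exact hc1.continuous
  · exact fun x => (h0 x).trans (le_max_left _ _)
  · exact fun x => (h1 x).trans ((le_max_left _ _).trans (le_max_right _ _))
  · exact fun x y => abs_sub_le_of_hasDerivAt (fun z => (hd2 z).hasDerivAt) fun z _ =>
      (h2 z).trans ((le_max_right _ _).trans (le_max_right _ _))

namespace IsTestFunction

variable {F f f' : ℝ → ℝ} {C : ℝ}

lemma nonneg (h : IsTestFunction F f f' C) : 0 ≤ C := (abs_nonneg _).trans (h.abs_le 0)

lemma continuous (h : IsTestFunction F f f' C) : Continuous f :=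
  continuous_iff_continuousAt.2 fun x => (h.hasDerivAt x).continuousAt

lemma continuous_antideriv (h : IsTestFunction F f f' C) : Continuous F :=
  continuous_iff_continuousAt.2 fun x => (h.hasDerivAt_antideriv x).continuousAt

lemma abs_antideriv_sub_le (h : IsTestFunction F f f' C) (x y : ℝ) :
    |F y - F x| ≤ C * |y - x| :=
  abs_sub_le_of_hasDerivAt h.hasDerivAt_antideriv fun z _ => h.abs_le z

lemma abs_sub_le (h : IsTestFunction F f f' C) (x y : ℝ) :
    |f y - f x - f' x * (y - x)| ≤ C * |y - x| ^ 2 := by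
  have hd : ∀ z, HasDerivAt (fun z => f z - f' x * (z - x)) (f' z - f' x) z := fun z =>
    ((h.hasDerivAt z).sub (((hasDerivAt_id z).sub_const x).const_mul (f' x))).congr_deriv (by ring)
  have := abs_sub_le_of_hasDerivAt hd (x := x) (y := y) (M := C * |y - x|) fun z hz =>
    (h.lipschitz_deriv x z).trans (mul_le_mul_of_nonneg_left hz h.nonneg)
  simp only [sub_self, mul_zero, sub_zero] at this
  calc _ = |f y - f' x * (y - x) - f x| := by congr 1; ring
    _ ≤ _ := this
    _ = _ := by ring

lemma abs_antideriv_taylor_le (h : IsTestFunction F f f' C) (x y : ℝ) :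
    |F y - F x - f x * (y - x) - 1 / 2 * (f' x * (y - x) ^ 2)| ≤ C * |y - x| ^ 3 := by
  have hd : ∀ z, HasDerivAt (fun z => F z - f x * (z - x) - 1 / 2 * (f' x * (z - x) ^ 2))
      (f z - f x - f' x * (z - x)) z := fun z =>
    (((h.hasDerivAt_antideriv z).sub (((hasDerivAt_id z).sub_const x).const_mul (f x))).sub
      (((((hasDerivAt_id z).sub_const x).pow 2).const_mul (f' x)).const_mul (1 / 2))).congr_deriv
      (by simp; ring)
  have := abs_sub_le_of_hasDerivAt hd (x := x) (y := y) (M := C * |y - x| ^ 2) fun z hz =>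
    (h.abs_sub_le x z).trans (mul_le_mul_of_nonneg_left (pow_le_pow_left₀ (abs_nonneg _) hz 2)
      h.nonneg)
  simp only [sub_self, mul_zero, sub_zero, ne_eq, OfNat.ofNat_ne_zero, not_false_eq_true, zero_pow]
    at this
  calc _ = |F y - f x * (y - x) - 1 / 2 * (f' x * (y - x) ^ 2) - F x| := by congr 1; ring
    _ ≤ _ := this
    _ = _ := by ring

end IsTestFunction

namespace IsRegularBifracBM

variable {Ω : Type*} [MeasurableSpace Ω] {p K T : ℝ} {B : ℝ → Ω → ℝ} {P : Measure Ω}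

lemma memLp_lipschitz_comp (hB : IsRegularBifracBM p K T B P) [IsProbabilityMeasure P] {g : ℝ → ℝ}
    (hg : Continuous g) {C : ℝ} (hC : ∀ x y, |g y - g x| ≤ C * |y - x|) (s : ℝ) :
    MemLp (fun ω => g (B s ω)) 2 P := by
  have hB2 : MemLp (B s) 2 P := by
    simpa using hB.isCenteredGaussianSpace.memLp_two (timeVec s)
  have h1 : MemLp (fun ω => g (B s ω) - g 0) 2 P := by
    refine (hB2.const_mul C).mono
      ((hg.measurable.comp (hB.measurable s)).sub_const _).aestronglyMeasurable
      (ae_of_all _ fun ω => ?_)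
    rw [norm_mul, Real.norm_eq_abs, Real.norm_eq_abs, Real.norm_eq_abs]
    have := hC 0 (B s ω)
    rw [sub_zero] at this
    exact this.trans (mul_le_mul_of_nonneg_right (le_abs_self C) (abs_nonneg _))
  have := h1.add (memLp_const (g 0))
  refine this.ae_eq (ae_of_all _ fun ω => ?_)
  simp

lemma integral_incr_sq_le (hB : IsRegularBifracBM p K T B P) (hp : 1 ≤ p) (hpK : p * K = 1)
    {r s : ℝ} (hr : 0 ≤ r) (hrs : r ≤ s) (hs : s ≤ T) :
    ∫ ω, (B s ω - B r ω) ^ 2 ∂P ≤ 3 * (s - r) := by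
  have h := hB.gcov_incr_self_le hp hpK hr hrs hs
  rw [IsCenteredGaussianSpace.gcov_self] at h
  simpa only [processSpan_incr] using h

/-- Averages of a Lipschitz function of the process over shrinking intervals. -/
lemma l2Tendsto_average [IsProbabilityMeasure P] (hB : IsRegularBifracBM p K T B P)
    (hp : 1 ≤ p) (hpK : p * K = 1) {g : ℝ → ℝ}
    (hg : Continuous g) {C : ℝ} (hC : ∀ x y, |g y - g x| ≤ C * |y - x|) {t : ℝ} {l : ℝ → ℝ}
    (hl : ∀ᶠ ε in 𝓝[>] (0 : ℝ), 0 ≤ l ε ∧ l ε ≤ t ∧ t ≤ l ε + ε ∧ l ε + ε ≤ T) :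
    L2Tendsto P (fun ε ω => 1 / ε * ∫ s in (l ε)..(l ε + ε), g (B s ω)) fun ω => g (B t ω) := by
  refine L2Tendsto.of_integral_sq_le (hB.memLp_lipschitz_comp hg hC t)
    (b := fun ε => C ^ 2 * (3 * ε)) ?_ ?_
  · have : Continuous fun ε : ℝ => C ^ 2 * (3 * ε) := by fun_prop
    have h := this.tendsto 0
    simp only [mul_zero] at h
    exact h.mono_left nhdsWithin_le_nhds
  filter_upwards [hl, self_mem_nhdsWithin] with ε hε hε0
  obtain ⟨l0, l1, l2, l3⟩ := hε
  have hε0 : 0 < ε := hε0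
  have hF : Measurable (Function.uncurry fun ω s => g (B s ω) - g (B t ω)) :=
    (hg.measurable.comp hB.measurable_swap_uncurry).sub
      (hg.measurable.comp ((hB.measurable t).comp measurable_fst))
  have e : ∀ ω, 1 / ε * (∫ s in (l ε)..(l ε + ε), g (B s ω)) - g (B t ω) =
      1 / ε * ∫ s in (l ε)..(l ε + ε), (g (B s ω) - g (B t ω)) := by
    intro ω
    have hi : IntervalIntegrable (fun s => g (B s ω)) volume (l ε) (l ε + ε) :=
      (hg.comp (hB.continuous ω)).intervalIntegrable _ _
    rw [intervalIntegral.integral_sub hi intervalIntegrable_const, intervalIntegral.integral_const,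
      smul_eq_mul, mul_sub]
    congr 1
    field_simp
    ring
  have hm : ∀ s ∈ Ioc (l ε) (l ε + ε), MemLp (fun ω => g (B s ω) - g (B t ω)) 2 P ∧
      ∫ ω, (g (B s ω) - g (B t ω)) ^ 2 ∂P ≤ C ^ 2 * (3 * ε) := by
    intro s hs
    have m1 := (hB.memLp_lipschitz_comp hg hC s).sub (hB.memLp_lipschitz_comp hg hC t)
    have m2 := hB.memLp_incr_pow t s 1
    simp only [pow_one] at m2
    refine ⟨m1, ?_⟩
    have hincr : ∫ ω, (B s ω - B t ω) ^ 2 ∂P ≤ 3 * ε := by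
      rcases le_total t s with h | h
      · have := hB.integral_incr_sq_le hp hpK (by linarith) h (by linarith [hs.2])
        linarith [hs.2]
      · have := hB.integral_incr_sq_le hp hpK (by linarith [hs.1]) h (by linarith)
        simp_rw [sub_sq_comm (B t _)] at this
        linarith [hs.1]
    calc _ ≤ ∫ ω, C ^ 2 * (B s ω - B t ω) ^ 2 ∂P := by
          refine integral_mono m1.integrable_sq (m2.integrable_sq.const_mul _) fun ω => ?_
          simp only [← mul_pow]
          rw [← sq_abs, ← sq_abs (C * _), abs_mul]
          refine pow_le_pow_left₀ (abs_nonneg _) ((hC _ _).trans ?_) 2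
          exact mul_le_mul_of_nonneg_right (le_abs_self C) (abs_nonneg _)
      _ ≤ _ := by
          rw [integral_const_mul]; gcongr
  obtain ⟨c1, c2⟩ := memLp_intervalIntegral_and_integral_sq_le hF (by linarith : l ε ≤ l ε + ε)
    (by positivity) hm
  simp_rw [e, mul_pow]
  refine ⟨c1.const_mul _, ?_⟩
  rw [integral_const_mul]
  calc _ ≤ (1 / ε) ^ 2 * ((l ε + ε - l ε) ^ 2 * (C ^ 2 * (3 * ε))) := by gcongr
    _ = _ := by
      rw [add_sub_cancel_left, ← mul_assoc, ← mul_pow, one_div_mul_cancel hε0.ne', one_pow, one_mul]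

/-- Remainders of third order in the increments do not contribute to the limits. -/
lemma l2Tendsto_remainder [IsProbabilityMeasure P] (hB : IsRegularBifracBM p K T B P)
    (hp : 1 ≤ p) (hpK : p * K = 1) {ρ : ℝ → ℝ → ℝ} (hρ : Continuous (Function.uncurry ρ)) {C : ℝ}
    (hC : ∀ x y, |ρ x y| ≤ C * |y - x| ^ 3) (hT : 0 < T) {t : ℝ} (ht : 0 ≤ t) :
    L2Tendsto P (fun ε ω => 1 / ε * ∫ s in (0 : ℝ)..min t (T - ε), ρ (B s ω) (B (s + ε) ω))
      fun _ => 0 := by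
  have hm0 := stdMoment_nonneg 3
  refine L2Tendsto.of_integral_sq_le_zero (b := fun ε => T ^ 2 * C ^ 2 * 27 * stdMoment 3 * ε) ?_ ?_
  · have : Continuous fun ε : ℝ => T ^ 2 * C ^ 2 * 27 * stdMoment 3 * ε := by fun_prop
    have h := this.tendsto 0
    simp only [mul_zero] at h
    exact h.mono_left nhdsWithin_le_nhds
  filter_upwards [eventually_mem_Ioo hT] with ε hε
  obtain ⟨hε0, hεT⟩ := hε
  have hτ0 : 0 ≤ min t (T - ε) := le_min ht (by linarith)
  have hτT : min t (T - ε) ≤ T - ε := min_le_right _ _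
  set τ := min t (T - ε)
  have hF : Measurable (Function.uncurry fun ω s => ρ (B s ω) (B (s + ε) ω)) :=
    hρ.measurable.comp (hB.measurable_swap_uncurry.prodMk (hB.measurable_swap_uncurry_add ε))
  have hm : ∀ s ∈ Ioc 0 τ, MemLp (fun ω => ρ (B s ω) (B (s + ε) ω)) 2 P ∧
      ∫ ω, ρ (B s ω) (B (s + ε) ω) ^ 2 ∂P ≤ C ^ 2 * ((3 * ε) ^ 3 * stdMoment 3) := by
    intro s hs
    have hbd : ∀ ω, |ρ (B s ω) (B (s + ε) ω)| ≤ |C * (B (s + ε) ω - B s ω) ^ 3| := fun ω => by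
      rw [abs_mul, abs_pow]
      exact (hC _ _).trans (mul_le_mul_of_nonneg_right (le_abs_self C) (by positivity))
    have m3 := hB.memLp_incr_pow s (s + ε) 3
    have m1 : MemLp (fun ω => ρ (B s ω) (B (s + ε) ω)) 2 P :=
      (m3.const_mul C).mono (hρ.measurable.comp
        ((hB.measurable s).prodMk (hB.measurable (s + ε)))).aestronglyMeasurable
        (ae_of_all _ hbd)
    refine ⟨m1, ?_⟩
    have h6 := hB.integral_incr_pow_le hp hpK hs.1.le (by linarith : s ≤ s + ε)
      (by linarith [hs.2]) 3
    rw [add_sub_cancel_left] at h6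
    calc _ ≤ ∫ ω, C ^ 2 * (B (s + ε) ω - B s ω) ^ (2 * 3) ∂P := by
          have i3 := m3.integrable_sq
          simp_rw [← pow_mul] at i3
          refine integral_mono m1.integrable_sq (i3.const_mul _) fun ω => ?_
          calc ρ (B s ω) (B (s + ε) ω) ^ 2 ≤ (C * (B (s + ε) ω - B s ω) ^ 3) ^ 2 :=
                sq_le_sq.2 (hbd ω)
            _ = _ := by ring
      _ ≤ _ := by rw [integral_const_mul]; gcongr
  obtain ⟨c1, c2⟩ := memLp_intervalIntegral_and_integral_sq_le hF hτ0 (by positivity) hm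
  refine ⟨c1.const_mul _, ?_⟩
  simp_rw [mul_pow]
  rw [integral_const_mul]
  calc _ ≤ (1 / ε) ^ 2 * ((τ - 0) ^ 2 * (C ^ 2 * ((3 * ε) ^ 3 * stdMoment 3))) := by gcongr
    _ ≤ (1 / ε) ^ 2 * (T ^ 2 * (C ^ 2 * ((3 * ε) ^ 3 * stdMoment 3))) := by
      gcongr
      linarith
    _ = _ := by field_simp; ring

lemma l2Tendsto_integral [IsProbabilityMeasure P] (hB : IsRegularBifracBM p K T B P) {g : ℝ → ℝ}
    (hg : Continuous g) {C : ℝ} (hC : ∀ x, |g x| ≤ C) (hT : 0 < T) {t : ℝ} (ht : t ∈ Icc 0 T) :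
    L2Tendsto P (fun ε ω => ∫ s in (0 : ℝ)..min t (T - ε), g (B s ω))
      fun ω => ∫ s in (0 : ℝ)..t, g (B s ω) := by
  have hF : Measurable (Function.uncurry fun ω s => g (B s ω)) :=
    hg.measurable.comp hB.measurable_swap_uncurry
  have hm : ∀ s, MemLp (fun ω => g (B s ω)) 2 P ∧ ∫ ω, g (B s ω) ^ 2 ∂P ≤ C ^ 2 := by
    intro s
    have m1 : MemLp (fun ω => g (B s ω)) 2 P :=
      (memLp_const C).mono (hg.measurable.comp (hB.measurable s)).aestronglyMeasurable
        (ae_of_all _ fun ω => (hC _).trans (le_abs_self C))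
    refine ⟨m1, ?_⟩
    calc _ ≤ ∫ ω, C ^ 2 ∂P := integral_mono m1.integrable_sq (integrable_const _) fun ω =>
          sq_le_sq.2 ((hC _).trans (le_abs_self C))
      _ = _ := by simp
  refine L2Tendsto.of_integral_sq_le
    (memLp_intervalIntegral_and_integral_sq_le hF ht.1 (sq_nonneg C) fun s _ => hm s).1
    (b := fun ε => ε ^ 2 * C ^ 2) ?_ ?_
  · have : Continuous fun ε : ℝ => ε ^ 2 * C ^ 2 := by fun_prop
    have h := this.tendsto 0
    simp only [ne_eq, OfNat.ofNat_ne_zero, not_false_eq_true, zero_pow, zero_mul] at h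
    exact h.mono_left nhdsWithin_le_nhds
  filter_upwards [eventually_mem_Ioo hT] with ε hε
  have hle : t - min t (T - ε) ≤ ε := by
    rcases min_choice t (T - ε) with h | h <;> rw [h] <;> linarith [ht.2, hε.1]
  obtain ⟨c1, c2⟩ := memLp_intervalIntegral_and_integral_sq_le hF (min_le_left t (T - ε))
    (sq_nonneg C) fun s _ => hm s
  have e : ∀ ω, (∫ s in (0 : ℝ)..min t (T - ε), g (B s ω)) - ∫ s in (0 : ℝ)..t, g (B s ω) =
      -1 * ∫ s in (min t (T - ε))..t, g (B s ω) := by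
    intro ω
    have hi := fun a b => (hg.comp (hB.continuous ω)).intervalIntegrable (μ := volume) a b
    have := intervalIntegral.integral_add_adjacent_intervals (hi 0 (min t (T - ε)))
      (hi (min t (T - ε)) t)
    simp only [Function.comp_def] at this
    rw [← this]; ring
  simp_rw [e]
  refine ⟨c1.const_mul _, ?_⟩
  simp_rw [mul_pow]
  rw [integral_const_mul]
  have h0 : 0 ≤ t - min t (T - ε) := sub_nonneg.2 (min_le_left _ _)
  calc _ = ∫ ω, (∫ s in (min t (T - ε))..t, g (B s ω)) ^ 2 ∂P := by norm_num
    _ ≤ _ := c2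
    _ ≤ _ := by gcongr

end IsRegularBifracBM

/-! ### Limits for test functions -/

namespace IsRegularBifracBM

variable {Ω : Type*} [MeasurableSpace Ω] {p K T : ℝ} {B : ℝ → Ω → ℝ} {P : Measure Ω}

/-- The forward integral of `f` is `F(B_t) - F(B_0) - 2 ^ (-K) ∫ f'(B_s) ds`. -/
lemma l2Tendsto_forward_of_isTestFunction [IsProbabilityMeasure P]
    (hB : IsRegularBifracBM p K T B P) (hp : 1 ≤ p) (hp2 : p ≤ 2) (hpK : p * K = 1)
    {F f f' : ℝ → ℝ} {C : ℝ} (hf : IsTestFunction F f f' C) (hT : 0 < T) {t : ℝ}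
    (ht : t ∈ Icc 0 T) :
    ∃ I, L2Tendsto P
      (fun ε ω => 1 / ε * ∫ s in (0 : ℝ)..min t (T - ε), forwardIntegrand B f ε s ω) I := by
  have hc0 := hf.continuous
  have hF0 := hf.continuous_antideriv
  have hc1 := hf.continuous_deriv
  have a1 := hB.l2Tendsto_average hp hpK hF0 hf.abs_antideriv_sub_le (t := t)
    (l := fun ε => min t (T - ε)) (by
      filter_upwards [eventually_mem_Ioo hT] with ε hε
      refine ⟨le_min ht.1 (by linarith [hε.2]), min_le_left _ _, ?_, ?_⟩
      · rcases min_choice t (T - ε) with h | h <;> rw [h] <;> linarith [ht.2, hε.1]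
      · linarith [min_le_right t (T - ε)])
  have a2 := hB.l2Tendsto_average hp hpK hF0 hf.abs_antideriv_sub_le (t := 0)
    (l := fun ε => 0) (by
      filter_upwards [eventually_mem_Ioo hT] with ε hε
      exact ⟨le_rfl, le_rfl, by linarith [hε.1], by linarith [hε.2]⟩)
  have a3 := hB.l2Tendsto_quadVar hp hp2 hpK hc1.measurable hf.abs_deriv_le hT ht.1
  have a4 := hB.l2Tendsto_integral hc1 hf.abs_deriv_le hT ht
  have a5 := hB.l2Tendsto_remainder hp hpK
    (ρ := fun x y => F y - F x - f x * (y - x) - 1 / 2 * (f' x * (y - x) ^ 2))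
    (by
      have : Function.uncurry
          (fun x y => F y - F x - f x * (y - x) - 1 / 2 * (f' x * (y - x) ^ 2)) =
        fun z : ℝ × ℝ => F z.2 - F z.1 - f z.1 * (z.2 - z.1) -
          1 / 2 * (f' z.1 * (z.2 - z.1) ^ 2) := rfl
      rw [this]; fun_prop)
    hf.abs_antideriv_taylor_le hT ht.1
  refine ⟨_, ((((a1.sub a2).sub (a3.const_mul (1 / 2))).sub
    (a4.const_mul (1 / 2 ^ K))).sub a5).congr' ?_⟩
  filter_upwards [self_mem_nhdsWithin] with ε hε
  have hε : (0 : ℝ) < ε := hε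
  refine ae_of_all _ fun ω => ?_
  set τ := min t (T - ε)
  have hBc := hB.continuous ω
  have hBc' : Continuous fun s => B (s + ε) ω := hBc.comp (continuous_add_const ε)
  have iF : ∀ a b, IntervalIntegrable (fun s => F (B s ω)) volume a b := fun a b =>
    (hF0.comp hBc).intervalIntegrable a b
  have iF' : ∀ a b, IntervalIntegrable (fun s => F (B (s + ε) ω)) volume a b := fun a b =>
    (hF0.comp hBc').intervalIntegrable a b
  have iq : IntervalIntegrable (fun s => quadVarIntegrand K B f' ε s ω) volume 0 τ := by
    apply Continuous.intervalIntegrable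
    unfold quadVarIntegrand
    fun_prop
  have ii : IntervalIntegrable (fun s => f' (B s ω)) volume 0 τ :=
    (hc1.comp hBc).intervalIntegrable _ _
  have ir : IntervalIntegrable (fun s => F (B (s + ε) ω) - F (B s ω) -
      f (B s ω) * (B (s + ε) ω - B s ω) -
      1 / 2 * (f' (B s ω) * (B (s + ε) ω - B s ω) ^ 2)) volume 0 τ := by
    apply Continuous.intervalIntegrable
    fun_prop
  have hdec : ∀ s, forwardIntegrand B f ε s ω = (F (B (s + ε) ω) - F (B s ω)) -
      1 / 2 * quadVarIntegrand K B f' ε s ω - 1 / 2 ^ K * ε * f' (B s ω) -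
      (F (B (s + ε) ω) - F (B s ω) - f (B s ω) * (B (s + ε) ω - B s ω) -
        1 / 2 * (f' (B s ω) * (B (s + ε) ω - B s ω) ^ 2)) := by
    intro s
    simp only [forwardIntegrand, quadVarIntegrand]
    ring
  -- the increments of `F` telescope to averages over the two ends of the interval
  have htel : (∫ s in (0 : ℝ)..τ, F (B (s + ε) ω)) - ∫ s in (0 : ℝ)..τ, F (B s ω) =
      (∫ s in τ..τ + ε, F (B s ω)) - ∫ s in (0 : ℝ)..(0 + ε), F (B s ω) := by
    rw [intervalIntegral.integral_comp_add_right (fun s => F (B s ω))]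
    have e1 := intervalIntegral.integral_add_adjacent_intervals (iF 0 (0 + ε)) (iF (0 + ε) (τ + ε))
    have e2 := intervalIntegral.integral_add_adjacent_intervals (iF 0 τ) (iF τ (τ + ε))
    linarith
  simp_rw [hdec]
  rw [intervalIntegral.integral_sub ((((iF' _ _).sub (iF _ _)).sub (iq.const_mul _)).sub
      (ii.const_mul _)) ir,
    intervalIntegral.integral_sub (((iF' _ _).sub (iF _ _)).sub (iq.const_mul _)) (ii.const_mul _),
    intervalIntegral.integral_sub ((iF' _ _).sub (iF _ _)) (iq.const_mul _),
    intervalIntegral.integral_sub (iF' _ _) (iF _ _), htel,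
    intervalIntegral.integral_const_mul, intervalIntegral.integral_const_mul]
  field_simp

/-- The quadratic covariation of `f(B)` and `B` is `2 ^ (1 - K) ∫ f'(B_s) ds`. -/
lemma l2Tendsto_covariation_of_isTestFunction [IsProbabilityMeasure P]
    (hB : IsRegularBifracBM p K T B P) (hp : 1 ≤ p) (hp2 : p ≤ 2) (hpK : p * K = 1)
    {F f f' : ℝ → ℝ} {C : ℝ} (hf : IsTestFunction F f f' C) (hT : 0 < T) {t : ℝ}
    (ht : t ∈ Icc 0 T) :
    ∃ I, L2Tendsto P
      (fun ε ω => 1 / ε * ∫ s in (0 : ℝ)..min t (T - ε), covariationIntegrand B f ε s ω) I := by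
  have hc0 := hf.continuous
  have hc1 := hf.continuous_deriv
  have a3 := hB.l2Tendsto_quadVar hp hp2 hpK hc1.measurable hf.abs_deriv_le hT ht.1
  have a4 := hB.l2Tendsto_integral hc1 hf.abs_deriv_le hT ht
  have a5 := hB.l2Tendsto_remainder hp hpK
    (ρ := fun x y => (f y - f x - f' x * (y - x)) * (y - x))
    (by
      have : Function.uncurry (fun x y => (f y - f x - f' x * (y - x)) * (y - x)) =
        fun z : ℝ × ℝ => (f z.2 - f z.1 - f' z.1 * (z.2 - z.1)) * (z.2 - z.1) := rfl
      rw [this]; fun_prop)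
    (fun x y => by
      rw [abs_mul]
      calc _ ≤ C * |y - x| ^ 2 * |y - x| := by gcongr; exact hf.abs_sub_le x y
        _ = _ := by ring) hT ht.1
  refine ⟨_, ((a3.add (a4.const_mul (2 * (1 / 2 ^ K)))).add a5).congr' ?_⟩
  filter_upwards [self_mem_nhdsWithin] with ε hε
  have hε : (0 : ℝ) < ε := hε
  refine ae_of_all _ fun ω => ?_
  set τ := min t (T - ε)
  have hBc := hB.continuous ω
  have hBc' : Continuous fun s => B (s + ε) ω := hBc.comp (continuous_add_const ε)
  have iq : IntervalIntegrable (fun s => quadVarIntegrand K B f' ε s ω) volume 0 τ := by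
    apply Continuous.intervalIntegrable
    unfold quadVarIntegrand
    fun_prop
  have ii : IntervalIntegrable (fun s => f' (B s ω)) volume 0 τ :=
    (hc1.comp hBc).intervalIntegrable _ _
  have ir : IntervalIntegrable (fun s => (f (B (s + ε) ω) - f (B s ω) -
      f' (B s ω) * (B (s + ε) ω - B s ω)) * (B (s + ε) ω - B s ω)) volume 0 τ := by
    apply Continuous.intervalIntegrable
    fun_prop
  have hdec : ∀ s, covariationIntegrand B f ε s ω = quadVarIntegrand K B f' ε s ω +
      2 * (1 / 2 ^ K) * ε * f' (B s ω) +
      (f (B (s + ε) ω) - f (B s ω) - f' (B s ω) * (B (s + ε) ω - B s ω)) *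
        (B (s + ε) ω - B s ω) := by
    intro s
    simp only [covariationIntegrand, quadVarIntegrand]
    ring
  simp_rw [hdec]
  rw [intervalIntegral.integral_add (iq.add (ii.const_mul _)) ir,
    intervalIntegral.integral_add iq (ii.const_mul _), intervalIntegral.integral_const_mul]
  field_simp

end IsRegularBifracBM

/-! ### Limits for all functions of finite norm -/

section Density

variable {T : ℝ}

/-- The norm of `𝓗` is a multiple of the `L²` norm for the Gaussian law of variance `T`. -/
lemma eNormSqH_eq_eLpNorm {f : ℝ → ℝ} (hf : Measurable f) (hT : 0 < T) :
    eNormSqH T f = ENNReal.ofReal (2 * T) * eLpNorm f 2 (gaussianReal 0 T.toNNReal) ^ 2 := by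
  rw [eNormSqH_eq_gaussianReal hf hT]
  congr 1
  have h := eLpNorm_nnreal_pow_eq_lintegral (μ := gaussianReal 0 T.toNNReal) (f := f) (p := 2)
    (by norm_num)
  simp only [NNReal.coe_ofNat, ENNReal.coe_ofNat, ENNReal.rpow_ofNat] at h
  rw [h]
  refine lintegral_congr fun x => ?_
  rw [Real.enorm_eq_ofReal_abs, ← ENNReal.ofReal_pow (abs_nonneg _), sq_abs]

lemma exists_contDiff_eNormSqH_sub_le {f : ℝ → ℝ} (hf : Measurable f) (hT : 0 < T)
    (hfin : eNormSqH T f < ⊤) {η : ENNReal} (hη : 0 < η) :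
    ∃ h : ℝ → ℝ, HasCompactSupport h ∧ ContDiff ℝ 2 h ∧ eNormSqH T (f - h) ≤ η := by
  have hT2 : ENNReal.ofReal (2 * T) ≠ 0 := by simp [hT]
  have hm : MemLp f 2 (gaussianReal 0 T.toNNReal) := by
    refine ⟨hf.aestronglyMeasurable, ?_⟩
    rw [eNormSqH_eq_eLpNorm hf hT] at hfin
    by_contra h
    rw [not_lt, top_le_iff] at h
    rw [h, ENNReal.top_pow (by norm_num), ENNReal.mul_top hT2] at hfin
    exact lt_irrefl _ hfin
  obtain ⟨c, hc0, hc⟩ : ∃ c : ℝ, 0 < c ∧ ENNReal.ofReal (2 * T) * ENNReal.ofReal c ^ 2 ≤ η := by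
    rcases eq_or_ne η ⊤ with rfl | hη'
    · exact ⟨1, one_pos, le_top⟩
    · have h1 : 0 < η.toReal := ENNReal.toReal_pos hη.ne' hη'
      refine ⟨√(η.toReal / (2 * T)), by positivity, ?_⟩
      rw [← ENNReal.ofReal_pow (Real.sqrt_nonneg _), Real.sq_sqrt (by positivity),
        ← ENNReal.ofReal_mul (by positivity), mul_div_cancel₀ _ (by positivity),
        ENNReal.ofReal_toReal hη']
  obtain ⟨h, h1, h2, h3⟩ := hm.exist_eLpNorm_sub_le (by norm_num) (by norm_num) hc0
  refine ⟨h, h1, contDiff_infty.1 h2 2, ?_⟩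
  rw [eNormSqH_eq_eLpNorm (hf.sub h2.continuous.measurable) hT]
  exact le_trans (by gcongr) hc

end Density

lemma IsBoundedApprox.eLpNorm_le {Ω : Type*} [MeasurableSpace Ω] {P : Measure Ω} {T : ℝ}
    {g : ℝ → ℝ → Ω → ℝ} {t ε : ℝ} {M : ENNReal}
    (h : IsBoundedApprox P T g t ε M) (hM : M ≠ ⊤) :
    eLpNorm (fun ω => 1 / ε * ∫ s in (0 : ℝ)..min t (T - ε), g ε s ω) 2 P ≤
      ENNReal.ofReal √M.toReal := by
  rw [eLpNorm_two_eq h.2.1]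
  refine ENNReal.ofReal_le_ofReal (Real.sqrt_le_sqrt ?_)
  exact (ENNReal.ofReal_le_iff_le_toReal hM).1 h.2.2

section Limits

variable {Ω : Type*} [MeasurableSpace Ω] {P : Measure Ω} {T : ℝ}

/-- Existence of the regularized limits for all functions of finite norm, from a uniform bound and
their existence for test functions. -/
lemma exists_isRegularizedLimit {Φ : (ℝ → ℝ) → ℝ → ℝ → Ω → ℝ}
    (hsub : ∀ f h ε s ω, Φ (f - h) ε s ω = Φ f ε s ω - Φ h ε s ω) (hT : 0 < T) {t : ℝ}
    (hbound : ∀ f, Measurable f → eNormSqH T f < ⊤ → ∀ ε, 0 < ε → ε < T →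
      IsBoundedApprox P T (Φ f) t ε (1240 * eNormSqH T f))
    (htest : ∀ F f f' C, IsTestFunction F f f' C → ∃ I, L2Tendsto P
      (fun ε ω => 1 / ε * ∫ s in (0 : ℝ)..min t (T - ε), Φ f ε s ω) I)
    {f : ℝ → ℝ} (hf : Measurable f) (hfin : eNormSqH T f < ⊤) :
    ∃ I, IsRegularizedLimit P T (Φ f) t I ∧ ∫ ω, |I ω| ^ 2 ∂P ≤ 1240 * normH T f ^ 2 := by
  have hb : ∀ᶠ ε in 𝓝[>] (0 : ℝ), IsBoundedApprox P T (Φ f) t ε (1240 * eNormSqH T f) :=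
    (IsRegularBifracBM.eventually_mem_Ioo hT).mono fun ε hε => hbound f hf hfin ε hε.1 hε.2
  have hMtop : 1240 * eNormSqH T f ≠ ⊤ := ENNReal.mul_ne_top (by simp) hfin.ne
  obtain ⟨I, hI⟩ : ∃ I, L2Tendsto P
      (fun ε ω => 1 / ε * ∫ s in (0 : ℝ)..min t (T - ε), Φ f ε s ω) I := by
    refine exists_l2Tendsto (hb.mono fun ε h => h.2.1) fun δ hδ => ?_
    obtain ⟨η, hη0, hη⟩ : ∃ η : ENNReal, 0 < η ∧
        (η ≠ ⊤ ∧ ENNReal.ofReal √(1240 * η).toReal ≤ δ) := by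
      rcases eq_or_ne δ ⊤ with rfl | hδ'
      · exact ⟨1, one_pos, by simp, le_top⟩
      · refine ⟨ENNReal.ofReal (δ.toReal ^ 2 / 1240), ?_, ENNReal.ofReal_ne_top, ?_⟩
        · have := ENNReal.toReal_pos hδ.ne' hδ'
          rw [ENNReal.ofReal_pos]; positivity
        · rw [ENNReal.toReal_mul, ENNReal.toReal_ofReal (by positivity), ENNReal.toReal_ofNat,
            mul_div_cancel₀ _ (by norm_num), Real.sqrt_sq ENNReal.toReal_nonneg,
            ENNReal.ofReal_toReal hδ']
    -- linearity turns the distance to the approximation of `h` into the approximation of `f - h`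
    obtain ⟨h, h1, h2, h3⟩ := exists_contDiff_eNormSqH_sub_le hf hT hfin hη0
    obtain ⟨F, h', C, hC⟩ := exists_isTestFunction h2 h1
    obtain ⟨J, hJ⟩ := htest F h h' C hC
    refine ⟨_, J, hJ, ?_⟩
    have hfh : Measurable (f - h) := hf.sub h2.continuous.measurable
    have hfin' : eNormSqH T (f - h) < ⊤ := h3.trans_lt hη.1.lt_top
    filter_upwards [IsRegularBifracBM.eventually_mem_Ioo hT] with ε hε
    have b1 := hbound f hf hfin ε hε.1 hε.2
    have b2 := hbound (f - h) hfh hfin' ε hε.1 hε.2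
    have hle := b2.eLpNorm_le (ENNReal.mul_ne_top (by simp) hfin'.ne)
    refine le_trans (le_of_eq (eLpNorm_congr_ae ?_)) (hle.trans (le_trans ?_ hη.2))
    · filter_upwards [b1.1, b2.1] with ω i1 i2
      have e : (fun s => Φ h ε s ω) = fun s => Φ f ε s ω - Φ (f - h) ε s ω := by
        ext s; rw [hsub]; ring
      rw [e, intervalIntegral.integral_sub i1 i2]
      ring
    · refine ENNReal.ofReal_le_ofReal (Real.sqrt_le_sqrt (ENNReal.toReal_mono
        (ENNReal.mul_ne_top (by simp) hη.1) ?_))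
      gcongr
  refine ⟨I, ⟨hb.mono fun ε h => ⟨h.1, h.2.1⟩, hI.2⟩, ?_⟩
  have h := hI.eLpNorm_le (hb.mono fun ε h => h.eLpNorm_le hMtop)
  rw [eLpNorm_two_eq hI.2.1, ENNReal.ofReal_le_ofReal_iff (Real.sqrt_nonneg _),
    Real.sqrt_le_sqrt_iff ENNReal.toReal_nonneg] at h
  simp_rw [sq_abs]
  rw [normH, Real.sq_sqrt ENNReal.toReal_nonneg]
  simpa using h

namespace IsRegularBifracBM

variable {p K : ℝ} {B : ℝ → Ω → ℝ}

/-- The limits and their bounds for a regular bi-fractional Brownian motion and a Borel function. -/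
lemma exists_limits [IsProbabilityMeasure P] (hB : IsRegularBifracBM p K T B P) (hp : 1 ≤ p)
    (hp2 : p ≤ 2) (hpK : p * K = 1) (hT : 0 < T) {t : ℝ} (ht : t ∈ Icc 0 T) {f : ℝ → ℝ}
    (hf : Measurable f) (hfin : eNormSqH T f < ⊤) :
    ∃ Im Ip Q, IsForwardIntegral P T B f t Im ∧ IsBackwardIntegral P T B f t Ip ∧
      IsQuadraticCovariation P T B f t Q ∧
      ∫ ω, |Im ω| ^ 2 ∂P ≤ 1240 * normH T f ^ 2 ∧ ∫ ω, |Ip ω| ^ 2 ∂P ≤ 1240 * normH T f ^ 2 := by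
  obtain ⟨Im, m1, m2⟩ := exists_isRegularizedLimit (P := P) (Φ := forwardIntegrand B) (T := T)
      (t := t)
    (fun f h ε s ω => by simp only [forwardIntegrand, Pi.sub_apply]; ring) hT
    (fun f hf hfin ε hε hεT => hB.forward_bound hp hp2 hpK hf hT hfin ht.1 hε hεT)
    (fun F f f' C hC => hB.l2Tendsto_forward_of_isTestFunction hp hp2 hpK hC hT ht) hf hfin
  obtain ⟨Ip, p1, p2⟩ := exists_isRegularizedLimit (P := P) (Φ := backwardIntegrand B) (T := T)
      (t := t)
    (fun f h ε s ω => by simp only [backwardIntegrand, Pi.sub_apply]; ring) hT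
    (fun f hf hfin ε hε hεT => hB.backward_bound hp hp2 hpK hf hT hfin ht.1 hε hεT)
    (fun F f f' C hC => by
      obtain ⟨I, hI⟩ := hB.l2Tendsto_forward_of_isTestFunction hp hp2 hpK hC hT ht
      obtain ⟨J, hJ⟩ := hB.l2Tendsto_covariation_of_isTestFunction hp hp2 hpK hC hT ht
      refine ⟨_, (hI.add hJ).congr' (Eventually.of_forall fun ε => ae_of_all _ fun ω => ?_)⟩
      have hBc := hB.continuous ω
      have hBc' : Continuous fun s => B (s + ε) ω := hBc.comp (continuous_add_const ε)
      have hfc := hC.continuous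
      beta_reduce
      rw [← mul_add, ← intervalIntegral.integral_add
        (Continuous.intervalIntegrable (by unfold forwardIntegrand; fun_prop) _ _)
        (Continuous.intervalIntegrable (by unfold covariationIntegrand; fun_prop) _ _)]
      congr 2
      ext s
      simp only [forwardIntegrand, backwardIntegrand, covariationIntegrand]
      ring) hf hfin
  have e : ∀ ε s ω, covariationIntegrand B f ε s ω =
      backwardIntegrand B f ε s ω - forwardIntegrand B f ε s ω := fun ε s ω => by
    simp only [forwardIntegrand, backwardIntegrand, covariationIntegrand]; ring
  have hlin : ∀ᶠ ε in 𝓝[>] (0 : ℝ),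
      (∀ᵐ ω ∂P, IntervalIntegrable (fun s => covariationIntegrand B f ε s ω) volume 0
        (min t (T - ε))) ∧
      (fun ω => 1 / ε * (∫ s in (0 : ℝ)..min t (T - ε), backwardIntegrand B f ε s ω) -
        1 / ε * ∫ s in (0 : ℝ)..min t (T - ε), forwardIntegrand B f ε s ω) =ᵐ[P]
      fun ω => 1 / ε * ∫ s in (0 : ℝ)..min t (T - ε), covariationIntegrand B f ε s ω := by
    filter_upwards [m1.1, p1.1] with ε h1 h2
    refine ⟨?_, ?_⟩
    · filter_upwards [h1.1, h2.1] with ω i1 i2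
      simp_rw [e]
      exact i2.sub i1
    · filter_upwards [h1.1, h2.1] with ω i1 i2
      simp_rw [e]
      rw [intervalIntegral.integral_sub i2 i1, mul_sub]
  have hQ := L2Tendsto.congr' (L2Tendsto.sub ⟨p1.1.mono fun ε h => h.2, p1.2⟩
    ⟨m1.1.mono fun ε h => h.2, m1.2⟩) (hlin.mono fun ε h => h.2)
  exact ⟨Im, Ip, _, m1, p1, ⟨(hlin.and hQ.1).mono fun ε h => ⟨h.1.1, h.2⟩, hQ.2⟩, m2, p2⟩

end IsRegularBifracBM

end Limits

/-! ### Regular versions and functions defined up to null sets -/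

section Transfer

variable {Ω : Type*} [MeasurableSpace Ω] {P : Measure Ω}

/-- A bi-fractional Brownian motion has a version all of whose paths are continuous and all of
whose variables are measurable; it is frozen outside the time interval. -/
lemma exists_isRegularBifracBM [IsProbabilityMeasure P] {H K T : ℝ} (hHK : 2 * H * K = 1)
    (hT : 0 < T) {B : ℝ → Ω → ℝ} (hB : IsBifractionalBM H K T B P) :
    ∃ B' : ℝ → Ω → ℝ, IsRegularBifracBM (2 * H) K T B' P ∧
      ∀ᵐ ω ∂P, ∀ s ∈ Icc 0 T, B' s ω = B s ω := by
  classical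
  have hne : Nonempty (Icc (0 : ℝ) T) := ⟨⟨0, le_rfl, hT.le⟩⟩
  set D : ℕ → Icc (0 : ℝ) T := TopologicalSpace.denseSeq (Icc (0 : ℝ) T) with hD
  have hDd : DenseRange D := TopologicalSpace.denseRange_denseSeq _
  have hae : ∀ d : Icc (0 : ℝ) T, AEMeasurable (B d) P := hB.isGaussian.aemeasurable
  have hgood : ∀ᵐ ω ∂P, ContinuousOn (fun t => B t ω) (Icc 0 T) ∧
      ∀ n, B (D n) ω = (hae (D n)).mk _ ω :=
    hB.continuous_paths.and (ae_all_iff.2 fun n => (hae (D n)).ae_eq_mk)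
  obtain ⟨N, hN, hNm, hN0⟩ := exists_measurable_superset_of_null hgood
  have hG : ∀ ω ∉ N, ContinuousOn (fun t => B t ω) (Icc 0 T) ∧
      ∀ n, B (D n) ω = (hae (D n)).mk _ ω := fun ω hω => by
    by_contra h
    exact hω (hN h)
  have hNae : ∀ᵐ ω ∂P, ω ∉ N := measure_eq_zero_iff_ae_notMem.1 hN0
  set B' : ℝ → Ω → ℝ := fun s ω => if ω ∈ N then 0 else B (projIcc 0 T hT.le s) ω with hB'
  have hBB' : ∀ s, B (projIcc 0 T hT.le s) =ᵐ[P] B' s := fun s => by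
    filter_upwards [hNae] with ω hω
    simp [hB', hω]
  have hBB'' : ∀ s ∈ Icc 0 T, B' s =ᵐ[P] B s := fun s hs => by
    have := (hBB' s).symm
    rwa [projIcc_of_mem _ hs] at this
  refine ⟨B', ⟨?_, ?_, ?_, ?_, ?_⟩, ?_⟩
  · exact (hB.isGaussian.comp_right (projIcc 0 T hT.le)).congr hBB'
  · intro t
    rw [← integral_congr_ae (hBB' t)]
    exact hB.centered _ (projIcc 0 T hT.le t).2
  · intro s hs t ht
    have h1 : ∫ ω, B' s ω * B' t ω ∂P = ∫ ω, B s ω * B t ω ∂P := by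
      refine integral_congr_ae ?_
      filter_upwards [hBB'' s hs, hBB'' t ht] with ω e1 e2
      rw [e1, e2]
    rw [h1, hB.covariance t ht s hs, hHK, Real.rpow_one, bifracCov, powSum, abs_sub_comm]
  · -- the value at a time is the limit of measurable functions along a dense sequence of times
    intro s
    obtain ⟨x, hx, hxs⟩ := mem_closure_iff_seq_limit.1 (hDd (projIcc 0 T hT.le s))
    choose n hn using hx
    refine measurable_of_tendsto_metrizable
      (f := fun k ω => if ω ∈ N then 0 else (hae (D (n k))).mk _ ω) (fun k =>
        Measurable.ite hNm measurable_const (hae (D (n k))).measurable_mk) ?_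
    rw [tendsto_pi_nhds]
    intro ω
    by_cases hω : ω ∈ N
    · simp [hB', hω]
    · obtain ⟨h1, h2⟩ := hG ω hω
      simp only [hB', hω, if_false, ← h2]
      have h3 := (continuousOn_iff_continuous_domRestrict.1 h1).tendsto (projIcc 0 T hT.le s)
      have h4 := h3.comp hxs
      refine h4.congr fun k => ?_
      simp only [Function.comp_apply, domRestrict_apply, hn]
  · intro ω
    by_cases hω : ω ∈ N
    · simp only [hB', hω, if_true]
      exact continuous_const
    · simp only [hB', hω, if_false]
      exact (continuousOn_iff_continuous_domRestrict.1 (hG ω hω).1).comp continuous_projIcc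
  · filter_upwards [hNae] with ω hω s hs
    simp [hB', hω, projIcc_of_mem _ hs]

lemma eNormSqH_congr {T : ℝ} {f g : ℝ → ℝ} (h : f =ᵐ[volume] g) : eNormSqH T f = eNormSqH T g := by
  unfold eNormSqH
  congr 1 <;> refine lintegral_congr fun s => lintegral_congr_ae ?_ <;>
    filter_upwards [h] with x hx <;> rw [hx]

/-- The process spends almost surely no time in Lebesgue null sets. -/
lemma IsRegularBifracBM.ae_ae_notMem [IsProbabilityMeasure P] {p K T : ℝ} {B : ℝ → Ω → ℝ}
    (hB : IsRegularBifracBM p K T B P) (hpK : p * K = 1) {N : Set ℝ} (hN : MeasurableSet N)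
    (hN0 : volume N = 0) {ε : ℝ} (hε : 0 ≤ ε) :
    ∀ᵐ ω ∂P, ∀ᵐ s ∂volume.restrict (Ioc 0 (T - ε)), B (s + ε) ω ∉ N := by
  have hm : MeasurableSet {z : Ω × ℝ | B (z.2 + ε) z.1 ∉ N} :=
    (hB.measurable_swap_uncurry_add ε) hN.compl
  rw [Measure.ae_ae_comm hm]
  filter_upwards [ae_restrict_mem measurableSet_Ioc] with s hs
  have h0 : P.map (B (s + ε)) N = 0 := by
    rw [hB.map_eq hpK ⟨by linarith [hs.1], by linarith [hs.2]⟩]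
    refine gaussianReal_absolutelyContinuous 0 ?_ hN0
    have : 0 < s + ε := by linarith [hs.1]
    simpa using this
  rw [Measure.map_apply (hB.measurable _) hN] at h0
  exact measure_eq_zero_iff_ae_notMem.1 h0

/-- A regularized limit depends on the integrand only up to null sets of times. -/
lemma IsRegularizedLimit.congr {T t : ℝ} (hT : 0 < T) (ht : 0 ≤ t) {g g' : ℝ → ℝ → Ω → ℝ}
    {I : Ω → ℝ} (hg : IsRegularizedLimit P T g t I)
    (h : ∀ ε, 0 < ε → ε < T →
      ∀ᵐ ω ∂P, ∀ᵐ s ∂volume.restrict (Ioc 0 (T - ε)), g ε s ω = g' ε s ω) :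
    IsRegularizedLimit P T g' t I := by
  have hint : ∀ ε, 0 < ε → ε < T → ∀ᵐ ω ∂P, ∀ᵐ s ∂volume.restrict (uIoc 0 (min t (T - ε))),
      g ε s ω = g' ε s ω := by
    intro ε h1 h2
    filter_upwards [h ε h1 h2] with ω hω
    rw [uIoc_of_le (le_min ht (by linarith))]
    exact ae_mono (Measure.restrict_mono (Ioc_subset_Ioc_right (min_le_right _ _)) le_rfl) hω
  have hae : ∀ ε, 0 < ε → ε < T →
      (fun ω => 1 / ε * ∫ s in (0 : ℝ)..min t (T - ε), g ε s ω) =ᵐ[P]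
        fun ω => 1 / ε * ∫ s in (0 : ℝ)..min t (T - ε), g' ε s ω := by
    intro ε h1 h2
    filter_upwards [hint ε h1 h2] with ω hω
    rw [intervalIntegral.integral_congr_ae_restrict hω]
  have hev := IsRegularBifracBM.eventually_mem_Ioo hT
  refine ⟨?_, ?_⟩
  · filter_upwards [hg.1, hev] with ε h1 h2
    refine ⟨?_, h1.2.ae_eq (hae ε h2.1 h2.2)⟩
    filter_upwards [h1.1, hint ε h2.1 h2.2] with ω i1 i2
    exact i1.congr_ae i2
  · exact (L2Tendsto.congr' ⟨hg.1.mono fun ε h => h.2, hg.2⟩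
      (hev.mono fun ε h2 => hae ε h2.1 h2.2)).2

end Transfer

theorem mainTheorem3 (H K : ℝ) (hH : H ∈ Set.Ioo (0 : ℝ) 1) (hK : K ∈ Set.Ioc (0 : ℝ) 1)
    (hHK : 2 * H * K = 1) :
    ∃ C : ℝ, 0 < C ∧
      ∀ (T : ℝ), 0 < T →
      ∀ (Ω : Type*) [MeasurableSpace Ω] (P : Measure Ω) [IsProbabilityMeasure P]
        (B : ℝ → Ω → ℝ), IsBifractionalBM H K T B P →
      ∀ f : ℝ → ℝ, MemH T f →
      ∀ t ∈ Set.Icc (0 : ℝ) T,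
        ∃ Im Ip Q : Ω → ℝ,
          IsForwardIntegral P T B f t Im ∧
          IsBackwardIntegral P T B f t Ip ∧
          IsQuadraticCovariation P T B f t Q ∧
          ∫ ω, |Im ω| ^ 2 ∂P ≤ C * normH T f ^ 2 ∧
          ∫ ω, |Ip ω| ^ 2 ∂P ≤ C * normH T f ^ 2 := by
  refine ⟨1240, by norm_num, ?_⟩
  intro T hT Ω _ P _ B hB f hf t ht
  obtain ⟨B', hB', hBB'⟩ := exists_isRegularBifracBM hHK hT hB
  obtain ⟨⟨f', hf'm, hff'⟩, hfin⟩ := hf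
  have hnorm : eNormSqH T f = eNormSqH T f' := eNormSqH_congr hff'
  obtain ⟨Im, Ip, Q, m, q, c, bm, bq⟩ := hB'.exists_limits (p := 2 * H) (by nlinarith [hK.1, hK.2])
    (by linarith [hH.2]) hHK hT ht hf'm (hnorm ▸ hfin)
  -- the exceptional set of `f` and its Borel version is avoided at almost every time
  obtain ⟨N, hN, hNm, hN0⟩ := exists_measurable_superset_of_null hff'
  have hfN : ∀ x ∉ N, f' x = f x := fun x hx => by
    by_contra h
    exact hx (hN fun h' => h h'.symm)
  have key : ∀ ε, 0 < ε → ε < T → ∀ᵐ ω ∂P, ∀ᵐ s ∂volume.restrict (Ioc 0 (T - ε)),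
      B' s ω = B s ω ∧ B' (s + ε) ω = B (s + ε) ω ∧ f' (B s ω) = f (B s ω) ∧
        f' (B (s + ε) ω) = f (B (s + ε) ω) := by
    intro ε h1 h2
    filter_upwards [hBB', hB'.ae_ae_notMem hHK hNm hN0 le_rfl, hB'.ae_ae_notMem hHK hNm hN0 h1.le]
      with ω e1 e2 e3
    rw [sub_zero] at e2
    have e2' := ae_mono (Measure.restrict_mono (Ioc_subset_Ioc_right (by linarith : T - ε ≤ T))
      le_rfl) e2
    filter_upwards [e2', e3, ae_restrict_mem measurableSet_Ioc] with s e4 e5 hs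
    have e6 := e1 s ⟨hs.1.le, by linarith [hs.2]⟩
    have e7 := e1 (s + ε) ⟨by linarith [hs.1], by linarith [hs.2]⟩
    rw [add_zero, e6] at e4
    rw [e7] at e5
    exact ⟨e6, e7, hfN _ e4, hfN _ e5⟩
  have hnH : normH T f' = normH T f := by rw [normH, normH, hnorm]
  rw [hnH] at bm bq
  refine ⟨Im, Ip, Q, m.congr hT ht.1 ?_, q.congr hT ht.1 ?_, c.congr hT ht.1 ?_, bm, bq⟩ <;>
  · intro ε h1 h2
    filter_upwards [key ε h1 h2] with ω hω
    filter_upwards [hω] with s hs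
    simp only [forwardIntegrand, backwardIntegrand, covariationIntegrand, hs.1, hs.2.1, hs.2.2.1,
      hs.2.2.2]
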